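/- Let $S$ be a finite set of at least two items, $\bot$ a symbol that is not an item, $p$ a number of processes and $\varphi\ge 1$ an integer. The algorithm DMTF represents $S$ by a doubly linked list. Each node has fields $item$ (never changed), $next$, $prev$, $old$, $new$. A compare-and-swap (CAS) object $Head$ holds pointers to the first and second nodes of the list, and each process $p_i$ has a CAS object $A[i]$ holding a pair. $\mathrm{CAS}(O,x,y)$ atomically replaces the value of $O$ by $y$ if it equals $x$, and returns the value that $O$ had immediately before. Initially the list has exactly one node for each item of $S$, in some order and correctly linked, $old=\mathrm{DONE}$ and $new=\mathrm{NULL}$ in each of them, $A[i]=(\mathrm{NULL},\bot)$ for all $i$, and no process is performing an operation. The $p$ processes run asynchronously; each step makes at most one access to shared memory, steps are interleaved arbitrarily, processes may crash (stop for ever), and each process may at any time when it is not performing an operation invoke $\mathrm{SEARCH}(e)$ for any item $e$, in $S$ or not. Allocated nodes are always new. The code is as follows. $\mathrm{SEARCH}(e)$ by $p_i$: 1. Let $g$ point to a newly allocated node with $item=e$ and all other fields $\mathrm{NULL}$. $\mathrm{CAS}(A[i],(\mathrm{NULL},\bot),(g,e))$. $(h_1,h)\leftarrow Head$. 2. If $h_1.item=e$: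 $(a,b)\leftarrow \mathrm{CAS}(A[i],(g,e),(\mathrm{NULL},\bot))$; if $b=\bot$ then $\mathrm{CAS}(A[i],(a,b),(\mathrm{NULL},\bot))$; return $h_1$. 3. $c\leftarrow 0$. While $h\ne\mathrm{NULL}$: (i) if $h.item=e$: $(a,b)\leftarrow A[i]$; if $b=\bot$ then $\mathrm{CAS}(A[i],(a,b),(\mathrm{NULL},\bot))$ and return $a$; otherwise $\mathrm{CAS}(g.old,\mathrm{NULL},h)$; $\mathrm{CAS}(h.new,\mathrm{NULL},g)$; $g'\leftarrow h.new$; if $g'\ne\mathrm{GONE}$ then MOVE-TO-FRONT$(g')$; $(a,b)\leftarrow A[i]$; $\mathrm{CAS}(A[i],(a,b),(\mathrm{NULL},\bot))$; return $a$; (ii) $c\leftarrow (c+1)\bmod\varphi$; if $c=0$: $(a,b)\leftarrow A[i]$, and if $b=\bot$ then $\mathrm{CAS}(A[i],(a,b),(\mathrm{NULL},\bot))$ and return $a$; (iii) $h\leftarrow h.next$. 4. $(a,b)\leftarrow A[i]$; $\mathrm{CAS}(A[i],(a,b),(\mathrm{NULL},\bot))$; if $b=\bot$ return $a$, else return NOT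 PRESENT. MOVE-TO-FRONT$(g')$: while $g'.old\ne\mathrm{DONE}$: $(h_1,h_2)\leftarrow Head$; $h'\leftarrow h_1.old$. If $h'=\mathrm{DONE}$: if $g'.old\ne\mathrm{DONE}$ then $\mathrm{CAS}(Head,(h_1,h_2),(g',h_1))$. Otherwise: $\mathrm{CAS}(h_1.next,\mathrm{NULL},h_2)$; $\mathrm{CAS}(h_2.prev,\mathrm{NULL},h_1)$; $e'\leftarrow h_1.item$; for every process index $j$: $(a,b)\leftarrow A[j]$, and if $b=e'$ and $h_1.old\ne\mathrm{DONE}$ then $\mathrm{CAS}(A[j],(a,b),(h_1,\bot))$; then $pred\leftarrow h'.prev$; $succ\leftarrow h'.next$; $\mathrm{CAS}(pred.next,h',succ)$; if $succ\ne\mathrm{NULL}$ then $\mathrm{CAS}(succ.prev,h',pred)$; $\mathrm{CAS}(h'.new,h_1,\mathrm{GONE})$; $\mathrm{CAS}(h_1.old,h',\mathrm{DONE})$. Theorem. DMTF is linearizable: for every (finite or infinite) execution one can assign distinct linearization points to all completed operations and to some subset of the incomplete ones such that the point of each such operation lies after its invocation and, if it is completed, before its return, and the result of every completed operation (a pointer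 to a node containing the item, or NOT PRESENT) is the same as if the linearized operations were performed sequentially, in the order of their points, on a move-to-front list of the items of $S$. Moreover, the points can be chosen so that for every linearized operation $\mathrm{SEARCH}(e)$: if $e\in S$, then at its linearization point the first node of the list (the one to which the first component of $Head$ points) contains $e$, and the operation, if it returns, returns a pointer to this node; if $e\notin S$, the operation, if it returns, returns NOT PRESENT. A $\mathrm{SEARCH}(e)$ with $e\notin S$ does return NOT PRESENT if its process does not crash, i.e. keeps taking steps. In every reachable configuration each process that is performing an operation has a next step (it never dereferences $\mathrm{NULL}$). -/

import Mathlib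

/-!
Shared-memory model of DMTF, a list-based implementation of a static set by `p` asynchronous
processes that communicate through registers and compare-and-swap (CAS) objects.

Every step of a process performs at most one access to the shared memory, followed by local
computation. Any process may be scheduled at any time and may stop for ever (crash) at any time.
-/

namespace DMTF

/-- Memory addresses of nodes. -/
abbrev Addr := ℕ

/-- A pointer to a node, or `NULL` (`none`). -/
abbrev Ptr := Option Addr

/-- Contents of the fields `old` and `new`: a pointer (possibly `NULL`), or a special mark, which
is read as `DONE` in the field `old` and as `GONE` in the field `new`. -/
inductive Link where
  | ptr (a : Ptr)
  | mark
  deriving DecidableEq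

/-- The mark `DONE` of a field `old`. -/
abbrev Link.DONE : Link := Link.mark

/-- The mark `GONE` of a field `new`. -/
abbrev Link.GONE : Link := Link.mark

/-- Nodes of the doubly linked list. -/
structure Node (Item : Type*) where
  item : Item
  next : Ptr
  prev : Ptr
  old : Link
  new : Link

/-- What a `SEARCH` returns: a pointer or NOT PRESENT. -/
inductive Result where
  | pointer (a : Ptr)
  | notPresent

/-- Program counter. The code of each position is given in `Step`. -/
inductive PC where
  -- positions in `SEARCH`
  | allocate | announce | getHead | testFront | unannFront1 | unannFront2
  | loop | testItem | readAnn1 | unannOther1 | setOld | setNew | getNew | readAnn2 | unannPostMTF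
  | readAnn3 | unannOther2 | next | readAnn4 | unannEnd | ret
  -- positions in `MOVE-TO-FRONT`
  | outer | getHead2 | getOld | testPrepend | prepend | setNext | setPrev | getItem
  | readAnn | testInform | inform | getPrev | getNext | remove1 | remove2 | gone | done

/-- Local variables of a process that is performing `SEARCH(e)`. -/
structure Loc (Item : Type*) (p : ℕ) where
  pc : PC
  /-- the item searched for -/
  e : Item
  /-- the replacement node allocated for this search -/
  g : Ptr := none
  /-- first node of the list, as read at the start of the search -/
  h1 : Ptr := none
  /-- current node of the traversal -/
  h : Ptr := none
  c : ℕ := 0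
  a : Ptr := none
  b : Option Item := none
  /-- parameter of `MOVE-TO-FRONT` -/
  g' : Ptr := none
  /-- the variables `h₁`, `h₂` of `MOVE-TO-FRONT` -/
  k1 : Ptr := none
  k2 : Ptr := none
  h' : Ptr := none
  e' : Item := e
  /-- process indices still to be treated in the loop that informs all processes -/
  todo : Finset (Fin p) := ∅
  /-- the process index treated at present in that loop -/
  j : Option (Fin p) := none
  pred : Ptr := none
  succ : Ptr := none
  res : Result := .notPresent

/-- A configuration: the shared memory and the local states of all processes. -/
structure Config (Item : Type*) (p : ℕ) where
  /-- the nodes allocated so far -/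
  heap : Addr → Option (Node Item)
  /-- pointers to the first and to the second node of the list -/
  head : Ptr × Ptr
  /-- the announcement array `A`; the value `none` in the second component is `⊥` -/
  ann : Fin p → Ptr × Option Item
  /-- `none` if the process is not performing `SEARCH` -/
  proc : Fin p → Option (Loc Item p)

variable {Item : Type*} {p : ℕ}

/-- Process `i` continues with local state `l`. -/
def Config.setLoc (s : Config Item p) (i : Fin p) (l : Loc Item p) : Config Item p :=
  { s with proc := Function.update s.proc i (some l) }

/-- Process `i` is no longer performing an operation. -/
def Config.setIdle (s : Config Item p) (i : Fin p) : Config Item p :=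
  { s with proc := Function.update s.proc i none }

/-- Store node `v` at address `x`. -/
def Config.setNode (s : Config Item p) (x : Addr) (v : Node Item) : Config Item p :=
  { s with heap := Function.update s.heap x (some v) }

/-- `CAS(Head, exp, val)`. -/
def Config.casHead (s : Config Item p) (exp val : Ptr × Ptr) : Config Item p :=
  if s.head = exp then { s with head := val } else s

/-- `CAS(A[j], exp, val)`. -/
def Config.casAnn [DecidableEq Item] (s : Config Item p) (j : Fin p)
    (exp val : Ptr × Option Item) : Config Item p :=
  if s.ann j = exp then { s with ann := Function.update s.ann j val } else s

/-- `CAS(x.next, exp, val)`, where `v` is the node at address `x`; similarly below. -/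
def Config.casNext (s : Config Item p) (x : Addr) (v : Node Item) (exp val : Ptr) :
    Config Item p :=
  if v.next = exp then s.setNode x { v with next := val } else s

def Config.casPrev (s : Config Item p) (x : Addr) (v : Node Item) (exp val : Ptr) :
    Config Item p :=
  if v.prev = exp then s.setNode x { v with prev := val } else s

def Config.casOld (s : Config Item p) (x : Addr) (v : Node Item) (exp val : Link) :
    Config Item p :=
  if v.old = exp then s.setNode x { v with old := val } else s

def Config.casNew (s : Config Item p) (x : Addr) (v : Node Item) (exp val : Link) :
    Config Item p :=
  if v.new = exp then s.setNode x { v with new := val } else s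

/-- Process `i` is performing an operation, has local state `l` and is at position `q`. -/
def Config.At (s : Config Item p) (i : Fin p) (l : Loc Item p) (q : PC) : Prop :=
  s.proc i = some l ∧ l.pc = q

/-- `a` points to the node `v`, stored at address `x`. -/
def Config.Pts (s : Config Item p) (a : Ptr) (x : Addr) (v : Node Item) : Prop :=
  a = some x ∧ s.heap x = some v

/-- `a` is a pointer to a node that contains the item `e`. -/
def Config.Contains (s : Config Item p) (a : Ptr) (e : Item) : Prop :=
  ∃ x v, s.Pts a x v ∧ v.item = e

/-- Labels of steps: process `i` invokes `SEARCH(e)`, takes a step inside `SEARCH`, or returns. -/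
inductive Label (Item : Type*) (p : ℕ) where
  | inv (i : Fin p) (e : Item)
  | tau (i : Fin p)
  | ret (i : Fin p) (r : Result)

/-- The process that takes the step. -/
def Label.proc : Label Item p → Fin p
  | .inv i _ => i
  | .tau i => i
  | .ret i _ => i

/-- The steps of DMTF, where a process looks at its announcement after every `φ` nodes.
A step that accesses a field of a node through a pointer `a` requires `s.Pts a x v`: a process that
dereferences `NULL` has no step. -/
inductive Step [DecidableEq Item] (φ : ℕ) :
    Config Item p → Label Item p → Config Item p → Prop
  -- SEARCH(e)
  | invoke (s : Config Item p) (i : Fin p) (e : Item) (h : s.proc i = none) :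
      Step φ s (.inv i e) (s.setLoc i { pc := .allocate, e := e })
  /-- `g ← allocate(node); g.item ← e; g.prev ← g.next ← g.old ← g.new ← NULL`: the address is an
  arbitrary one that has never been in use. No other process has a pointer to the new node before
  the announcement, so its initialization is part of the same step. -/
  | allocate (s : Config Item p) (i : Fin p) (l : Loc Item p) (x : Addr)
      (hl : s.At i l .allocate) (hx : s.heap x = none) :
      Step φ s (.tau i) ((s.setNode x ⟨l.e, none, none, .ptr none, .ptr none⟩).setLoc i
        { l with g := some x, pc := .announce })
  /-- `CAS(A[i], (NULL, ⊥), (g, e))` -/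
  | announce (s : Config Item p) (i : Fin p) (l : Loc Item p) (hl : s.At i l .announce) :
      Step φ s (.tau i) ((s.casAnn i (none, none) (l.g, some l.e)).setLoc i
        { l with pc := .getHead })
  /-- `(h₁, h) ← Head` -/
  | getHead (s : Config Item p) (i : Fin p) (l : Loc Item p) (hl : s.At i l .getHead) :
      Step φ s (.tau i) (s.setLoc i { l with h1 := s.head.1, h := s.head.2, pc := .testFront })
  /-- `if h₁.item = e then … else c ← 0` -/
  | testFront (s : Config Item p) (i : Fin p) (l : Loc Item p) (x : Addr) (v : Node Item)
      (hl : s.At i l .testFront) (hx : s.Pts l.h1 x v) :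
      Step φ s (.tau i) (s.setLoc i
        (if v.item = l.e then { l with pc := .unannFront1 } else { l with c := 0, pc := .loop }))
  /-- `(a, b) ← CAS(A[i], (g, e), (NULL, ⊥)); if b = ⊥ then …`:
  CAS returns the value that the object had immediately before. -/
  | unannFront1 (s : Config Item p) (i : Fin p) (l : Loc Item p) (hl : s.At i l .unannFront1) :
      Step φ s (.tau i) ((s.casAnn i (l.g, some l.e) (none, none)).setLoc i
        { l with
          a := (s.ann i).1, b := (s.ann i).2, res := .pointer l.h1
          pc := if (s.ann i).2 = none then .unannFront2 else .ret })
  /-- `CAS(A[i], (a, b), (NULL, ⊥)); return h₁` -/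
  | unannFront2 (s : Config Item p) (i : Fin p) (l : Loc Item p) (hl : s.At i l .unannFront2) :
      Step φ s (.tau i) ((s.casAnn i (l.a, l.b) (none, none)).setLoc i
        { l with res := .pointer l.h1, pc := .ret })
  /-- `while h ≠ NULL do` -/
  | loop (s : Config Item p) (i : Fin p) (l : Loc Item p) (hl : s.At i l .loop) :
      Step φ s (.tau i) (s.setLoc i { l with pc := if l.h = none then .readAnn4 else .testItem })
  /-- `if h.item = e then … else c ← (c + 1) mod φ; if c = 0 then …` -/
  | testItem (s : Config Item p) (i : Fin p) (l : Loc Item p) (x : Addr) (v : Node Item)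
      (hl : s.At i l .testItem) (hx : s.Pts l.h x v) :
      Step φ s (.tau i) (s.setLoc i
        (if v.item = l.e then { l with pc := .readAnn1 }
          else { l with c := (l.c + 1) % φ
                        pc := if (l.c + 1) % φ = 0 then .readAnn3 else .next }))
  /-- `(a, b) ← A[i]; if b = ⊥ then …` -/
  | readAnn1 (s : Config Item p) (i : Fin p) (l : Loc Item p) (hl : s.At i l .readAnn1) :
      Step φ s (.tau i) (s.setLoc i
        { l with
          a := (s.ann i).1, b := (s.ann i).2
          pc := if (s.ann i).2 = none then .unannOther1 else .setOld })
  /-- `CAS(A[i], (a, b), (NULL, ⊥)); return a` -/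
  | unannOther1 (s : Config Item p) (i : Fin p) (l : Loc Item p) (hl : s.At i l .unannOther1) :
      Step φ s (.tau i) ((s.casAnn i (l.a, l.b) (none, none)).setLoc i
        { l with res := .pointer l.a, pc := .ret })
  /-- `CAS(g.old, NULL, h)` -/
  | setOld (s : Config Item p) (i : Fin p) (l : Loc Item p) (x : Addr) (v : Node Item)
      (hl : s.At i l .setOld) (hx : s.Pts l.g x v) :
      Step φ s (.tau i) ((s.casOld x v (.ptr none) (.ptr l.h)).setLoc i { l with pc := .setNew })
  /-- `CAS(h.new, NULL, g)` -/
  | setNew (s : Config Item p) (i : Fin p) (l : Loc Item p) (x : Addr) (v : Node Item)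
      (hl : s.At i l .setNew) (hx : s.Pts l.h x v) :
      Step φ s (.tau i) ((s.casNew x v (.ptr none) (.ptr l.g)).setLoc i { l with pc := .getNew })
  /-- `g' ← h.new`, in the case `g' = GONE` -/
  | getNewGone (s : Config Item p) (i : Fin p) (l : Loc Item p) (x : Addr) (v : Node Item)
      (hl : s.At i l .getNew) (hx : s.Pts l.h x v) (hv : v.new = .GONE) :
      Step φ s (.tau i) (s.setLoc i { l with pc := .readAnn2 })
  /-- `g' ← h.new`, in the case `g' ≠ GONE`, and call of `MOVE-TO-FRONT(g')` -/
  | getNew (s : Config Item p) (i : Fin p) (l : Loc Item p) (x : Addr) (v : Node Item) (a : Ptr)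
      (hl : s.At i l .getNew) (hx : s.Pts l.h x v) (hv : v.new = .ptr a) :
      Step φ s (.tau i) (s.setLoc i { l with g' := a, pc := .outer })
  /-- `(a, b) ← A[i]` -/
  | readAnn2 (s : Config Item p) (i : Fin p) (l : Loc Item p) (hl : s.At i l .readAnn2) :
      Step φ s (.tau i) (s.setLoc i
        { l with a := (s.ann i).1, b := (s.ann i).2, pc := .unannPostMTF })
  /-- `CAS(A[i], (a, b), (NULL, ⊥)); return a` -/
  | unannPostMTF (s : Config Item p) (i : Fin p) (l : Loc Item p) (hl : s.At i l .unannPostMTF) :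
      Step φ s (.tau i) ((s.casAnn i (l.a, l.b) (none, none)).setLoc i
        { l with res := .pointer l.a, pc := .ret })
  /-- `(a, b) ← A[i]; if b = ⊥ then …` -/
  | readAnn3 (s : Config Item p) (i : Fin p) (l : Loc Item p) (hl : s.At i l .readAnn3) :
      Step φ s (.tau i) (s.setLoc i
        { l with
          a := (s.ann i).1, b := (s.ann i).2
          pc := if (s.ann i).2 = none then .unannOther2 else .next })
  /-- `CAS(A[i], (a, b), (NULL, ⊥)); return a` -/
  | unannOther2 (s : Config Item p) (i : Fin p) (l : Loc Item p) (hl : s.At i l .unannOther2) :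
      Step φ s (.tau i) ((s.casAnn i (l.a, l.b) (none, none)).setLoc i
        { l with res := .pointer l.a, pc := .ret })
  /-- `h ← h.next; end while` -/
  | next (s : Config Item p) (i : Fin p) (l : Loc Item p) (x : Addr) (v : Node Item)
      (hl : s.At i l .next) (hx : s.Pts l.h x v) :
      Step φ s (.tau i) (s.setLoc i { l with h := v.next, pc := .loop })
  /-- `(a, b) ← A[i]` -/
  | readAnn4 (s : Config Item p) (i : Fin p) (l : Loc Item p) (hl : s.At i l .readAnn4) :
      Step φ s (.tau i) (s.setLoc i
        { l with a := (s.ann i).1, b := (s.ann i).2, pc := .unannEnd })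
  /-- `CAS(A[i], (a, b), (NULL, ⊥)); if b = ⊥ then return a else return NOT PRESENT` -/
  | unannEnd (s : Config Item p) (i : Fin p) (l : Loc Item p) (hl : s.At i l .unannEnd) :
      Step φ s (.tau i) ((s.casAnn i (l.a, l.b) (none, none)).setLoc i
        { l with res := if l.b = none then .pointer l.a else .notPresent, pc := .ret })
  /-- the operation returns its result -/
  | ret (s : Config Item p) (i : Fin p) (l : Loc Item p) (hl : s.At i l .ret) :
      Step φ s (.ret i l.res) (s.setIdle i)
  -- MOVE-TO-FRONT(g')
  /-- `while g'.old ≠ DONE do` -/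
  | outer (s : Config Item p) (i : Fin p) (l : Loc Item p) (x : Addr) (v : Node Item)
      (hl : s.At i l .outer) (hx : s.Pts l.g' x v) :
      Step φ s (.tau i) (s.setLoc i
        { l with pc := if v.old = .DONE then .readAnn2 else .getHead2 })
  /-- `(h₁, h₂) ← Head` -/
  | getHead2 (s : Config Item p) (i : Fin p) (l : Loc Item p) (hl : s.At i l .getHead2) :
      Step φ s (.tau i) (s.setLoc i { l with k1 := s.head.1, k2 := s.head.2, pc := .getOld })
  /-- `h' ← h₁.old`, in the case `h' = DONE` -/
  | getOldDone (s : Config Item p) (i : Fin p) (l : Loc Item p) (x : Addr) (v : Node Item)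
      (hl : s.At i l .getOld) (hx : s.Pts l.k1 x v) (hv : v.old = .DONE) :
      Step φ s (.tau i) (s.setLoc i { l with pc := .testPrepend })
  /-- `h' ← h₁.old`, in the case `h' ≠ DONE` -/
  | getOld (s : Config Item p) (i : Fin p) (l : Loc Item p) (x : Addr) (v : Node Item) (a : Ptr)
      (hl : s.At i l .getOld) (hx : s.Pts l.k1 x v) (hv : v.old = .ptr a) :
      Step φ s (.tau i) (s.setLoc i { l with h' := a, pc := .setNext })
  /-- `if g'.old ≠ DONE then …` -/
  | testPrepend (s : Config Item p) (i : Fin p) (l : Loc Item p) (x : Addr) (v : Node Item)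
      (hl : s.At i l .testPrepend) (hx : s.Pts l.g' x v) :
      Step φ s (.tau i) (s.setLoc i { l with pc := if v.old = .DONE then .outer else .prepend })
  /-- `CAS(Head, (h₁, h₂), (g', h₁))` -/
  | prepend (s : Config Item p) (i : Fin p) (l : Loc Item p) (hl : s.At i l .prepend) :
      Step φ s (.tau i) ((s.casHead (l.k1, l.k2) (l.g', l.k1)).setLoc i { l with pc := .outer })
  /-- `CAS(h₁.next, NULL, h₂)` -/
  | setNext (s : Config Item p) (i : Fin p) (l : Loc Item p) (x : Addr) (v : Node Item)
      (hl : s.At i l .setNext) (hx : s.Pts l.k1 x v) :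
      Step φ s (.tau i) ((s.casNext x v none l.k2).setLoc i { l with pc := .setPrev })
  /-- `CAS(h₂.prev, NULL, h₁)` -/
  | setPrev (s : Config Item p) (i : Fin p) (l : Loc Item p) (x : Addr) (v : Node Item)
      (hl : s.At i l .setPrev) (hx : s.Pts l.k2 x v) :
      Step φ s (.tau i) ((s.casPrev x v none l.k1).setLoc i { l with pc := .getItem })
  /-- `e' ← h₁.item` -/
  | getItem (s : Config Item p) (i : Fin p) (l : Loc Item p) (x : Addr) (v : Node Item)
      (hl : s.At i l .getItem) (hx : s.Pts l.k1 x v) :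
      Step φ s (.tau i) (s.setLoc i
        { l with e' := v.item, todo := Finset.univ, pc := .readAnn })
  /-- `for every process index j do (a, b) ← A[j]; if b = e' …`: the indices are treated in an
  arbitrary order -/
  | readAnn (s : Config Item p) (i : Fin p) (l : Loc Item p) (j : Fin p)
      (hl : s.At i l .readAnn) (hj : j ∈ l.todo) :
      Step φ s (.tau i) (s.setLoc i
        { l with
          j := some j, todo := l.todo.erase j, a := (s.ann j).1, b := (s.ann j).2
          pc := if (s.ann j).2 = some l.e' then .testInform else .readAnn })
  /-- `… and h₁.old ≠ DONE then …` -/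
  | testInform (s : Config Item p) (i : Fin p) (l : Loc Item p) (x : Addr) (v : Node Item)
      (hl : s.At i l .testInform) (hx : s.Pts l.k1 x v) :
      Step φ s (.tau i) (s.setLoc i { l with pc := if v.old = .DONE then .readAnn else .inform })
  /-- `CAS(A[j], (a, b), (h₁, ⊥))` -/
  | inform (s : Config Item p) (i : Fin p) (l : Loc Item p) (j : Fin p)
      (hl : s.At i l .inform) (hj : l.j = some j) :
      Step φ s (.tau i) ((s.casAnn j (l.a, l.b) (l.k1, none)).setLoc i { l with pc := .readAnn })
  /-- end of the loop over all process indices -/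
  | informed (s : Config Item p) (i : Fin p) (l : Loc Item p)
      (hl : s.At i l .readAnn) (hj : l.todo = ∅) :
      Step φ s (.tau i) (s.setLoc i { l with pc := .getPrev })
  /-- `pred ← h'.prev` -/
  | getPrev (s : Config Item p) (i : Fin p) (l : Loc Item p) (x : Addr) (v : Node Item)
      (hl : s.At i l .getPrev) (hx : s.Pts l.h' x v) :
      Step φ s (.tau i) (s.setLoc i { l with pred := v.prev, pc := .getNext })
  /-- `succ ← h'.next` -/
  | getNext (s : Config Item p) (i : Fin p) (l : Loc Item p) (x : Addr) (v : Node Item)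
      (hl : s.At i l .getNext) (hx : s.Pts l.h' x v) :
      Step φ s (.tau i) (s.setLoc i { l with succ := v.next, pc := .remove1 })
  /-- `CAS(pred.next, h', succ)` -/
  | remove1 (s : Config Item p) (i : Fin p) (l : Loc Item p) (x : Addr) (v : Node Item)
      (hl : s.At i l .remove1) (hx : s.Pts l.pred x v) :
      Step φ s (.tau i) ((s.casNext x v l.h' l.succ).setLoc i { l with pc := .remove2 })
  /-- `if succ ≠ NULL …`, in the case `succ = NULL` -/
  | remove2Null (s : Config Item p) (i : Fin p) (l : Loc Item p)
      (hl : s.At i l .remove2) (hx : l.succ = none) :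
      Step φ s (.tau i) (s.setLoc i { l with pc := .gone })
  /-- `if succ ≠ NULL then CAS(succ.prev, h', pred)` -/
  | remove2 (s : Config Item p) (i : Fin p) (l : Loc Item p) (x : Addr) (v : Node Item)
      (hl : s.At i l .remove2) (hx : s.Pts l.succ x v) :
      Step φ s (.tau i) ((s.casPrev x v l.h' l.pred).setLoc i { l with pc := .gone })
  /-- `CAS(h'.new, h₁, GONE)` -/
  | gone (s : Config Item p) (i : Fin p) (l : Loc Item p) (x : Addr) (v : Node Item)
      (hl : s.At i l .gone) (hx : s.Pts l.h' x v) :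
      Step φ s (.tau i) ((s.casNew x v (.ptr l.k1) .GONE).setLoc i { l with pc := .done })
  /-- `CAS(h₁.old, h', DONE); end while` -/
  | done (s : Config Item p) (i : Fin p) (l : Loc Item p) (x : Addr) (v : Node Item)
      (hl : s.At i l .done) (hx : s.Pts l.k1 x v) :
      Step φ s (.tau i) ((s.casOld x v (.ptr l.h') .DONE).setLoc i { l with pc := .outer })

/-- Initial configurations: the list has one node for each member of `items`, in this order, no
other node is allocated, nothing is announced and no process is performing an operation. -/
def IsInit (items : List Item) (s : Config Item p) : Prop :=
  (∃ addrs : List Addr, addrs.Nodup ∧ addrs.length = items.length ∧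
    (∀ t x e, addrs[t]? = some x → items[t]? = some e →
      s.heap x = some
        { item := e
          next := addrs[t + 1]?
          prev := if t = 0 then none else addrs[t - 1]?
          old := .DONE
          new := .ptr none }) ∧
    (∀ x, x ∉ addrs → s.heap x = none) ∧
    s.head = (addrs[0]?, addrs[1]?)) ∧
  (∀ i, s.ann i = (none, none)) ∧
  (∀ i, s.proc i = none)

/-- Finite and infinite executions of DMTF by `p` processes: step number `k < len` leads from
configuration `cfg k` to configuration `cfg (k + 1)`. The values of `cfg` and `lab` beyond the length
of a finite execution are irrelevant. -/
structure Execution [DecidableEq Item] (p φ : ℕ) (items : List Item) where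
  len : ℕ∞
  cfg : ℕ → Config Item p
  lab : ℕ → Label Item p
  init : IsInit items (cfg 0)
  step : ∀ k : ℕ, (k : ℕ∞) < len → Step φ (cfg k) (lab k) (cfg (k + 1))

section

variable [DecidableEq Item] {φ : ℕ} {items : List Item}

/-- Step `k` is the invocation of `SEARCH(e)` by process `i`. The number `k` of its first step
identifies an operation. -/
def Execution.Invokes (X : Execution p φ items) (k : ℕ) (i : Fin p) (e : Item) : Prop :=
  (k : ℕ∞) < X.len ∧ X.lab k = .inv i e

/-- The operation invoked at step `k` is completed: it returns `r` at step `m`. -/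
def Execution.Returns (X : Execution p φ items) (k m : ℕ) (r : Result) : Prop :=
  ∃ i e, X.Invokes k i e ∧ k < m ∧ (m : ℕ∞) < X.len ∧ X.lab m = .ret i r ∧
    ∀ m' r', k < m' → m' < m → X.lab m' ≠ .ret i r'

/-- The item that the operation invoked at step `k` searches for. -/
def Execution.opItem (X : Execution p φ items) (k : ℕ) : Option Item :=
  match X.lab k with
  | .inv _ e => some e
  | _ => none

/-- Sequential specification, new state: `SEARCH(e)` moves `e` to the front of the list `L` if it
occurs there. -/
def seqState (e : Item) (L : List Item) : List Item :=
  if e ∈ L then e :: L.erase e else L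

/-- Sequential specification, response of `SEARCH(e)` in state `L`: the item found, or `none` for
NOT PRESENT. -/
def seqResponse (e : Item) (L : List Item) : Option Item :=
  if e ∈ L then some e else none

/-- The state after the operations on the items `es`, performed one after the other. -/
def seqRun (L : List Item) (es : List Item) : List Item :=
  es.foldl (fun L' e => seqState e L') L

/-- The result `r`, returned in configuration `s`, is the same as a response of the sequential
specification. -/
def SameResult (s : Config Item p) : Result → Option Item → Prop
  | .pointer a, some e => s.Contains a e
  | .notPresent, none => True
  | _, _ => False

/-- `pt` is a correct assignment of linearization points to the operations in `ops`.
The point `(t, c)` means: at the `c`-th instant of the time during which `cfg t` is the current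
configuration (so several points may lie between two consecutive steps). -/
structure Execution.IsLinearization (X : Execution p φ items) (ops : Set ℕ)
    (pt : ℕ → ℕ ×ₗ ℕ) : Prop where
  /-- only operations are linearized -/
  isOp : ∀ k ∈ ops, ∃ i e, X.Invokes k i e
  /-- every completed operation is linearized -/
  complete : ∀ k m r, X.Returns k m r → k ∈ ops
  /-- the points are distinct -/
  distinct : Set.InjOn pt ops
  /-- the points lie within the execution -/
  within : ∀ k ∈ ops, ((ofLex (pt k)).1 : ℕ∞) ≤ X.len
  /-- each operation is linearized after its invocation -/
  after : ∀ k ∈ ops, k < (ofLex (pt k)).1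
  /-- each completed operation is linearized before its return step -/
  before : ∀ k m r, X.Returns k m r → (ofLex (pt k)).1 ≤ m
  /-- the result of each completed operation is the one that it has if the linearized operations
  are performed sequentially in the order of their points; `prior` lists the earlier ones -/
  legal : ∀ k m i e r, X.Invokes k i e → X.Returns k m r →
    ∃ prior : List ℕ, prior.Pairwise (fun a b => pt a < pt b) ∧
      (∀ a, a ∈ prior ↔ a ∈ ops ∧ pt a < pt k) ∧
      SameResult (X.cfg m) r (seqResponse e (seqRun items (prior.filterMap X.opItem)))

end

end DMTF

/-!
A node is removed from the list only after a newer node with the same item has become the first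
one, so we rank the nodes by the time at which they were prepended. Every `next` pointer leads to a
lower rank. Call a node *protected* if it is the newest one with its item, or if it is being
replaced by the first node and some process that searches for the item has not been informed of
this. A traversal never jumps over a protected node: before a helper unlinks a node, it replaces the
announcement of every process that searches for the item by `(h₁, ⊥)`, where `h₁` is the first node.
Hence a search for a member of `S` reaches the item unless it is informed, and a process that has to
wait for its node to be moved to the front has been informed once the move is complete.

Consequently a returned node was the first node at some time during the operation, and this is the
time at which the operation is linearized. No process answers a search for an item outside
`S`, so such a search can be linearized anywhere, and it terminates since the ranks along its
traversal decrease. The result of a sequential search depends only on the members of the list, which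
no search changes.
-/

namespace DMTF

variable {Item : Type*} {p : ℕ}

/-- The data of a configuration that the invariants talk about: the fields of the nodes as functions
of their addresses (`item x = none` if `x` is not allocated), `Head`, the announcements, and
* `seeks i e`: process `i` searches for `e`, did not find it at the front and has not been informed;
* `unannounced x`: the node `x` is allocated, but not announced yet;
* `rank x`: `0` if `x` has never been in the list, otherwise larger the later `x` was prepended. -/
@[ext]
structure View (Item : Type*) (p : ℕ) where
  item : Addr → Option Item
  next : Addr → Ptr
  prev : Addr → Ptr
  old : Addr → Link
  new : Addr → Link
  head : Ptr × Ptr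
  ann : Fin p → Ptr × Option Item
  seeks : Fin p → Item → Prop
  unannounced : Addr → Prop
  rank : Addr → ℕ

namespace View

/-- No node that contains the item of `w` was prepended later than `w`. -/
def Latest (V : View Item p) (w : Addr) : Prop :=
  ∀ z, V.item z = V.item w → V.rank z ≤ V.rank w

/-- `w` is the node that contained the item of `x` when `x` was prepended. -/
def PrevOcc (V : View Item p) (w x : Addr) : Prop :=
  0 < V.rank w ∧ V.item w = V.item x ∧ V.rank w < V.rank x ∧
    ∀ z, V.item z = V.item x → V.rank z < V.rank x → V.rank z ≤ V.rank w

/-- The front node is about to replace `w`, and some process that searches for the item of `w` has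
not been informed of this. -/
def Awaited (V : View Item p) (w : Addr) : Prop :=
  ∃ a e i, V.head.1 = some a ∧ V.old a = .ptr (some w) ∧ V.item w = some e ∧ V.seeks i e

/-- A traversal must not miss `w`. -/
def Protected (V : View Item p) (w : Addr) : Prop :=
  0 < V.rank w ∧ (V.Latest w ∨ V.Awaited w)

/-- The invariant of the shared memory. -/
structure SharedInv (V : View Item p) (items : List Item) : Prop where
  rank_inj : ∀ x y, 0 < V.rank x → V.rank x = V.rank y → x = y
  item_mem : ∀ x, 0 < V.rank x → ∃ e ∈ items, V.item x = some e
  exists_node : ∀ e ∈ items, ∃ x, 0 < V.rank x ∧ V.item x = some e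
  head : ∃ a b, V.head = (some a, some b) ∧ 0 < V.rank b ∧ V.rank b < V.rank a ∧
    V.item a ≠ V.item b ∧ ∀ z, z ≠ a → V.rank z ≤ V.rank b
  old : ∀ x, 0 < V.rank x → V.old x = .DONE ∨ V.head.1 = some x ∧
    ∃ w, V.old x = .ptr (some w) ∧ V.PrevOcc w x ∧ (V.new w = .ptr (some x) ∨ V.new w = .GONE)
  next_lt : ∀ x y, 0 < V.rank x → V.next x = some y → 0 < V.rank y ∧ V.rank y < V.rank x
  le_next : ∀ x w, 0 < V.rank x → V.Protected w → V.rank w < V.rank x →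
    (∃ y, V.next x = some y ∧ V.rank w ≤ V.rank y) ∨
      (V.head.1 = some x ∧ V.old x ≠ .DONE ∧ V.next x = none)
  prev_listed : ∀ x y, 0 < V.rank x → V.prev x = some y → 0 < V.rank y
  prev_ne_none : ∀ x, 0 < V.rank x → V.head.1 ≠ some x →
    (V.head.2 = some x → ∀ a, V.head.1 = some a → V.old a = .DONE) → V.prev x ≠ none
  new_ptr : ∀ x g, 0 < V.rank x → V.new x = .ptr (some g) →
    V.item g = V.item x ∧ V.head.1 ≠ some x ∧ (0 < V.rank g → V.rank x < V.rank g) ∧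
      (V.rank g = 0 → V.old g = .ptr (some x))
  new_of_later : ∀ x z, 0 < V.rank x → V.rank x < V.rank z → V.item z = V.item x →
    V.new x ≠ .ptr none ∧ ∀ g, V.new x = .ptr (some g) → 0 < V.rank g
  not_protected_of_gone : ∀ x, V.new x = .GONE → ¬ V.Protected x
  unlisted : ∀ x, V.rank x = 0 → V.next x = none ∧ V.prev x = none ∧ V.new x = .ptr none
  ann : ∀ j x, (V.ann j).1 = some x → V.item x ≠ none ∧ ¬ V.unannounced x

/-- What the processes rely on in a step from `V` to `V'` of another process. The fields that
mention `rely` hold for the processes `j` with local state `l` such that `rely j l`; the addresses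
in `seen j` were at the front of the list during the current operation of `j`. -/
structure Evolves (V V' : View Item p) (items : List Item) (seen : Fin p → Addr → Prop)
    (rely : Fin p → Loc Item p → Prop) : Prop where
  item : ∀ x, V.item x ≠ none → V'.item x = V.item x
  rank : ∀ x, V'.rank x = V.rank x ∨
    V.rank x = 0 ∧ V'.head.1 = some x ∧ V.item x ≠ none ∧ ∀ z, V.rank z < V'.rank x
  head : ∀ x, 0 < V.rank x → V'.head.1 = some x → V.head.1 = some x
  old : ∀ x, 0 < V.rank x → V'.old x = V.old x ∨ V'.old x = .DONE
  next : ∀ x, 0 < V.rank x → V'.head.1 = some x → V.next x ≠ none → V'.next x ≠ none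
  prev : ∀ x, V.prev x ≠ none → V'.prev x ≠ none
  new : ∀ x, 0 < V.rank x → V'.new x = V.new x ∨
    (∃ g, V.new x = .ptr none ∧ V'.new x = .ptr (some g)) ∨
    (∃ g, V.new x = .ptr (some g) ∧ 0 < V'.rank g ∧ V'.new x = .GONE)
  unlinked : ∀ j l x, rely j l → l.g = some x → V.rank x = 0 →
    (∀ y, 0 < V.rank y → V.new y ≠ .ptr (some x)) →
    V'.rank x = 0 ∧ (∀ y, 0 < V'.rank y → V'.new y ≠ .ptr (some x)) ∧ V'.old x = V.old x
  protected_of : ∀ w, 0 < V.rank w → V'.Protected w → V.Protected w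
  protected_of_seeks : ∀ j e v, V'.seeks j e → V.seeks j e → V.item v = some e →
    V.head.1 ≠ some v → V.Protected v → V'.Protected v
  seeks : ∀ j e, V'.seeks j e → V.seeks j e ∨ ∃ a, V.head.1 = some a ∧ V.item a ≠ some e
  seeks_own : ∀ j l e, rely j l → V'.seeks j e → V.seeks j e
  ann_of_seeks : ∀ j e, V'.seeks j e → V'.ann j = V.ann j
  ann_own : ∀ j l, rely j l → V'.ann j = V.ann j ∨
    V.ann j = (l.g, some l.e) ∧ l.e ∈ items ∧
      ∃ x, V'.ann j = (some x, none) ∧ seen j x ∧ V'.item x = some l.e ∧ 0 < V'.rank x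
  ann_some : ∀ j x e, V'.ann j = (x, some e) →
    V.ann j = (x, some e) ∨ ∃ y, x = some y ∧ V.unannounced y
  unannounced : ∀ x, V'.unannounced x → V.unannounced x ∨ V.item x = none

variable {V V' : View Item p} {items : List Item} {seen : Fin p → Addr → Prop}
  {rely : Fin p → Loc Item p → Prop}

theorem Evolves.refl : V.Evolves V items seen rely where
  item _ _ := rfl
  rank _ := .inl rfl
  head _ _ h := h
  old _ _ := .inl rfl
  next _ _ _ h := h
  prev _ h := h
  new _ _ := .inl rfl
  unlinked _ _ _ _ _ h h' := ⟨h, h', rfl⟩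
  protected_of _ _ h := h
  protected_of_seeks _ _ _ _ _ _ _ h := h
  seeks _ _ h := .inl h
  seeks_own _ _ _ _ h := h
  ann_of_seeks _ _ _ := rfl
  ann_own _ _ _ := .inl rfl
  ann_some _ _ _ h := .inl h
  unannounced _ h := .inl h

theorem Evolves.mono {rely' : Fin p → Loc Item p → Prop} (E : V.Evolves V' items seen rely)
    (h : ∀ j l, rely' j l → rely j l) : V.Evolves V' items seen rely' :=
  { E with
    unlinked := fun j l x hj => E.unlinked j l x (h j l hj)
    seeks_own := fun j l e hj => E.seeks_own j l e (h j l hj)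
    ann_own := fun j l hj => E.ann_own j l (h j l hj) }

theorem PrevOcc.not_latest {w x : Addr} (h : V.PrevOcc w x) : ¬ V.Latest w := fun h' =>
  absurd (h' x h.2.1.symm) h.2.2.1.not_ge

namespace SharedInv

theorem head_listed (G : V.SharedInv items) {a : Addr} (ha : V.head.1 = some a) :
    0 < V.rank a := by
  obtain ⟨a', b, h1, h2, h3, -⟩ := G.head
  obtain rfl : a' = a := by simpa [h1] using ha
  omega

theorem rank_le_head (G : V.SharedInv items) {a : Addr} (ha : V.head.1 = some a) (z : Addr) :
    V.rank z ≤ V.rank a := by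
  obtain ⟨a', b, h1, -, h3, -, h5⟩ := G.head
  obtain rfl : a' = a := by simpa [h1] using ha
  obtain rfl | h := eq_or_ne z a'
  · exact le_rfl
  · exact (h5 z h).trans h3.le

theorem protected_second (G : V.SharedInv items) {b : Addr} (hb : V.head.2 = some b) :
    V.Protected b := by
  obtain ⟨a, b', h1, h2, -, h4, h5⟩ := G.head
  obtain rfl : b' = b := by simpa [h1] using hb
  exact ⟨h2, .inl fun z hz => h5 z fun hza => h4 (hza ▸ hz)⟩

theorem prevOcc_of_old (G : V.SharedInv items) {x w : Addr} (hx : 0 < V.rank x)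
    (hw : V.old x = .ptr (some w)) : V.PrevOcc w x := by
  rcases G.old x hx with h | ⟨-, w', h, h', -⟩
  · cases hw.symm.trans h
  · cases hw.symm.trans h
    exact h'

theorem prevOcc_unique (G : V.SharedInv items) {w x y : Addr} (hx : V.PrevOcc w x)
    (hy : V.PrevOcc w y) : x = y := by
  obtain ⟨-, hx1, hx2, hx3⟩ := hx
  obtain ⟨-, hy1, hy2, hy3⟩ := hy
  rcases lt_trichotomy (V.rank x) (V.rank y) with h | h | h
  · have := hy3 x (hx1.symm.trans hy1) h
    omega
  · exact G.rank_inj x y (by omega) h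
  · have := hx3 y (hy1.symm.trans hx1) h
    omega

theorem not_protected_of_prevOcc (G : V.SharedInv items) {w x : Addr} (h : V.PrevOcc w x)
    (hx : V.head.1 = some x → V.old x ≠ .DONE → ∀ j e, V.item x = some e → ¬ V.seeks j e) :
    ¬ V.Protected w := by
  rintro ⟨-, hw | ⟨a, e, i, ha, haw, he, hi⟩⟩
  · exact h.not_latest hw
  · obtain rfl := G.prevOcc_unique (G.prevOcc_of_old (G.head_listed ha) haw) h
    exact hx ha (by simp [haw]) i e (h.2.1 ▸ he) hi

theorem exists_latest (G : V.SharedInv items) {e : Item} (he : e ∈ items) :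
    ∃ v, 0 < V.rank v ∧ V.item v = some e ∧ V.Latest v := by
  classical
  obtain ⟨x, hx, hxe⟩ := G.exists_node e he
  obtain ⟨a, b, hab, -⟩ := G.head
  have bound : ∀ z, V.rank z ≤ V.rank a := G.rank_le_head (by rw [hab])
  let P : ℕ → Prop := fun n => ∃ z, V.item z = some e ∧ V.rank z = n
  obtain ⟨v, hv, hr⟩ : P (Nat.findGreatest P (V.rank a)) :=
    Nat.findGreatest_spec (P := P) (bound x) ⟨x, hxe, rfl⟩
  have hmax : ∀ z, V.item z = some e → V.rank z ≤ V.rank v := fun z hz =>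
    hr ▸ Nat.le_findGreatest (P := P) (bound z) ⟨z, hz, rfl⟩
  exact ⟨v, hx.trans_le (hmax x hxe), hv, fun z hz => hmax z (hz.trans hv)⟩

end SharedInv

section next

variable {x : Addr} {y : Ptr}

theorem SharedInv.setNext (G : V.SharedInv items) (hx : 0 < V.rank x)
    (hy : ∀ u, y = some u → 0 < V.rank u ∧ V.rank u < V.rank x)
    (hs : ∀ w, V.Protected w → V.rank w < V.rank x → ∃ u, y = some u ∧ V.rank w ≤ V.rank u) :
    ({ V with next := Function.update V.next x y } : View Item p).SharedInv items := by
  refine { G with next_lt := fun z u hz hu => ?_, le_next := fun z w hz hw hr => ?_,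
                  unlisted := fun z hz => ?_ }
  · obtain rfl | h := eq_or_ne z x
    · exact hy u (by simpa using hu)
    · exact G.next_lt z u hz (by simpa [h] using hu)
  · obtain rfl | h := eq_or_ne z x
    · exact .inl (by simpa using hs w hw hr)
    · simpa [h] using G.le_next z w hz hw hr
  · have h : z ≠ x := fun h => hx.ne' (h ▸ hz)
    simpa [h] using G.unlisted z hz

theorem SharedInv.evolves_setNext (G : V.SharedInv items)
    (hs : ∀ w, V.Protected w → V.rank w < V.rank x → ∃ u, y = some u ∧ V.rank w ≤ V.rank u) :
    V.Evolves { V with next := Function.update V.next x y } items seen rely :=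
  { Evolves.refl with
    next := by
      intro z hz ha hn
      obtain rfl | h := eq_or_ne z x
      · obtain ⟨a, b, h1, _, h3, -⟩ := G.head
        obtain rfl : a = z := by simpa [h1] using ha
        obtain ⟨u, hu, -⟩ := hs b (G.protected_second (by rw [h1])) h3
        simp [hu]
      · simpa [h] using hn }

end next

section prev

variable {x y : Addr}

theorem SharedInv.setPrev (G : V.SharedInv items) (hx : 0 < V.rank x) (hy : 0 < V.rank y) :
    ({ V with prev := Function.update V.prev x (some y) } : View Item p).SharedInv items := by
  refine { G with prev_listed := fun z u hz hu => ?_, prev_ne_none := fun z hz h1 h2 => ?_,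
                  unlisted := fun z hz => ?_ }
  · obtain rfl | h := eq_or_ne z x
    · obtain rfl : y = u := by simpa using hu
      exact hy
    · exact G.prev_listed z u hz (by simpa [h] using hu)
  · obtain rfl | h := eq_or_ne z x
    · simp
    · simpa [h] using G.prev_ne_none z hz h1 h2
  · have h : z ≠ x := fun h => hx.ne' (h ▸ hz)
    simpa [h] using G.unlisted z hz

theorem evolves_setPrev :
    V.Evolves { V with prev := Function.update V.prev x (some y) } items seen rely :=
  { Evolves.refl with
    prev := by
      intro z hz
      obtain rfl | h := eq_or_ne z x
      · simp
      · simpa [h] using hz }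

end prev

section new

variable {x g : Addr}

theorem SharedInv.setNew (G : V.SharedInv items) (hx : 0 < V.rank x) (hn : V.new x = .ptr none)
    (hxh : V.head.1 ≠ some x) (hg : V.rank g = 0) (hi : V.item g = V.item x)
    (ho : V.old g = .ptr (some x)) :
    ({ V with new := Function.update V.new x (.ptr (some g)) } : View Item p).SharedInv items := by
  refine { G with old := fun z hz => ?_, new_ptr := fun z g' hz hg' => ?_,
                  new_of_later := fun z z' hz hr hi' => ?_,
                  not_protected_of_gone := fun z hz => ?_, unlisted := fun z hz => ?_ }
  · refine (G.old z hz).imp_right fun ⟨h1, w, h2, h3, h4⟩ => ⟨h1, w, h2, h3, ?_⟩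
    have hwx : w ≠ x := by
      rintro rfl
      simp [hn] at h4
    simpa [hwx] using h4
  · obtain rfl | h := eq_or_ne z x
    · obtain rfl : g = g' := by simpa using hg'
      exact ⟨hi, hxh, fun h => absurd hg h.ne', fun _ => ho⟩
    · exact G.new_ptr z g' hz (by simpa [h] using hg')
  · have h := G.new_of_later z z' hz hr hi'
    have hzx : z ≠ x := by
      rintro rfl
      exact h.1 hn
    simpa [hzx] using h
  · have h : z ≠ x := by
      rintro rfl
      simp at hz
    exact G.not_protected_of_gone z (by simpa [h] using hz)
  · have h : z ≠ x := fun h => hx.ne' (h ▸ hz)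
    simpa [h] using G.unlisted z hz

theorem evolves_setNew (hn : V.new x = .ptr none) (hg : ∀ j l, rely j l → l.g ≠ some g) :
    V.Evolves { V with new := Function.update V.new x (.ptr (some g)) } items seen rely :=
  { Evolves.refl with
    new := by
      intro z _
      obtain rfl | h := eq_or_ne z x
      · exact .inr (.inl ⟨g, hn, by simp⟩)
      · simp [h]
    unlinked := by
      intro j l y hj hy h h'
      refine ⟨h, fun z hz => ?_, rfl⟩
      obtain rfl | hzx := eq_or_ne z x
      · have hgy : g ≠ y := fun hgy => hg j l hj (hgy ▸ hy)
        simpa using hgy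
      · simpa [hzx] using h' z hz }

theorem SharedInv.setGone (G : V.SharedInv items) (hx : 0 < V.rank x) (hp : ¬ V.Protected x) :
    ({ V with new := Function.update V.new x .GONE } : View Item p).SharedInv items := by
  refine { G with old := fun z hz => ?_, new_ptr := fun z g hz hg => ?_,
                  new_of_later := fun z z' hz hr hi => ?_,
                  not_protected_of_gone := fun z hz => ?_, unlisted := fun z hz => ?_ }
  · refine (G.old z hz).imp_right fun ⟨h1, w, h2, h3, h4⟩ => ⟨h1, w, h2, h3, ?_⟩
    obtain rfl | h := eq_or_ne w x
    · simp
    · simpa [h] using h4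
  · have h : z ≠ x := by
      rintro rfl
      simp at hg
    exact G.new_ptr z g hz (by simpa [h] using hg)
  · obtain rfl | h := eq_or_ne z x
    · simp
    · simpa [h] using G.new_of_later z z' hz hr hi
  · obtain rfl | h := eq_or_ne z x
    · exact hp
    · exact G.not_protected_of_gone z (by simpa [h] using hz)
  · have h : z ≠ x := fun h => hx.ne' (h ▸ hz)
    simpa [h] using G.unlisted z hz

theorem evolves_setGone (hg : 0 < V.rank g) (hn : V.new x = .ptr (some g)) :
    V.Evolves { V with new := Function.update V.new x .GONE } items seen rely :=
  { Evolves.refl with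
    new := by
      intro z _
      obtain rfl | h := eq_or_ne z x
      · exact .inr (.inr ⟨g, hn, hg, by simp⟩)
      · simp [h]
    unlinked := by
      intro j l y _ _ h h'
      refine ⟨h, fun z hz => ?_, rfl⟩
      obtain rfl | hzx := eq_or_ne z x
      · simp
      · simpa [hzx] using h' z hz }

end new

section old

variable {x g : Addr} {y : Link}

theorem SharedInv.protected_setOld (G : V.SharedInv items) (hg : V.rank g = 0) (w : Addr) :
    ({ V with old := Function.update V.old g y } : View Item p).Protected w ↔ V.Protected w := by
  refine and_congr_right fun _ => or_congr_right <| exists_congr fun a => exists₂_congr fun e i =>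
    and_congr_right fun ha => ?_
  have hag : a ≠ g := fun h => (G.head_listed ha).ne' (h ▸ hg)
  simp only [Function.update_of_ne hag]

theorem SharedInv.setOld (G : V.SharedInv items) (hg : V.rank g = 0)
    (hn : ∀ x, 0 < V.rank x → V.new x ≠ .ptr (some g)) :
    ({ V with old := Function.update V.old g y } : View Item p).SharedInv items := by
  have hne : ∀ x, 0 < V.rank x → x ≠ g := fun x hx h => hx.ne' (h ▸ hg)
  refine { G with old := fun z hz => ?_, le_next := fun x w hx hw hr => ?_,
                  prev_ne_none := fun z hz h1 h2 => ?_, new_ptr := fun x g' hx hg' => ?_,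
                  not_protected_of_gone := fun x hx => ?_ }
  · simpa [hne z hz, PrevOcc] using G.old z hz
  · simpa [hne x hx] using G.le_next x w hx ((G.protected_setOld hg w).1 hw) hr
  · refine G.prev_ne_none z hz h1 fun h3 a ha => ?_
    simpa [hne a (G.head_listed ha)] using h2 h3 a ha
  · have h : g' ≠ g := by
      rintro rfl
      exact hn x hx hg'
    simpa [h] using G.new_ptr x g' hx hg'
  · rw [G.protected_setOld hg x]
    exact G.not_protected_of_gone x hx

theorem SharedInv.evolves_setOld (G : V.SharedInv items) (hg : V.rank g = 0)
    (hJ : ∀ j l, rely j l → l.g ≠ some g) :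
    V.Evolves { V with old := Function.update V.old g y } items seen rely :=
  { Evolves.refl with
    old := by
      intro x hx
      have h : x ≠ g := fun h => hx.ne' (h ▸ hg)
      simp [h]
    unlinked := by
      intro j l x hj hx h h'
      have hxg : x ≠ g := fun hxg => hJ j l hj (hxg ▸ hx)
      exact ⟨h, h', by simp [hxg]⟩
    protected_of := fun w _ => (G.protected_setOld hg w).1
    protected_of_seeks := fun _ _ w _ _ _ _ => (G.protected_setOld hg w).2 }

theorem protected_of_setDone (hx : V.head.1 = some x) {w : Addr}
    (h : ({ V with old := Function.update V.old x .DONE } : View Item p).Protected w) :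
    V.Protected w := by
  refine h.imp_right (Or.imp_right ?_)
  rintro ⟨a, e, i, ha, haw, -⟩
  obtain rfl : x = a := by simpa [hx] using ha
  simp at haw

theorem SharedInv.setDone (G : V.SharedInv items) (hx : V.head.1 = some x)
    (hn : V.next x ≠ none) (hp : ∀ b, V.head.2 = some b → V.prev b ≠ none) :
    ({ V with old := Function.update V.old x .DONE } : View Item p).SharedInv items := by
  refine { G with old := fun z hz => ?_, le_next := fun z w hz hw hr => ?_,
                  prev_ne_none := fun z hz h1 _ => ?_, new_ptr := fun y g hy hg => ?_,
                  not_protected_of_gone :=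
                    fun y hy h => G.not_protected_of_gone y hy (protected_of_setDone hx h) }
  · obtain rfl | h := eq_or_ne z x
    · simp
    · simpa [h, PrevOcc] using G.old z hz
  · refine (G.le_next z w hz (protected_of_setDone hx hw) hr).imp_right ?_
    rintro ⟨h1, -, h3⟩
    obtain rfl : x = z := by simpa [hx] using h1
    exact absurd h3 hn
  · by_cases h : V.head.2 = some z
    · exact hp z h
    · exact G.prev_ne_none z hz h1 fun h3 => absurd h3 h
  · obtain ⟨h1, h2, h3, h4⟩ := G.new_ptr y g hy hg
    refine ⟨h1, h2, h3, fun h => ?_⟩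
    have hgx : g ≠ x := fun hgx => (G.head_listed hx).ne' (hgx ▸ h)
    simpa [hgx] using h4 h

theorem SharedInv.evolves_setDone (G : V.SharedInv items) (hx : V.head.1 = some x)
    (hs : V.old x ≠ .DONE → ∀ j e, V.item x = some e → ¬ V.seeks j e) :
    V.Evolves { V with old := Function.update V.old x .DONE } items seen rely :=
  { Evolves.refl with
    old := by
      intro y _
      obtain rfl | h := eq_or_ne y x
      · simp
      · simp [h]
    unlinked := by
      intro j l y _ _ h h'
      have hyx : y ≠ x := fun hyx => (G.head_listed hx).ne' (hyx ▸ h)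
      exact ⟨h, h', by simp [hyx]⟩
    protected_of := fun w _ h => protected_of_setDone hx h
    protected_of_seeks := by
      rintro j e v hj - hv - ⟨h0, h | ⟨a, e', i, ha, hav, -⟩⟩
      · exact ⟨h0, .inl h⟩
      · obtain rfl : x = a := by simpa [hx] using ha
        have hvx := G.prevOcc_of_old (G.head_listed hx) hav
        exact absurd hj (hs (by simp [hav]) j e (hvx.2.1 ▸ hv)) }

end old

section ann

variable {ann' : Fin p → Ptr × Option Item} {seeks' : Fin p → Item → Prop}
  {unannounced' : Addr → Prop}

theorem Protected.of_seeks
    {w : Addr} (hw : ({ V with ann := ann', seeks := seeks', unannounced := unannounced' } :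
      View Item p).Protected w)
    (hs : ∀ j e, seeks' j e → V.seeks j e) : V.Protected w :=
  hw.imp_right <| Or.imp_right fun ⟨a, e, i, ha, haw, he, hi⟩ =>
    ⟨a, e, i, ha, haw, he, hs i e hi⟩

theorem Protected.of_seeking {j : Fin p} {e : Item} {v : Addr} (hj : seeks' j e)
    (hv : V.item v = some e) (h : V.Protected v) :
    ({ V with ann := ann', seeks := seeks', unannounced := unannounced' } :
      View Item p).Protected v :=
  h.imp_right <| Or.imp_right fun ⟨a, _, _, ha, hav, _⟩ => ⟨a, e, j, ha, hav, hv, hj⟩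

theorem SharedInv.setAnn (G : V.SharedInv items) (hs : ∀ j e, seeks' j e → V.seeks j e)
    (ha : ∀ j x, (ann' j).1 = some x → V.item x ≠ none ∧ ¬ unannounced' x) :
    ({ V with ann := ann', seeks := seeks', unannounced := unannounced' } :
      View Item p).SharedInv items :=
  { G with
    le_next := fun x w hx hw => G.le_next x w hx (hw.of_seeks hs)
    not_protected_of_gone := fun x hx hw => G.not_protected_of_gone x hx (hw.of_seeks hs)
    ann := ha }

theorem evolves_setAnn (hs : ∀ j e, seeks' j e → V.seeks j e ∧ ann' j = V.ann j)
    (hu : ∀ x, unannounced' x → V.unannounced x)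
    (hown : ∀ j l, rely j l → ann' j = V.ann j ∨ V.ann j = (l.g, some l.e) ∧ l.e ∈ items ∧
      ∃ x, ann' j = (some x, none) ∧ seen j x ∧ V.item x = some l.e ∧ 0 < V.rank x)
    (ha : ∀ j x e, ann' j = (x, some e) →
      V.ann j = (x, some e) ∨ ∃ y, x = some y ∧ V.unannounced y) :
    V.Evolves { V with ann := ann', seeks := seeks', unannounced := unannounced' }
      items seen rely :=
  { (Evolves.refl : V.Evolves V items seen rely) with
    protected_of := fun _ _ h => h.of_seeks fun j e hj => (hs j e hj).1
    protected_of_seeks := fun _ _ _ hj _ hv _ h => h.of_seeking hj hv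
    seeks := fun j e h => .inl (hs j e h).1
    seeks_own := fun j _ e _ h => (hs j e h).1
    ann_of_seeks := fun j e h => (hs j e h).2
    ann_own := hown
    ann_some := ha
    unannounced := fun x h => .inl (hu x h) }

theorem SharedInv.protected_of_seek (G : V.SharedInv items)
    (hs : ∀ j e, seeks' j e → V.seeks j e ∨ ∃ a, V.head.1 = some a ∧ V.item a ≠ some e) {w : Addr}
    (hw : ({ V with seeks := seeks' } : View Item p).Protected w) : V.Protected w := by
  refine hw.imp_right (Or.imp_right ?_)
  rintro ⟨a, e, i, ha, haw, he, hi⟩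
  refine ⟨a, e, i, ha, haw, he, (hs i e hi).resolve_right ?_⟩
  rintro ⟨a', ha', hae⟩
  obtain rfl : a = a' := Option.some.inj (ha.symm.trans ha')
  exact hae ((G.prevOcc_of_old (G.head_listed ha) haw).2.1 ▸ he)

theorem SharedInv.seek (G : V.SharedInv items)
    (hs : ∀ j e, seeks' j e → V.seeks j e ∨ ∃ a, V.head.1 = some a ∧ V.item a ≠ some e) :
    ({ V with seeks := seeks' } : View Item p).SharedInv items :=
  { G with
    le_next := fun x w hx hw => G.le_next x w hx (G.protected_of_seek hs hw)
    not_protected_of_gone := fun x hx hw =>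
      G.not_protected_of_gone x hx (G.protected_of_seek hs hw) }

theorem SharedInv.evolves_seek (G : V.SharedInv items)
    (hs : ∀ j e, seeks' j e → V.seeks j e ∨ ∃ a, V.head.1 = some a ∧ V.item a ≠ some e)
    (hown : ∀ j l e, rely j l → seeks' j e → V.seeks j e) :
    V.Evolves { V with seeks := seeks' } items seen rely :=
  { Evolves.refl with
    protected_of := fun _ _ h => G.protected_of_seek hs h
    protected_of_seeks := fun _ _ _ hj _ hv _ h => h.of_seeking hj hv
    seeks := hs
    seeks_own := hown
    ann_of_seeks := fun _ _ _ => rfl }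

end ann

section allocate

variable {x : Addr} {e : Item} {unannounced' : Addr → Prop}

theorem SharedInv.ne_of_item_eq_none (G : V.SharedInv items) (hx : V.item x = none) {z : Addr}
    (hz : 0 < V.rank z) : z ≠ x := by
  rintro rfl
  obtain ⟨e, -, h⟩ := G.item_mem z hz
  simp [hx] at h

theorem SharedInv.update_item_eq_iff (G : V.SharedInv items) (hx : V.item x = none) {z w : Addr}
    (hz : 0 < V.rank z) (hw : 0 < V.rank w) :
    Function.update V.item x (some e) z = Function.update V.item x (some e) w ↔
      V.item z = V.item w := by
  simp [G.ne_of_item_eq_none hx hz, G.ne_of_item_eq_none hx hw]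

theorem SharedInv.protected_allocate (G : V.SharedInv items) (hx : V.item x = none) (w : Addr) :
    ({ V with item := Function.update V.item x (some e), unannounced := unannounced' } :
      View Item p).Protected w ↔ V.Protected w := by
  refine and_congr_right fun h0 => or_congr (forall_congr' fun z => ?_) ?_
  · rcases Nat.eq_zero_or_pos (V.rank z) with h1 | h1
    · simp [h1]
    · exact imp_congr_left (G.update_item_eq_iff hx h1 h0)
  · simp [Awaited, G.ne_of_item_eq_none hx h0]

theorem SharedInv.prevOcc_allocate (G : V.SharedInv items) (hx : V.item x = none) {w z : Addr}
    (hz : 0 < V.rank z) (h : V.PrevOcc w z) :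
    ({ V with item := Function.update V.item x (some e), unannounced := unannounced' } :
      View Item p).PrevOcc w z := by
  obtain ⟨h1, h2, h3, h4⟩ := h
  refine ⟨h1, (G.update_item_eq_iff hx h1 hz).2 h2, h3, fun u hu hr => ?_⟩
  rcases Nat.eq_zero_or_pos (V.rank u) with h0 | h0
  · exact h0 ▸ Nat.zero_le _
  · exact h4 u ((G.update_item_eq_iff hx h0 hz).1 hu) hr

theorem SharedInv.allocate (G : V.SharedInv items) (hx : V.item x = none)
    (hu : ∀ y, unannounced' y → V.unannounced y ∨ y = x) :
    ({ V with item := Function.update V.item x (some e), unannounced := unannounced' } :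
      View Item p).SharedInv items := by
  have hne : ∀ z, 0 < V.rank z → z ≠ x := fun z hz => G.ne_of_item_eq_none hx hz
  refine { G with
    item_mem := fun z hz => by simpa [hne z hz] using G.item_mem z hz
    exists_node := fun e he => ?_
    head := ?_
    old := fun z hz => (G.old z hz).imp_right fun ⟨h1, w, h2, h3, h4⟩ =>
      ⟨h1, w, h2, G.prevOcc_allocate hx hz h3, h4⟩
    le_next := fun z w hz hw hr => G.le_next z w hz ((G.protected_allocate hx w).1 hw) hr
    new_ptr := fun z g hz hg => ?_
    new_of_later := fun z z' hz hr hi =>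
      G.new_of_later z z' hz hr ((G.update_item_eq_iff hx (hz.trans hr) hz).1 hi)
    not_protected_of_gone := fun z hz h =>
      G.not_protected_of_gone z hz ((G.protected_allocate hx z).1 h)
    ann := fun j y hy => ?_ }
  · obtain ⟨z, hz, h⟩ := G.exists_node e he
    exact ⟨z, hz, by simpa [hne z hz] using h⟩
  · obtain ⟨a, b, h1, h2, h3, h4, h5⟩ := G.head
    exact ⟨a, b, h1, h2, h3, fun h => h4 ((G.update_item_eq_iff hx (h2.trans h3) h2).1 h), h5⟩
  · obtain ⟨h1, h2⟩ := G.new_ptr z g hz hg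
    refine ⟨?_, h2⟩
    have hgx : g ≠ x := by
      rintro rfl
      obtain ⟨e, -, h⟩ := G.item_mem z hz
      simp [hx, h] at h1
    simpa [hne z hz, hgx] using h1
  · obtain ⟨h1, h2⟩ := G.ann j y hy
    have hyx : y ≠ x := by
      rintro rfl
      exact h1 hx
    exact ⟨by simpa [hyx] using h1, fun h => (hu y h).elim h2 hyx⟩

theorem SharedInv.evolves_allocate (G : V.SharedInv items) (hx : V.item x = none)
    (hu : ∀ y, unannounced' y → V.unannounced y ∨ y = x) :
    V.Evolves { V with item := Function.update V.item x (some e), unannounced := unannounced' }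
      items seen rely :=
  { (Evolves.refl : V.Evolves V items seen rely) with
    item := by
      intro y hy
      have h : y ≠ x := fun h => hy (h ▸ hx)
      simp [h]
    protected_of := fun w _ => (G.protected_allocate hx w).1
    protected_of_seeks := fun _ _ w _ _ _ _ => (G.protected_allocate hx w).2
    ann_own := fun _ _ _ => .inl rfl
    unannounced := by
      intro y h
      refine (hu y h).imp_right ?_
      rintro rfl
      exact hx }

end allocate

end View

namespace View

variable {V : View Item p} {items : List Item} {seen : Fin p → Addr → Prop}
  {rely : Fin p → Loc Item p → Prop}

/-- `CAS(Head, (a, b), (g, a))` succeeds and prepends `g`, which replaces `x`. -/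
structure CanPrepend (V : View Item p) (a b x g : Addr) : Prop where
  head : V.head = (some a, some b)
  old_head : V.old a = .DONE
  rank_pos : 0 < V.rank x
  rank_eq_zero : V.rank g = 0
  new : V.new x = .ptr (some g)

/-- The configuration after the node `g` has been prepended to a list with first node `a`. -/
def prepend (V : View Item p) (a g : Addr) : View Item p :=
  { V with head := (some g, some a), rank := Function.update V.rank g (V.rank a + 1) }

section prepend

variable {a b x g w z : Addr}

theorem rank_prepend_of_ne (h : z ≠ g) : (V.prepend a g).rank z = V.rank z := by
  simp [prepend, h]

theorem rank_prepend_self : (V.prepend a g).rank g = V.rank a + 1 := by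
  simp [prepend]

theorem SharedInv.latest_of_new (G : V.SharedInv items) (hx : 0 < V.rank x) (hg : V.rank g = 0)
    (hn : V.new x = .ptr (some g)) : V.Latest x := fun z hz =>
  not_lt.1 fun h => ((G.new_of_later x z hx h hz).2 g hn).ne' hg

namespace CanPrepend

theorem ne (C : V.CanPrepend a b x g) (hz : 0 < V.rank z) : z ≠ g := fun h =>
  hz.ne' (h ▸ C.rank_eq_zero)

theorem rank_prepend (C : V.CanPrepend a b x g) (hz : 0 < V.rank z) :
    (V.prepend a g).rank z = V.rank z :=
  rank_prepend_of_ne (C.ne hz)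

theorem rank_prepend_pos (C : V.CanPrepend a b x g) (hz : 0 < V.rank z) :
    0 < (V.prepend a g).rank z := by
  rwa [C.rank_prepend hz]

theorem eq_or_listed (hz : 0 < (V.prepend a g).rank z) : z = g ∨ z ≠ g ∧ 0 < V.rank z := by
  refine or_iff_not_imp_left.2 fun h => ⟨h, ?_⟩
  rwa [rank_prepend_of_ne h] at hz

theorem head_listed (C : V.CanPrepend a b x g) (G : V.SharedInv items) : 0 < V.rank a :=
  G.head_listed (by rw [C.head])

theorem rank_lt (C : V.CanPrepend a b x g) (G : V.SharedInv items) (z : Addr) :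
    V.rank z < (V.prepend a g).rank g := by
  have := G.rank_le_head (a := a) (by rw [C.head]) z
  rw [rank_prepend_self]
  omega

theorem latest (C : V.CanPrepend a b x g) (G : V.SharedInv items) : V.Latest x :=
  G.latest_of_new C.rank_pos C.rank_eq_zero C.new

theorem item_eq (C : V.CanPrepend a b x g) (G : V.SharedInv items) : V.item g = V.item x :=
  (G.new_ptr x g C.rank_pos C.new).1

theorem old (C : V.CanPrepend a b x g) (G : V.SharedInv items) : V.old g = .ptr (some x) :=
  (G.new_ptr x g C.rank_pos C.new).2.2.2 C.rank_eq_zero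

theorem item_ne (C : V.CanPrepend a b x g) (G : V.SharedInv items) : V.item g ≠ V.item a := by
  intro h
  obtain ⟨a', b', hab, -, hlt, -, hle⟩ := G.head
  obtain ⟨rfl, rfl⟩ : a = a' ∧ b = b' := by simpa [C.head] using hab
  have hxa : x ≠ a := fun hxa => (G.new_ptr x g C.rank_pos C.new).2.1 (by rw [C.head, hxa])
  have h1 := C.latest G a (h.symm.trans (C.item_eq G))
  have h2 := hle x hxa
  omega

theorem eq_or_protected (C : V.CanPrepend a b x g) (G : V.SharedInv items)
    (hw : (V.prepend a g).Protected w) : w = g ∨ V.Protected w := by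
  refine or_iff_not_imp_left.2 fun hwg => ?_
  obtain ⟨h0, h | ⟨a', e, i, h1, h2, -⟩⟩ := hw
  · rw [rank_prepend_of_ne hwg] at h0
    refine ⟨h0, .inl fun z hz => ?_⟩
    obtain rfl | hzg := eq_or_ne z g
    · simp [C.rank_eq_zero]
    · simpa only [rank_prepend_of_ne hzg, rank_prepend_of_ne hwg] using h z hz
  · obtain rfl : g = a' := by simpa [prepend] using h1
    obtain rfl : x = w := by simpa [prepend, C.old G] using h2
    exact ⟨C.rank_pos, .inl (C.latest G)⟩

theorem prevOcc (C : V.CanPrepend a b x g) (G : V.SharedInv items) :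
    (V.prepend a g).PrevOcc x g := by
  refine ⟨C.rank_prepend_pos C.rank_pos, (C.item_eq G).symm, ?_, fun z hz hr => ?_⟩
  · rw [C.rank_prepend C.rank_pos]
    exact C.rank_lt G x
  · have hzg : z ≠ g := fun h => hr.ne (h ▸ rfl)
    rw [rank_prepend_of_ne hzg, C.rank_prepend C.rank_pos]
    exact C.latest G z (hz.trans (C.item_eq G))

theorem protected_of_seeks (C : V.CanPrepend a b x g) (G : V.SharedInv items) {j : Fin p}
    {e : Item} (hj : V.seeks j e) (hz : V.item z = some e) (hp : V.Protected z) :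
    (V.prepend a g).Protected z := by
  refine ⟨C.rank_prepend_pos hp.1, ?_⟩
  obtain rfl | hzx := eq_or_ne z x
  · exact .inr ⟨g, e, j, rfl, C.old G, hz, hj⟩
  obtain ⟨h0, h | ⟨a', -, -, ha, hold, -⟩⟩ := hp
  · refine .inl fun u hu => ?_
    rw [C.rank_prepend h0]
    obtain rfl | hug := eq_or_ne u g
    · have h1 := h x ((C.item_eq G).symm.trans hu)
      have h2 := C.latest G z (hu.symm.trans (C.item_eq G))
      exact absurd (G.rank_inj z x h0 (by omega)) hzx
    · rw [rank_prepend_of_ne hug]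
      exact h u hu
  · obtain rfl : a = a' := by simpa [C.head] using ha
    simp [C.old_head] at hold

theorem rank_inj_prepend (C : V.CanPrepend a b x g) (G : V.SharedInv items) {y z : Addr}
    (hy : 0 < (V.prepend a g).rank y) (h : (V.prepend a g).rank y = (V.prepend a g).rank z) :
    y = z := by
  rcases eq_or_listed hy with rfl | ⟨hyg, hy0⟩
  · by_contra hyz
    rw [rank_prepend_of_ne (Ne.symm hyz)] at h
    exact (C.rank_lt G z).ne' h
  · have hzg : z ≠ g := by
      rintro rfl
      rw [rank_prepend_of_ne hyg] at h
      exact (C.rank_lt G y).ne h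
    rw [rank_prepend_of_ne hyg, rank_prepend_of_ne hzg] at h
    exact G.rank_inj y z hy0 h

theorem old_prepend (C : V.CanPrepend a b x g) (G : V.SharedInv items)
    (hz : 0 < (V.prepend a g).rank z) : V.old z = .DONE ∨ some g = some z ∧
      ∃ w, V.old z = .ptr (some w) ∧ (V.prepend a g).PrevOcc w z ∧
        (V.new w = .ptr (some z) ∨ V.new w = .GONE) := by
  rcases eq_or_listed hz with rfl | ⟨-, hz⟩
  · exact .inr ⟨rfl, x, C.old G, C.prevOcc G, .inl C.new⟩
  · refine .inl ((G.old z hz).resolve_right ?_)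
    rintro ⟨ha, w, hw, -⟩
    obtain rfl : a = z := by simpa [C.head] using ha
    simp [C.old_head] at hw

theorem le_next_prepend (C : V.CanPrepend a b x g) (G : V.SharedInv items)
    (hz : 0 < (V.prepend a g).rank z) (hw : (V.prepend a g).Protected w)
    (hr : (V.prepend a g).rank w < (V.prepend a g).rank z) :
    (∃ y, V.next z = some y ∧ (V.prepend a g).rank w ≤ (V.prepend a g).rank y) ∨
      some g = some z ∧ V.old z ≠ .DONE ∧ V.next z = none := by
  rcases eq_or_listed hz with rfl | ⟨hzg, hz⟩
  · exact .inr ⟨rfl, by simp [C.old G], (G.unlisted z C.rank_eq_zero).1⟩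
  · have hwg : w ≠ g := by
      rintro rfl
      rw [rank_prepend_of_ne hzg] at hr
      exact (C.rank_lt G z).not_gt hr
    rw [rank_prepend_of_ne hzg, rank_prepend_of_ne hwg] at hr
    rcases G.le_next z w hz ((C.eq_or_protected G hw).resolve_left hwg) hr with
      ⟨y, h1, h2⟩ | ⟨ha, h, -⟩
    · refine .inl ⟨y, h1, ?_⟩
      rwa [rank_prepend_of_ne hwg, C.rank_prepend (G.next_lt z y hz h1).1]
    · obtain rfl : a = z := by simpa [C.head] using ha
      exact absurd C.old_head h

theorem prev_ne_none_prepend (C : V.CanPrepend a b x g) (G : V.SharedInv items)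
    (hz : 0 < (V.prepend a g).rank z) (hzg : some g ≠ some z)
    (h : some a = some z → ∀ c, some g = some c → V.old c = .DONE) : V.prev z ≠ none := by
  obtain rfl | hza := eq_or_ne z a
  · simpa [C.old G] using h rfl g rfl
  · obtain ⟨-, hz⟩ := (eq_or_listed hz).resolve_left fun h => hzg (h ▸ rfl)
    refine G.prev_ne_none z hz (by simpa [C.head] using hza.symm) fun _ c hc => ?_
    obtain rfl : a = c := by simpa [C.head] using hc
    exact C.old_head

theorem new_ptr_prepend (C : V.CanPrepend a b x g) (G : V.SharedInv items) {y : Addr}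
    (hz : 0 < (V.prepend a g).rank z) (hy : V.new z = .ptr (some y)) :
    V.item y = V.item z ∧ some g ≠ some z ∧
      (0 < (V.prepend a g).rank y → (V.prepend a g).rank z < (V.prepend a g).rank y) ∧
      ((V.prepend a g).rank y = 0 → V.old y = .ptr (some z)) := by
  rcases eq_or_listed hz with rfl | ⟨hzg, hz⟩
  · simp [(G.unlisted z C.rank_eq_zero).2.2] at hy
  obtain ⟨h1, -, h3, h4⟩ := G.new_ptr z y hz hy
  refine ⟨h1, by simpa using hzg.symm, ?_⟩
  obtain rfl | hyg := eq_or_ne y g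
  · rw [rank_prepend_of_ne hzg]
    exact ⟨fun _ => C.rank_lt G z,
      fun h => absurd h ((C.rank_lt G z).trans_le' (Nat.zero_le _)).ne'⟩
  · rw [rank_prepend_of_ne hzg, rank_prepend_of_ne hyg]
    exact ⟨h3, h4⟩

theorem new_of_later_prepend (C : V.CanPrepend a b x g) (G : V.SharedInv items) {u : Addr}
    (hz : 0 < (V.prepend a g).rank z) (hr : (V.prepend a g).rank z < (V.prepend a g).rank u)
    (hi : V.item u = V.item z) :
    V.new z ≠ .ptr none ∧ ∀ y, V.new z = .ptr (some y) → 0 < (V.prepend a g).rank y := by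
  have of_later : ∀ u', 0 < V.rank z → V.rank z < V.rank u' → V.item u' = V.item z →
      V.new z ≠ .ptr none ∧ ∀ y, V.new z = .ptr (some y) → 0 < (V.prepend a g).rank y :=
    fun u' hz0 hr' hi' => (G.new_of_later z u' hz0 hr' hi').imp_right
      fun h y hy => C.rank_prepend_pos (h y hy)
  rcases eq_or_listed hz with rfl | ⟨hzg, hz0⟩
  · have huz : u ≠ z := fun h => hr.ne (h ▸ rfl)
    rw [rank_prepend_of_ne huz] at hr
    exact absurd hr (C.rank_lt G u).not_gt
  obtain rfl | hug := eq_or_ne u g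
  · obtain rfl | hzx := eq_or_ne z x
    · simp [C.new, rank_prepend_self]
    · have hle := C.latest G z (hi.symm.trans (C.item_eq G))
      have hne : V.rank z ≠ V.rank x := fun h => hzx (G.rank_inj z x hz0 h)
      exact of_later x hz0 (by omega) ((C.item_eq G).symm.trans hi)
  · rw [rank_prepend_of_ne hzg, rank_prepend_of_ne hug] at hr
    exact of_later u hz0 hr hi

theorem sharedInv_prepend (C : V.CanPrepend a b x g) (G : V.SharedInv items) :
    (V.prepend a g).SharedInv items where
  rank_inj _ _ := C.rank_inj_prepend G
  item_mem z hz := by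
    rcases eq_or_listed hz with rfl | ⟨-, hz⟩
    · obtain ⟨e, he, h⟩ := G.item_mem x C.rank_pos
      exact ⟨e, he, (C.item_eq G).trans h⟩
    · exact G.item_mem z hz
  exists_node e he := by
    obtain ⟨z, hz, h⟩ := G.exists_node e he
    exact ⟨z, C.rank_prepend_pos hz, h⟩
  head := by
    refine ⟨g, a, rfl, C.rank_prepend_pos (C.head_listed G), ?_, C.item_ne G, fun z hz => ?_⟩
    · rw [C.rank_prepend (C.head_listed G)]
      exact C.rank_lt G a
    · rw [rank_prepend_of_ne hz, C.rank_prepend (C.head_listed G)]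
      exact G.rank_le_head (by rw [C.head]) z
  old _ := C.old_prepend G
  next_lt z y hz hy := by
    rcases eq_or_listed hz with rfl | ⟨-, hz⟩
    · simp [prepend, (G.unlisted z C.rank_eq_zero).1] at hy
    · have h := G.next_lt z y hz hy
      rwa [C.rank_prepend h.1, C.rank_prepend hz]
  le_next _ _ := C.le_next_prepend G
  prev_listed z y hz hy := by
    rcases eq_or_listed hz with rfl | ⟨-, hz⟩
    · simp [prepend, (G.unlisted z C.rank_eq_zero).2.1] at hy
    · exact C.rank_prepend_pos (G.prev_listed z y hz hy)
  prev_ne_none _ := C.prev_ne_none_prepend G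
  new_ptr _ _ := C.new_ptr_prepend G
  new_of_later _ _ := C.new_of_later_prepend G
  not_protected_of_gone z hz hw := by
    rcases C.eq_or_protected G hw with rfl | hw
    · simp [prepend, (G.unlisted z C.rank_eq_zero).2.2] at hz
    · exact G.not_protected_of_gone z hz hw
  unlisted z hz := G.unlisted z <| by
    by_contra h
    exact (C.rank_prepend_pos (Nat.pos_of_ne_zero h)).ne' hz
  ann := G.ann

theorem evolves_prepend (C : V.CanPrepend a b x g) (G : V.SharedInv items) :
    V.Evolves (V.prepend a g) items seen rely where
  __ := (Evolves.refl : V.Evolves V items seen rely)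
  rank z := by
    obtain rfl | hzg := eq_or_ne z g
    · obtain ⟨e, -, h⟩ := G.item_mem x C.rank_pos
      exact .inr ⟨C.rank_eq_zero, rfl, by simp [C.item_eq G, h], C.rank_lt G⟩
    · exact .inl (rank_prepend_of_ne hzg)
  head z hz h := absurd (Option.some.inj h).symm (C.ne hz)
  next z hz h := absurd (Option.some.inj h).symm (C.ne hz)
  new z _ := .inl rfl
  unlinked j l y _ _ hy hny := by
    have hyg : y ≠ g := by
      rintro rfl
      exact hny x C.rank_pos C.new
    refine ⟨by rwa [rank_prepend_of_ne hyg], fun z hz => ?_, rfl⟩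
    rcases eq_or_listed hz with rfl | ⟨-, hz⟩
    · simp [prepend, (G.unlisted z C.rank_eq_zero).2.2]
    · exact hny z hz
  protected_of w hw h := (C.eq_or_protected G h).resolve_left (C.ne hw)
  protected_of_seeks _ _ _ hj _ hv _ h := C.protected_of_seeks G hj hv h
  ann_own _ _ _ := .inl rfl

end CanPrepend

end prepend

end View

namespace View

section predicates

variable (V : View Item p) (items : List Item) (seen : Fin p → Addr → Prop) (i : Fin p)
  (l : Loc Item p)

/-- Another process told `i` that its item was at the front of the list, in the node `x`. -/
def Informed : Prop :=
  ∃ x, V.ann i = (some x, none) ∧ seen i x ∧ V.item x = some l.e ∧ 0 < V.rank x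

/-- The announcement of `i` stands or has been answered. -/
def Announced : Prop :=
  V.ann i = (l.g, some l.e) ∨ V.Informed seen i l

/-- Only `i` can change its new node, whose field `old` contains `o`. -/
def Unlinked (o : Link) : Prop :=
  ∃ x, l.g = some x ∧ V.item x = some l.e ∧ V.rank x = 0 ∧
    (∀ y, 0 < V.rank y → V.new y ≠ .ptr (some x)) ∧ V.old x = o

/-- `i` has read the answer to its announcement. -/
def Withdrawing : Prop :=
  V.ann i = (l.a, l.b) ∧ l.b = none

/-- The process read `Head` when the item was at the front. -/
def AtFront : Prop :=
  ∃ a, l.h1 = some a ∧ V.item a = some l.e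

/-- The process read `Head` when the item was not at the front. -/
def Missed : Prop :=
  ∃ a, l.h1 = some a ∧ V.item a ≠ some l.e

/-- The traversal is at a node that contains the item. -/
def Found : Prop :=
  ∃ x, l.h = some x ∧ V.item x = some l.e

/-- The traversal is at a node that does not contain the item. -/
def NotFound : Prop :=
  ∃ x, l.h = some x ∧ V.item x ≠ some l.e

/-- Some process has proposed a replacement for the node found. -/
def HasReplacement : Prop :=
  ∀ x, l.h = some x → V.new x ≠ .ptr none

/-- `g'` is the replacement of the node found. -/
def Target : Prop :=
  ∃ x y, l.h = some x ∧ l.g' = some y ∧ V.item y ≠ none ∧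
    (V.new x = .ptr (some y) ∨ V.new x = .GONE ∧ 0 < V.rank y)

/-- `(k1, k2)` has been the value of `Head`. -/
def HeadPair : Prop :=
  ∃ x y, l.k1 = some x ∧ l.k2 = some y ∧ 0 < V.rank y ∧ V.rank y < V.rank x ∧
    ∀ z, V.rank z < V.rank x → V.rank z ≤ V.rank y

/-- The replacement of `k1` for its predecessor is complete. -/
def OldDone : Prop :=
  ∀ x, l.k1 = some x → V.old x = .DONE

/-- If `k1` is still at the front, then `g'` has never been in the list. -/
def NotPrepended : Prop :=
  V.head.1 = l.k1 → ∀ y, l.g' = some y → V.rank y = 0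

/-- `k1` replaces `h'`. -/
def Replaces : Prop :=
  ∃ x w, l.k1 = some x ∧ l.h' = some w ∧ V.PrevOcc w x ∧
    (V.old x = .DONE ∨ V.old x = .ptr (some w))

/-- The field `next` of `k1` has been set. -/
def NextSet : Prop :=
  ∀ x, l.k1 = some x → V.head.1 = some x → V.next x ≠ none

/-- The field `prev` of `k2` has been set. -/
def PrevSet : Prop :=
  ∀ y, l.k2 = some y → V.prev y ≠ none

/-- If the replacement by `k1` is in progress, then every process that searches for the item of
`k1` is `pending`. -/
def Informing (pending : Fin p → Prop) : Prop :=
  ∀ x, l.k1 = some x → V.item x = some l.e' ∧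
    (V.head.1 = some x → V.old x ≠ .DONE → ∀ j, V.seeks j l.e' → pending j)

/-- `(a, b)` is an announcement of the item `e'` that process `j` has made. -/
def Informee : Prop :=
  ∃ j, l.j = some j ∧ l.b = some l.e' ∧ ∀ x, l.a = some x → V.item x ≠ none ∧ ¬ V.unannounced x

/-- If process `j` still waits for an answer, then `k1` is a valid one. -/
def ValidAnswer : Prop :=
  ∀ j x, l.j = some j → V.ann j = (l.a, l.b) → l.k1 = some x → seen j x

/-- `pred` can be linked to the successor of `h'`. -/
def GotPrev : Prop :=
  ∃ y, l.pred = some y ∧ 0 < V.rank y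

/-- A traversal that continues with `succ` instead of `h'` does not miss a protected node. -/
def GotNext : Prop :=
  ∀ w, l.h' = some w → (∀ u, l.succ = some u → 0 < V.rank u ∧ V.rank u < V.rank w) ∧
    ∀ z, V.Protected z → V.rank z < V.rank w → ∃ u, l.succ = some u ∧ V.rank z ≤ V.rank u

/-- The result of the operation is correct. -/
def CorrectResult : Prop :=
  (l.e ∈ items → ∃ x, l.res = .pointer (some x) ∧ seen i x ∧ V.item x = some l.e) ∧
    (l.e ∉ items → l.res = .notPresent)

/-- The process traverses the list. -/
def Searching : Prop :=
  V.Announced seen i l ∧ V.Unlinked l (.ptr none) ∧ V.Missed l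

/-- The process performs MOVE-TO-FRONT. -/
def Moving : Prop :=
  V.Announced seen i l ∧ V.Missed l ∧ V.Found l ∧ V.Target l

/-- The process completes the replacement of `h'` by `k1`. -/
def Helping : Prop :=
  V.Moving seen i l ∧ V.HeadPair l ∧ V.Replaces l

/-- The process completes the replacement of `h'` by `k1`, which is linked to its successor. -/
def Linked : Prop :=
  V.Helping seen i l ∧ V.NextSet l ∧ V.PrevSet l

/-- The process removes `h'`, for which nobody searches any more. -/
def Removing : Prop :=
  V.Linked seen i l ∧ V.Informing l fun _ => False

/-- The proof outline of the algorithm: the assertion about process `i` at each position. -/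
def Outline : PC → Prop
  | .allocate => V.ann i = (none, none) ∧ l.h1 = none
  | .announce => V.ann i = (none, none) ∧ V.Unlinked l (.ptr none) ∧ l.h1 = none
  | .getHead => V.Announced seen i l ∧ V.Unlinked l (.ptr none) ∧ l.h1 = none
  | .testFront => V.Announced seen i l ∧ V.Unlinked l (.ptr none) ∧ l.h1 ≠ none
  | .unannFront1 => V.Announced seen i l ∧ V.AtFront l
  | .unannFront2 => V.AtFront l ∧ V.Withdrawing i l
  | .loop => V.Searching seen i l
  | .testItem => V.Searching seen i l ∧ l.h ≠ none
  | .readAnn1 | .setOld => V.Searching seen i l ∧ V.Found l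
  | .setNew => V.Announced seen i l ∧ V.Unlinked l (.ptr l.h) ∧ V.Missed l ∧ V.Found l
  | .getNew => V.Announced seen i l ∧ V.Missed l ∧ V.Found l ∧ V.HasReplacement l
  | .readAnn3 | .next => V.Searching seen i l ∧ V.NotFound l
  | .readAnn4 => V.Announced seen i l ∧ V.Missed l ∧ l.h = none
  | .unannEnd => V.Announced seen i l ∧ V.ann i = (l.a, l.b) ∧ (l.b = none ∨ l.e ∉ items)
  | .readAnn2 => V.Informed seen i l
  | .unannOther1 | .unannOther2 | .unannPostMTF => V.Informed seen i l ∧ V.Withdrawing i l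
  | .ret => V.ann i = (none, none) ∧ V.CorrectResult items seen i l
  | .outer | .getHead2 => V.Moving seen i l
  | .getOld => V.Moving seen i l ∧ V.HeadPair l
  | .testPrepend => V.Moving seen i l ∧ V.HeadPair l ∧ V.OldDone l
  | .prepend => V.Moving seen i l ∧ V.HeadPair l ∧ V.OldDone l ∧ V.NotPrepended l
  | .setNext => V.Helping seen i l
  | .setPrev => V.Helping seen i l ∧ V.NextSet l
  | .getItem => V.Linked seen i l
  | .readAnn => V.Linked seen i l ∧ V.Informing l (· ∈ l.todo)
  | .testInform => V.Linked seen i l ∧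
      V.Informing l (fun j => j ∈ l.todo ∨ l.j = some j ∧ V.ann j = (l.a, l.b)) ∧ V.Informee l
  | .inform => V.Linked seen i l ∧
      V.Informing l (fun j => j ∈ l.todo ∨ l.j = some j ∧ V.ann j = (l.a, l.b)) ∧ V.Informee l ∧
      V.ValidAnswer seen l
  | .getPrev | .gone | .done => V.Removing seen i l
  | .getNext => V.Removing seen i l ∧ V.GotPrev l
  | .remove1 | .remove2 => V.Removing seen i l ∧ V.GotPrev l ∧ V.GotNext l

/-- A traversal by a process that has to find its item has not passed the node it has to find. -/
def OnTrack : Prop :=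
  V.seeks i l.e → l.e ∈ items → ∃ x v, l.h = some x ∧ V.Protected v ∧ V.item v = some l.e ∧
    V.head.1 ≠ some v ∧ V.rank v ≤ V.rank x

/-- The invariant about the local state `l` of process `i`. The addresses in `seen j` were at the
front of the list at some time during the current operation of process `j`. -/
structure Local : Prop where
  g_allocated : ∀ x, l.g = some x → V.item x ≠ none
  h1_seen : ∀ x, l.h1 = some x → 0 < V.rank x ∧ seen i x
  h_passed : ∀ x, l.h = some x → 0 < V.rank x ∧ V.head.1 ≠ some x
  onTrack : V.OnTrack items i l
  outline : V.Outline items seen i l l.pc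

end predicates

variable {V V' : View Item p} {items : List Item} {seen seen' : Fin p → Addr → Prop}
  {rely : Fin p → Loc Item p → Prop} {i : Fin p} {l : Loc Item p}

theorem Local.outline_at {q : PC} (L : V.Local items seen i l) (hpc : l.pc = q) :
    V.Outline items seen i l q :=
  hpc ▸ L.outline

section of_seen

theorem Informed.of_seen (h : ∀ x, seen i x → seen' i x) (hI : V.Informed seen i l) :
    V.Informed seen' i l :=
  hI.imp fun x ⟨h1, h2, h3⟩ => ⟨h1, h x h2, h3⟩

theorem Announced.of_seen (h : ∀ x, seen i x → seen' i x) (hA : V.Announced seen i l) :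
    V.Announced seen' i l :=
  hA.imp_right (·.of_seen h)

theorem CorrectResult.of_seen (h : ∀ x, seen i x → seen' i x)
    (hr : V.CorrectResult items seen i l) : V.CorrectResult items seen' i l :=
  hr.imp_left fun hr he => (hr he).imp fun x ⟨h1, h2, h3⟩ => ⟨h1, h x h2, h3⟩

theorem Searching.of_seen (h : ∀ x, seen i x → seen' i x) (hS : V.Searching seen i l) :
    V.Searching seen' i l :=
  hS.imp_left (·.of_seen h)

theorem Moving.of_seen (h : ∀ x, seen i x → seen' i x) (hM : V.Moving seen i l) :
    V.Moving seen' i l :=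
  hM.imp_left (·.of_seen h)

theorem Helping.of_seen (h : ∀ x, seen i x → seen' i x) (hH : V.Helping seen i l) :
    V.Helping seen' i l :=
  hH.imp_left (·.of_seen h)

theorem Linked.of_seen (h : ∀ x, seen i x → seen' i x) (hL : V.Linked seen i l) :
    V.Linked seen' i l :=
  hL.imp_left (·.of_seen h)

theorem Removing.of_seen (h : ∀ x, seen i x → seen' i x) (hR : V.Removing seen i l) :
    V.Removing seen' i l :=
  hR.imp_left (·.of_seen h)

theorem ValidAnswer.of_seen (h : ∀ j x, (V.ann j).2 ≠ none → seen j x → seen' j x)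
    (hI : V.Informee l) (hv : V.ValidAnswer seen l) : V.ValidAnswer seen' l := by
  intro j x hj ha hx
  obtain ⟨-, -, hb, -⟩ := hI
  exact h j x (by simp [ha, hb]) (hv j x hj ha hx)

theorem Outline.of_seen (h : ∀ j x, j = i ∨ (V.ann j).2 ≠ none → seen j x → seen' j x) :
    ∀ q, V.Outline items seen i l q → V.Outline items seen' i l q := by
  have hi : ∀ x, seen i x → seen' i x := fun x => h i x (.inl rfl)
  intro q O
  cases q
  case allocate => exact O
  case announce => exact O
  case getHead | testFront | unannFront1 | getNew | setNew | readAnn4 | unannEnd =>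
    exact O.imp_left (Announced.of_seen hi)
  case unannFront2 => exact O
  case loop => exact Searching.of_seen hi O
  case testItem | readAnn1 | setOld | readAnn3 | next => exact O.imp_left (Searching.of_seen hi)
  case readAnn2 => exact Informed.of_seen hi O
  case unannOther1 | unannOther2 | unannPostMTF => exact O.imp_left (Informed.of_seen hi)
  case ret => exact O.imp_right (CorrectResult.of_seen hi)
  case outer | getHead2 => exact Moving.of_seen hi O
  case getOld | testPrepend | prepend => exact O.imp_left (Moving.of_seen hi)
  case setNext => exact Helping.of_seen hi O
  case setPrev => exact O.imp_left (Helping.of_seen hi)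
  case getItem => exact Linked.of_seen hi O
  case readAnn | testInform => exact O.imp_left (Linked.of_seen hi)
  case inform =>
    obtain ⟨hL, hI, hJ, hv⟩ := O
    exact ⟨hL.of_seen hi, hI, hJ, hv.of_seen (fun j x hj => h j x (.inr hj)) hJ⟩
  case getPrev | gone | done => exact Removing.of_seen hi O
  case getNext | remove1 | remove2 => exact O.imp_left (Removing.of_seen hi)

theorem Local.of_seen (h : ∀ j x, j = i ∨ (V.ann j).2 ≠ none → seen j x → seen' j x)
    (L : V.Local items seen i l) : V.Local items seen' i l :=
  { L with
    h1_seen := fun x hx => (L.h1_seen x hx).imp_right (h i x (.inl rfl))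
    outline := Outline.of_seen h l.pc L.outline }

end of_seen

namespace Evolves

theorem rank_eq (E : V.Evolves V' items seen rely) {x : Addr} (hx : 0 < V.rank x) :
    V'.rank x = V.rank x :=
  (E.rank x).resolve_right fun h => hx.ne' h.1

theorem rank_pos (E : V.Evolves V' items seen rely) {x : Addr} (hx : 0 < V.rank x) :
    0 < V'.rank x :=
  (E.rank_eq hx).symm ▸ hx

theorem rank_eq_of_le (E : V.Evolves V' items seen rely) {x z : Addr} (hx : 0 < V.rank x)
    (h : V'.rank z ≤ V'.rank x) : V'.rank z = V.rank z :=
  (E.rank z).resolve_right fun ⟨_, _, _, h'⟩ => (h' x).not_ge (E.rank_eq hx ▸ h)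

theorem item_some (E : V.Evolves V' items seen rely) {x : Addr} {e : Item}
    (h : V.item x = some e) : V'.item x = some e := by
  rw [E.item x (by simp [h]), h]

theorem item_eq (G : V.SharedInv items) (E : V.Evolves V' items seen rely) {x : Addr}
    (hx : 0 < V.rank x) : V'.item x = V.item x := by
  obtain ⟨e, -, he⟩ := G.item_mem x hx
  exact E.item x (by simp [he])

theorem old_ne_done (E : V.Evolves V' items seen rely) {x : Addr} (hx : 0 < V.rank x)
    (h : V'.old x ≠ .DONE) : V.old x ≠ .DONE := fun h' =>
  (E.old x hx).elim (fun h'' => h (h''.trans h')) h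

theorem prevOcc (G : V.SharedInv items) (E : V.Evolves V' items seen rely) {w x : Addr}
    (h : V.PrevOcc w x) : V'.PrevOcc w x := by
  obtain ⟨hw, hi, hr, hmax⟩ := h
  have hx := hw.trans hr
  refine ⟨E.rank_pos hw, by rw [E.item_eq G hw, E.item_eq G hx, hi],
    by rwa [E.rank_eq hw, E.rank_eq hx], fun z hz hzr => ?_⟩
  have hzeq := E.rank_eq_of_le hx hzr.le
  rw [hzeq, E.rank_eq hx] at hzr
  rw [hzeq, E.rank_eq hw]
  rcases Nat.eq_zero_or_pos (V.rank z) with h0 | h0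
  · exact h0 ▸ Nat.zero_le _
  · exact hmax z (by rwa [E.item_eq G h0, E.item_eq G hx] at hz) hzr

end Evolves

section evolves

theorem ann_eq_none_of_evolves (h : V.ann i = (none, none)) (E : V.Evolves V' items seen rely)
    (hi : rely i l) : V'.ann i = (none, none) := by
  rcases E.ann_own i l hi with h' | ⟨h', -⟩
  · rw [h', h]
  · simp [h] at h'

theorem Informed.evolves (h : V.Informed seen i l) (E : V.Evolves V' items seen rely)
    (hi : rely i l) : V'.Informed seen i l := by
  obtain ⟨x, ha, hs, he, hx⟩ := h
  rcases E.ann_own i l hi with h' | ⟨h', -⟩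
  · exact ⟨x, h'.trans ha, hs, E.item_some he, E.rank_pos hx⟩
  · simp [ha] at h'

theorem Announced.evolves (h : V.Announced seen i l) (E : V.Evolves V' items seen rely)
    (hi : rely i l) : V'.Announced seen i l := by
  rcases h with h | h
  · exact (E.ann_own i l hi).imp (·.trans h) fun ⟨_, _, hI⟩ => hI
  · exact .inr (h.evolves E hi)

theorem Withdrawing.evolves (h : V.Withdrawing i l) (E : V.Evolves V' items seen rely)
    (hi : rely i l) : V'.Withdrawing i l := by
  obtain ⟨ha, hb⟩ := h
  rcases E.ann_own i l hi with h' | ⟨h', -⟩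
  · exact ⟨h'.trans ha, hb⟩
  · simp [ha, hb] at h'

theorem unannEnd_of_evolves (h : V.ann i = (l.a, l.b) ∧ (l.b = none ∨ l.e ∉ items))
    (E : V.Evolves V' items seen rely) (hi : rely i l) :
    V'.ann i = (l.a, l.b) ∧ (l.b = none ∨ l.e ∉ items) := by
  obtain ⟨ha, hb⟩ := h
  rcases E.ann_own i l hi with h' | ⟨h', he, -⟩
  · exact ⟨h'.trans ha, hb⟩
  · obtain hb | hb := hb
    · simp [ha, hb] at h'
    · exact absurd he hb

theorem Unlinked.evolves {o : Link} (h : V.Unlinked l o) (E : V.Evolves V' items seen rely)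
    (hi : rely i l) : V'.Unlinked l o := by
  obtain ⟨x, hx, he, h0, hn, ho⟩ := h
  obtain ⟨h0', hn', ho'⟩ := E.unlinked i l x hi hx h0 hn
  exact ⟨x, hx, E.item_some he, h0', hn', ho'.trans ho⟩

theorem AtFront.evolves (h : V.AtFront l) (E : V.Evolves V' items seen rely) : V'.AtFront l :=
  h.imp fun _ => And.imp_right E.item_some

theorem Missed.evolves (h : V.Missed l) (G : V.SharedInv items)
    (E : V.Evolves V' items seen rely) (L : V.Local items seen i l) : V'.Missed l :=
  h.imp fun a ⟨ha, hne⟩ => ⟨ha, (E.item_eq G (L.h1_seen a ha).1).trans_ne hne⟩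

theorem Found.evolves (h : V.Found l) (E : V.Evolves V' items seen rely) : V'.Found l :=
  h.imp fun _ => And.imp_right E.item_some

theorem NotFound.evolves (h : V.NotFound l) (G : V.SharedInv items)
    (E : V.Evolves V' items seen rely) (L : V.Local items seen i l) : V'.NotFound l :=
  h.imp fun x ⟨hx, hne⟩ => ⟨hx, (E.item_eq G (L.h_passed x hx).1).trans_ne hne⟩

theorem HasReplacement.evolves (h : V.HasReplacement l) (E : V.Evolves V' items seen rely)
    (L : V.Local items seen i l) : V'.HasReplacement l := by
  intro x hx
  rcases E.new x (L.h_passed x hx).1 with h' | ⟨g, -, h'⟩ | ⟨g, -, -, h'⟩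
  · exact h'.trans_ne (h x hx)
  · simp [h']
  · simp [h']

theorem Target.evolves (h : V.Target l) (E : V.Evolves V' items seen rely)
    (L : V.Local items seen i l) : V'.Target l := by
  obtain ⟨x, y, hx, hy, hi, hn⟩ := h
  refine ⟨x, y, hx, hy, (E.item y hi).trans_ne hi, ?_⟩
  rcases E.new x (L.h_passed x hx).1 with h' | ⟨g, h', -⟩ | ⟨g, h', hg, hgone⟩
  · exact h' ▸ hn.imp_right (And.imp_right E.rank_pos)
  · simp [h'] at hn
  · obtain rfl : g = y := by simpa [h'] using hn
    exact .inr ⟨hgone, hg⟩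

theorem HeadPair.evolves (h : V.HeadPair l) (E : V.Evolves V' items seen rely) :
    V'.HeadPair l := by
  obtain ⟨x, y, hx, hy, h0, hlt, hmax⟩ := h
  have hx0 := h0.trans hlt
  refine ⟨x, y, hx, hy, E.rank_pos h0, by rwa [E.rank_eq h0, E.rank_eq hx0], fun z hz => ?_⟩
  have hzeq := E.rank_eq_of_le hx0 hz.le
  rw [hzeq, E.rank_eq hx0] at hz
  rw [hzeq, E.rank_eq h0]
  exact hmax z hz

theorem HeadPair.rank_pos (h : V.HeadPair l) {x : Addr} (hx : l.k1 = some x) : 0 < V.rank x := by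
  obtain ⟨x', y, hx', -, h0, hlt, -⟩ := h
  obtain rfl : x' = x := Option.some.inj (hx'.symm.trans hx)
  exact h0.trans hlt

theorem OldDone.evolves (h : V.OldDone l) (E : V.Evolves V' items seen rely)
    (hH : V.HeadPair l) : V'.OldDone l := fun x hx =>
  (E.old x (hH.rank_pos hx)).elim (·.trans (h x hx)) id

theorem NotPrepended.evolves (h : V.NotPrepended l) (E : V.Evolves V' items seen rely)
    (hH : V.HeadPair l) : V'.NotPrepended l := by
  intro ha y hy
  obtain ⟨x, _, hx, -, h0, hlt, -⟩ := hH
  have hx0 := h0.trans hlt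
  rw [hx] at ha
  have hy0 := h ((E.head x hx0 ha).trans hx.symm) y hy
  rcases E.rank y with h' | ⟨-, hy', -⟩
  · exact h'.trans hy0
  · obtain rfl : x = y := Option.some.inj (ha.symm.trans hy')
    exact absurd hy0 hx0.ne'

theorem Replaces.evolves (h : V.Replaces l) (G : V.SharedInv items)
    (E : V.Evolves V' items seen rely) : V'.Replaces l := by
  obtain ⟨x, w, hx, hw, hxw, ho⟩ := h
  refine ⟨x, w, hx, hw, E.prevOcc G hxw, ?_⟩
  exact (E.old x (hxw.1.trans hxw.2.2.1)).elim (fun h => h ▸ ho) .inl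

theorem NextSet.evolves (h : V.NextSet l) (E : V.Evolves V' items seen rely)
    (hH : V.HeadPair l) : V'.NextSet l := fun x hx ha =>
  have hx0 := hH.rank_pos hx
  E.next x hx0 ha (h x hx (E.head x hx0 ha))

theorem PrevSet.evolves (h : V.PrevSet l) (E : V.Evolves V' items seen rely) : V'.PrevSet l :=
  fun y hy => E.prev y (h y hy)

theorem Informing.evolves {pending pending' : Fin p → Prop} (h : V.Informing l pending)
    (E : V.Evolves V' items seen rely) (hH : V.HeadPair l)
    (hp : ∀ j, V'.seeks j l.e' → pending j → pending' j) : V'.Informing l pending' := by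
  intro x hx
  obtain ⟨he, h⟩ := h x hx
  have hx0 := hH.rank_pos hx
  refine ⟨E.item_some he, fun ha ho j hj => hp j hj ?_⟩
  have ha' := E.head x hx0 ha
  refine h ha' (E.old_ne_done hx0 ho) j ((E.seeks j _ hj).resolve_right ?_)
  rintro ⟨a, haa, hae⟩
  obtain rfl : a = x := Option.some.inj (haa.symm.trans ha')
  exact hae he

theorem Informee.evolves (h : V.Informee l) (E : V.Evolves V' items seen rely) :
    V'.Informee l := by
  obtain ⟨j, hj, hb, ha⟩ := h
  refine ⟨j, hj, hb, fun x hx => ?_⟩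
  obtain ⟨hi, hu⟩ := ha x hx
  exact ⟨(E.item x hi).trans_ne hi, fun hx' => (E.unannounced x hx').elim hu hi⟩

theorem ValidAnswer.evolves (h : V.ValidAnswer seen l) (E : V.Evolves V' items seen rely)
    (hI : V.Informee l) : V'.ValidAnswer seen l := by
  obtain ⟨-, -, hb, ha⟩ := hI
  intro j x hj hab hx
  rcases E.ann_some j _ _ (hb ▸ hab) with hab' | ⟨y, hy, hu⟩
  · exact h j x hj (hb ▸ hab') hx
  · exact absurd hu (ha y hy).2

theorem GotPrev.evolves (h : V.GotPrev l) (E : V.Evolves V' items seen rely) : V'.GotPrev l :=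
  h.imp fun _ => And.imp_right E.rank_pos

theorem GotNext.evolves (h : V.GotNext l) (E : V.Evolves V' items seen rely)
    (hR : V.Replaces l) : V'.GotNext l := by
  obtain ⟨-, w', -, hw', ⟨hw0, -⟩, -⟩ := hR
  intro w hw
  obtain rfl : w' = w := Option.some.inj (hw'.symm.trans hw)
  obtain ⟨hu, hz⟩ := h w' hw
  refine ⟨fun u hu' => ?_, fun z hzp hzr => ?_⟩
  · obtain ⟨hu0, hlt⟩ := hu u hu'
    exact ⟨E.rank_pos hu0, by rwa [E.rank_eq hu0, E.rank_eq hw0]⟩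
  · have hzeq := E.rank_eq_of_le hw0 hzr.le
    rw [hzeq, E.rank_eq hw0] at hzr
    have hz0 : 0 < V.rank z := hzeq ▸ hzp.1
    obtain ⟨u, hu', hle⟩ := hz z (E.protected_of z hz0 hzp) hzr
    exact ⟨u, hu', by rwa [hzeq, E.rank_eq (hu u hu').1]⟩

theorem CorrectResult.evolves (h : V.CorrectResult items seen i l)
    (E : V.Evolves V' items seen rely) : V'.CorrectResult items seen i l :=
  h.imp_left fun h he => (h he).imp fun _ => And.imp_right (And.imp_right E.item_some)

theorem Searching.evolves (h : V.Searching seen i l) (G : V.SharedInv items)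
    (E : V.Evolves V' items seen rely) (hi : rely i l) (L : V.Local items seen i l) :
    V'.Searching seen i l :=
  ⟨h.1.evolves E hi, h.2.1.evolves E hi, h.2.2.evolves G E L⟩

theorem Moving.evolves (h : V.Moving seen i l) (G : V.SharedInv items)
    (E : V.Evolves V' items seen rely) (hi : rely i l) (L : V.Local items seen i l) :
    V'.Moving seen i l :=
  ⟨h.1.evolves E hi, h.2.1.evolves G E L, h.2.2.1.evolves E, h.2.2.2.evolves E L⟩

theorem Helping.evolves (h : V.Helping seen i l) (G : V.SharedInv items)
    (E : V.Evolves V' items seen rely) (hi : rely i l) (L : V.Local items seen i l) :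
    V'.Helping seen i l :=
  ⟨h.1.evolves G E hi L, h.2.1.evolves E, h.2.2.evolves G E⟩

theorem Linked.evolves (h : V.Linked seen i l) (G : V.SharedInv items)
    (E : V.Evolves V' items seen rely) (hi : rely i l) (L : V.Local items seen i l) :
    V'.Linked seen i l :=
  ⟨h.1.evolves G E hi L, h.2.1.evolves E h.1.2.1, h.2.2.evolves E⟩

theorem Removing.evolves (h : V.Removing seen i l) (G : V.SharedInv items)
    (E : V.Evolves V' items seen rely) (hi : rely i l) (L : V.Local items seen i l) :
    V'.Removing seen i l :=
  ⟨h.1.evolves G E hi L, h.2.evolves E h.1.1.2.1 fun _ _ => id⟩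

theorem OnTrack.evolves (h : V.OnTrack items i l) (E : V.Evolves V' items seen rely)
    (hi : rely i l) (L : V.Local items seen i l) : V'.OnTrack items i l := by
  intro hs he
  have hs' := E.seeks_own i l l.e hi hs
  obtain ⟨x, v, hx, hv, hve, hva, hr⟩ := h hs' he
  refine ⟨x, v, hx, E.protected_of_seeks i l.e v hs hs' hve hva hv, E.item_some hve,
    fun ha => hva (E.head v hv.1 ha), ?_⟩
  rwa [E.rank_eq hv.1, E.rank_eq (L.h_passed x hx).1]

theorem Outline.evolves (G : V.SharedInv items) (E : V.Evolves V' items seen rely)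
    (hi : rely i l) (L : V.Local items seen i l) :
    ∀ q, V.Outline items seen i l q → V'.Outline items seen i l q := by
  have pending {j} (hj : V'.seeks j l.e') :
      j ∈ l.todo ∨ l.j = some j ∧ V.ann j = (l.a, l.b) →
        j ∈ l.todo ∨ l.j = some j ∧ V'.ann j = (l.a, l.b) :=
    Or.imp_right (And.imp_right (E.ann_of_seeks j _ hj).trans)
  intro q O
  cases q
  case allocate => exact O.imp_left (ann_eq_none_of_evolves · E hi)
  case announce => exact ⟨ann_eq_none_of_evolves O.1 E hi, O.2.1.evolves E hi, O.2.2⟩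
  case getHead | testFront => exact ⟨O.1.evolves E hi, O.2.1.evolves E hi, O.2.2⟩
  case unannFront1 => exact ⟨O.1.evolves E hi, O.2.evolves E⟩
  case unannFront2 => exact ⟨O.1.evolves E, O.2.evolves E hi⟩
  case loop => exact Searching.evolves O G E hi L
  case testItem => exact ⟨O.1.evolves G E hi L, O.2⟩
  case readAnn1 | setOld => exact ⟨O.1.evolves G E hi L, O.2.evolves E⟩
  case setNew =>
    exact ⟨O.1.evolves E hi, O.2.1.evolves E hi, O.2.2.1.evolves G E L, O.2.2.2.evolves E⟩
  case getNew =>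
    exact ⟨O.1.evolves E hi, O.2.1.evolves G E L, O.2.2.1.evolves E, O.2.2.2.evolves E L⟩
  case readAnn3 | next => exact ⟨O.1.evolves G E hi L, O.2.evolves G E L⟩
  case readAnn4 => exact ⟨O.1.evolves E hi, O.2.1.evolves G E L, O.2.2⟩
  case unannEnd => exact ⟨O.1.evolves E hi, unannEnd_of_evolves O.2 E hi⟩
  case readAnn2 => exact Informed.evolves O E hi
  case unannOther1 | unannOther2 | unannPostMTF => exact ⟨O.1.evolves E hi, O.2.evolves E hi⟩
  case ret => exact ⟨ann_eq_none_of_evolves O.1 E hi, O.2.evolves E⟩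
  case outer | getHead2 => exact Moving.evolves O G E hi L
  case getOld => exact ⟨O.1.evolves G E hi L, O.2.evolves E⟩
  case testPrepend => exact ⟨O.1.evolves G E hi L, O.2.1.evolves E, O.2.2.evolves E O.2.1⟩
  case prepend =>
    obtain ⟨hM, hH, hD, h0⟩ := O
    exact ⟨hM.evolves G E hi L, hH.evolves E, hD.evolves E hH, h0.evolves E hH⟩
  case setNext => exact Helping.evolves O G E hi L
  case setPrev => exact ⟨O.1.evolves G E hi L, O.2.evolves E O.1.2.1⟩
  case getItem => exact Linked.evolves O G E hi L
  case readAnn => exact ⟨O.1.evolves G E hi L, O.2.evolves E O.1.1.2.1 fun _ _ => id⟩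
  case testInform =>
    exact ⟨O.1.evolves G E hi L, O.2.1.evolves E O.1.1.2.1 fun _ => pending, O.2.2.evolves E⟩
  case inform =>
    exact ⟨O.1.evolves G E hi L, O.2.1.evolves E O.1.1.2.1 fun _ => pending, O.2.2.1.evolves E,
      O.2.2.2.evolves E O.2.2.1⟩
  case getPrev | gone | done => exact Removing.evolves O G E hi L
  case getNext => exact ⟨O.1.evolves G E hi L, O.2.evolves E⟩
  case remove1 | remove2 =>
    exact ⟨O.1.evolves G E hi L, O.2.1.evolves E, O.2.2.evolves E O.1.1.1.2.2⟩

theorem Local.evolves (L : V.Local items seen i l) (G : V.SharedInv items)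
    (E : V.Evolves V' items seen rely) (hi : rely i l) : V'.Local items seen i l where
  g_allocated x hx := (E.item x (L.g_allocated x hx)).trans_ne (L.g_allocated x hx)
  h1_seen x hx := (L.h1_seen x hx).imp_left E.rank_pos
  h_passed x hx := (L.h_passed x hx).imp E.rank_pos (mt (E.head x (L.h_passed x hx).1))
  onTrack := L.onTrack.evolves E hi L
  outline := Outline.evolves G E hi L l.pc L.outline

end evolves

end View

namespace View

variable {V : View Item p} {items : List Item} {seen : Fin p → Addr → Prop} {i : Fin p}
  {l : Loc Item p}

section own_steps

theorem SharedInv.eq_of_protected (G : V.SharedInv items) {x v : Addr} (hv : V.Protected v)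
    (hi : V.item x = V.item v) (hr : V.rank v ≤ V.rank x) (hx : 0 < V.rank x)
    (hh : V.head.1 ≠ some x) : x = v := by
  obtain ⟨-, h | ⟨a, e, j, ha, haw, -⟩⟩ := hv
  · exact G.rank_inj x v hx (le_antisymm (h x hi) hr)
  · obtain ⟨-, hav, -, hmax⟩ := G.prevOcc_of_old (G.head_listed ha) haw
    have hxa : V.rank x < V.rank a :=
      (G.rank_le_head ha x).lt_of_ne fun h =>
        hh (ha.trans (congrArg some (G.rank_inj x a hx h).symm))
    exact G.rank_inj x v hx (le_antisymm (hmax x (hi.trans hav) hxa) hr)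

theorem Local.not_seeks_of_not_protected (L : V.Local items seen i l) (G : V.SharedInv items)
    {x : Addr} (hx : l.h = some x) (hxe : V.item x = some l.e) (hp : ¬ V.Protected x) :
    ¬ V.seeks i l.e := by
  intro hs
  obtain ⟨hx0, hxh⟩ := L.h_passed x hx
  obtain ⟨e, he, he'⟩ := G.item_mem x hx0
  obtain rfl : e = l.e := Option.some_inj.1 (he'.symm.trans hxe)
  obtain ⟨x', v, hx', hv, hve, -, hr⟩ := L.onTrack hs he
  obtain rfl : x = x' := Option.some_inj.1 (hx.symm.trans hx')
  exact hp (G.eq_of_protected hv (hxe.trans hve.symm) hr hx0 hxh ▸ hv)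

theorem Announced.informed (h : V.Announced seen i l) (hb : (V.ann i).2 ≠ some l.e) :
    V.Informed seen i l :=
  h.resolve_left fun h' => hb (by rw [h'])

theorem Informed.ann_snd (h : V.Informed seen i l) : (V.ann i).2 = none := by
  obtain ⟨x, hx, -⟩ := h
  rw [hx]

theorem onTrack_head (G : V.SharedInv items)
    (hs : ∀ a, V.head.1 = some a → V.seeks i l.e → V.item a ≠ some l.e) :
    V.OnTrack items i { l with h1 := V.head.1, h := V.head.2, pc := .testFront } := by
  intro hs' he
  obtain ⟨a, b, hab, -, -, -, hb⟩ := G.head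
  obtain ⟨v, hv, hve, hlatest⟩ := G.exists_latest he
  have hva : v ≠ a := by
    rintro rfl
    exact hs v (by rw [hab]) hs' hve
  exact ⟨b, v, congrArg Prod.snd hab, ⟨hv, .inl hlatest⟩, hve, by simp [hab, hva.symm], hb v hva⟩

theorem Local.toTestFront (L : V.Local items seen i l) (hpc : l.pc = .getHead)
    {seeks' : Fin p → Item → Prop} (G : ({ V with seeks := seeks' } : View Item p).SharedInv items)
    (hs : ∀ a, V.head.1 = some a → seeks' i l.e → V.item a ≠ some l.e)
    (hseen : ∀ a, V.head.1 = some a → seen i a) :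
    ({ V with seeks := seeks' } : View Item p).Local items seen i
      { l with h1 := V.head.1, h := V.head.2, pc := .testFront } := by
  obtain ⟨a, b, hab, hb, hr, -⟩ := G.head
  change V.head = _ at hab
  obtain ⟨hA, hU, -⟩ := L.outline_at hpc
  refine ⟨L.g_allocated, fun x hx => ⟨G.head_listed hx, hseen x hx⟩, fun x hx => ?_,
    onTrack_head G hs, hA, hU, by simp [hab]⟩
  obtain rfl : b = x := by simpa [hab] using hx
  exact ⟨hb, fun h => hr.ne (by simp_all)⟩

theorem Local.toSetNew (L : V.Local items seen i l) (G : V.SharedInv items)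
    (hpc : l.pc = .setOld) {g : Addr} (hg : l.g = some g) :
    ({ V with old := Function.update V.old g (.ptr l.h) } : View Item p).Local items seen i
      { l with pc := .setNew } := by
  obtain ⟨⟨hA, ⟨x, hx, hxe, hx0, hxn, -⟩, hM⟩, hF⟩ := L.outline_at hpc
  obtain rfl : x = g := Option.some_inj.1 (hx.symm.trans hg)
  refine ⟨L.g_allocated, L.h1_seen, L.h_passed, fun hs he => ?_, hA,
    ⟨x, hx, hxe, hx0, hxn, Function.update_self ..⟩, hM, hF⟩
  obtain ⟨y, v, hy, hv, h⟩ := L.onTrack hs he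
  exact ⟨y, v, hy, (G.protected_setOld hx0 v).2 hv, h⟩

theorem SharedInv.target (G : V.SharedInv items) {x y : Addr} (hx : l.h = some x)
    (hx0 : 0 < V.rank x) (hy : V.new x = .ptr (some y)) :
    V.Target { l with g' := some y, pc := .outer } := by
  obtain ⟨e, -, he⟩ := G.item_mem x hx0
  exact ⟨x, y, hx, rfl, by simp [(G.new_ptr x y hx0 hy).1, he], .inl hy⟩

theorem Local.onTrack_next (L : V.Local items seen i l) (G : V.SharedInv items) {x : Addr}
    (hx : l.h = some x) (hn : V.item x ≠ some l.e) :
    V.OnTrack items i { l with h := V.next x, pc := .loop } := by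
  intro hs he
  obtain ⟨x', v, hx', hv, hve, hvh, hr⟩ := L.onTrack hs he
  obtain rfl : x = x' := Option.some_inj.1 (hx.symm.trans hx')
  obtain ⟨hx0, hxh⟩ := L.h_passed x hx
  have hlt : V.rank v < V.rank x := hr.lt_of_ne fun h => hn (G.rank_inj v x hv.1 h ▸ hve)
  rcases G.le_next x v hx0 hv hlt with ⟨y, hy, hy'⟩ | ⟨h, -⟩
  · exact ⟨y, v, hy, hv, hve, hvh, hy'⟩
  · exact absurd h hxh

theorem Local.toLoop (L : V.Local items seen i l) (G : V.SharedInv items) (hpc : l.pc = .next)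
    {x : Addr} (hx : l.h = some x) :
    V.Local items seen i { l with h := V.next x, pc := .loop } := by
  obtain ⟨hS, x', hx', hn⟩ := L.outline_at hpc
  obtain rfl : x = x' := Option.some_inj.1 (hx.symm.trans hx')
  refine ⟨L.g_allocated, L.h1_seen, fun y hy => ?_, L.onTrack_next G hx hn, hS⟩
  obtain ⟨hy0, hr⟩ := G.next_lt x y (L.h_passed x hx).1 hy
  exact ⟨hy0, fun h => hr.not_ge (G.rank_le_head h x)⟩

theorem SharedInv.headPair (G : V.SharedInv items) :
    V.HeadPair { l with k1 := V.head.1, k2 := V.head.2, pc := .getOld } := by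
  obtain ⟨a, b, hab, hb, hr, -, hmax⟩ := G.head
  exact ⟨a, b, by simp [hab], by simp [hab], hb, hr, fun z hz => hmax z (by rintro rfl; omega)⟩

theorem SharedInv.replaces (G : V.SharedInv items) {x : Addr} {w : Ptr} (hx : l.k1 = some x)
    (hx0 : 0 < V.rank x) (hw : V.old x = .ptr w) :
    V.Replaces { l with h' := w, pc := .setNext } := by
  obtain h | ⟨-, w', hw', hocc, -⟩ := G.old x hx0
  · cases hw.symm.trans h
  · exact ⟨x, w', hx, by simpa [hw] using hw', hocc, .inr hw'⟩

theorem Informing.mono {P Q : Fin p → Prop} (h : V.Informing l P)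
    (hPQ : ∀ j, V.seeks j l.e' → P j → Q j) : V.Informing l Q := fun x hx =>
  (h x hx).imp_right fun h' hh ho j hj => hPQ j hj (h' hh ho j hj)

theorem Informing.of_oldDone {P Q : Fin p → Prop} (h : V.Informing l P)
    (hd : V.OldDone l) : V.Informing l Q := fun x hx =>
  (h x hx).imp_right fun _ _ ho => absurd (hd x hx) ho

theorem Replaces.rank_lt {x w : Addr} (h : V.Replaces l) (hx : l.k1 = some x) (hw : l.h' = some w) :
    0 < V.rank w ∧ V.item w = V.item x ∧ V.rank w < V.rank x := by
  obtain ⟨x', w', hx', hw', ⟨h0, hi, hr, -⟩, -⟩ := h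
  obtain rfl : x = x' := Option.some_inj.1 (hx.symm.trans hx')
  obtain rfl : w = w' := Option.some_inj.1 (hw.symm.trans hw')
  exact ⟨h0, hi, hr⟩

theorem SharedInv.gotPrev (G : V.SharedInv items) (hR : V.Replaces l) {w : Addr}
    (hw : l.h' = some w) : V.GotPrev { l with pred := V.prev w, pc := .getNext } := by
  obtain ⟨x, w', -, hw', ⟨h0, hi, hr, -⟩, -⟩ := hR
  obtain rfl : w = w' := Option.some_inj.1 (hw.symm.trans hw')
  obtain ⟨a, b, hab, -, -, hne, hmax⟩ := G.head
  have hwa : a ≠ w := by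
    rintro rfl
    exact hr.not_ge (G.rank_le_head (by rw [hab]) x)
  have hwb : b ≠ w := by
    rintro rfl
    obtain rfl : x = a := by_contra fun h => hr.not_ge (hmax x h)
    exact hne hi.symm
  have hprev : V.prev w ≠ none :=
    G.prev_ne_none w h0 (by simp [hab, hwa]) fun h => absurd h (by simp [hab, hwb])
  obtain ⟨y, hy⟩ := Option.ne_none_iff_exists'.1 hprev
  exact ⟨y, hy, G.prev_listed w y h0 hy⟩

theorem SharedInv.gotNext (G : V.SharedInv items) (hR : V.Replaces l) {w : Addr}
    (hw : l.h' = some w) : V.GotNext { l with succ := V.next w, pc := .remove1 } := by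
  obtain ⟨x, w', -, hw', ⟨h0, -, hr, -⟩, -⟩ := hR
  obtain rfl : w = w' := Option.some_inj.1 (hw.symm.trans hw')
  intro w' hw'
  obtain rfl : w = w' := Option.some_inj.1 (hw.symm.trans hw')
  refine ⟨fun u => G.next_lt w u h0, fun z hz hzw => ?_⟩
  rcases G.le_next w z h0 hz hzw with h | ⟨h, -⟩
  · exact h
  · exact absurd hr (G.rank_le_head h x).not_gt

end own_steps

end View

namespace Config

/-- Process `i` searches for `e`, has read `Head` when `e` was not at the front and has not been
informed since. -/
def Seeks (s : Config Item p) (i : Fin p) (e : Item) : Prop :=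
  ∃ l a, s.proc i = some l ∧ l.e = e ∧ l.h1 = some a ∧ (s.heap a).map Node.item ≠ some e ∧
    (s.ann i).2 = some e

/-- The node `x` has been allocated for a search that is not announced yet. -/
def Unannounced (s : Config Item p) (x : Addr) : Prop :=
  ∃ i l, s.proc i = some l ∧ l.pc = .announce ∧ l.g = some x

/-- The view of a configuration. The ranks `ρ` depend on the history of the execution and are
therefore a parameter. -/
def view (s : Config Item p) (ρ : Addr → ℕ) : View Item p where
  item x := (s.heap x).map Node.item
  next x := (s.heap x).bind Node.next
  prev x := (s.heap x).bind Node.prev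
  old x := (s.heap x).elim (.ptr none) Node.old
  new x := (s.heap x).elim (.ptr none) Node.new
  head := s.head
  ann := s.ann
  seeks := s.Seeks
  unannounced := s.Unannounced
  rank := ρ

variable {s t : Config Item p} {ρ : Addr → ℕ} {x : Addr} {v : Node Item} {i : Fin p}
  {l l' : Loc Item p}

theorem view_item (h : s.heap x = some v) : (s.view ρ).item x = some v.item := by
  simp [view, h]

theorem view_next (h : s.heap x = some v) : (s.view ρ).next x = v.next := by
  simp [view, h]

theorem view_prev (h : s.heap x = some v) : (s.view ρ).prev x = v.prev := by
  simp [view, h]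

theorem view_old (h : s.heap x = some v) : (s.view ρ).old x = v.old := by
  simp [view, h]

theorem view_new (h : s.heap x = some v) : (s.view ρ).new x = v.new := by
  simp [view, h]

theorem view_item_eq_none : (s.view ρ).item x = none ↔ s.heap x = none :=
  Option.map_eq_none_iff

theorem exists_of_view_item (h : (s.view ρ).item x ≠ none) : ∃ v, s.heap x = some v :=
  Option.ne_none_iff_exists'.1 (mt view_item_eq_none.2 h)

theorem item_setNode {v' : Node Item} (h : s.heap x = some v) (hv : v'.item = v.item) (y : Addr) :
    ((s.setNode x v').heap y).map Node.item = (s.heap y).map Node.item := by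
  obtain rfl | hy := eq_or_ne y x
  · simp [setNode, h, hv]
  · simp [setNode, hy]

theorem view_setNode {v' : Node Item} (h : s.heap x = some v) (hv : v'.item = v.item) :
    (s.setNode x v').view ρ = { s.view ρ with
      next := Function.update (s.view ρ).next x v'.next
      prev := Function.update (s.view ρ).prev x v'.prev
      old := Function.update (s.view ρ).old x v'.old
      new := Function.update (s.view ρ).new x v'.new } := by
  refine View.ext (funext (item_setNode h hv)) (funext fun y => ?_) (funext fun y => ?_)
    (funext fun y => ?_) (funext fun y => ?_) rfl rfl ?_ rfl rfl
  case refine_5 =>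
    change (s.setNode x v').Seeks = s.Seeks
    unfold Seeks
    simp only [item_setNode h hv]
    rfl
  all_goals
    obtain rfl | hy := eq_or_ne y x
    · simp [view, setNode]
    · simp [view, setNode, hy]

theorem view_setNext {y : Ptr} (h : s.heap x = some v) :
    (s.setNode x { v with next := y }).view ρ =
      { s.view ρ with next := Function.update (s.view ρ).next x y } := by
  rw [view_setNode (v' := { v with next := y }) h rfl]
  simp only [← view_prev (ρ := ρ) h, ← view_old (ρ := ρ) h, ← view_new (ρ := ρ) h,
    Function.update_eq_self]

theorem view_setPrev {y : Ptr} (h : s.heap x = some v) :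
    (s.setNode x { v with prev := y }).view ρ =
      { s.view ρ with prev := Function.update (s.view ρ).prev x y } := by
  rw [view_setNode (v' := { v with prev := y }) h rfl]
  simp only [← view_next (ρ := ρ) h, ← view_old (ρ := ρ) h, ← view_new (ρ := ρ) h,
    Function.update_eq_self]

theorem view_setOld {y : Link} (h : s.heap x = some v) :
    (s.setNode x { v with old := y }).view ρ =
      { s.view ρ with old := Function.update (s.view ρ).old x y } := by
  rw [view_setNode (v' := { v with old := y }) h rfl]
  simp only [← view_next (ρ := ρ) h, ← view_prev (ρ := ρ) h, ← view_new (ρ := ρ) h,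
    Function.update_eq_self]

theorem view_setNew {y : Link} (h : s.heap x = some v) :
    (s.setNode x { v with new := y }).view ρ =
      { s.view ρ with new := Function.update (s.view ρ).new x y } := by
  rw [view_setNode (v' := { v with new := y }) h rfl]
  simp only [← view_next (ρ := ρ) h, ← view_prev (ρ := ρ) h, ← view_old (ρ := ρ) h,
    Function.update_eq_self]

theorem setLoc_proc_self : (t.setLoc i l').proc i = some l' :=
  Function.update_self ..

theorem setLoc_proc_of_ne {j : Fin p} (hj : j ≠ i) : (t.setLoc i l').proc j = t.proc j :=
  Function.update_of_ne hj ..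

theorem seeks_congr {j : Fin p} (hp : t.proc j = s.proc j) (ha : t.ann j = s.ann j)
    (hi : ∀ l a, s.proc j = some l → l.h1 = some a →
      (t.heap a).map Node.item = (s.heap a).map Node.item) (e : Item) :
    t.Seeks j e ↔ s.Seeks j e := by
  unfold Seeks
  rw [hp, ha]
  refine exists₂_congr fun l a => and_congr_right fun hl => and_congr_right fun _ =>
    and_congr_right fun h1 => ?_
  rw [hi l a hl h1]

theorem seeks_setLoc_of_ne {j : Fin p} (hj : j ≠ i) (e : Item) :
    (t.setLoc i l').Seeks j e ↔ t.Seeks j e :=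
  seeks_congr (setLoc_proc_of_ne hj) rfl (fun _ _ _ _ => rfl) e

theorem not_seeks_of_ann (h : (s.ann i).2 = none) (e : Item) : ¬ s.Seeks i e := by
  rintro ⟨_, _, _, _, _, _, h'⟩
  simp [h] at h'

theorem seeks_of_ann (hl : s.proc i = some l) {a : Addr} (ha : l.h1 = some a)
    (hi : (s.view ρ).item a ≠ some l.e) (h : (s.ann i).2 = some l.e) : s.Seeks i l.e :=
  ⟨l, a, hl, rfl, ha, hi, h⟩

theorem unannounced_of_ne {y : Addr} (ht : ∀ j, j ≠ i → t.proc j = s.proc j)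
    (hi : ∀ m, t.proc i = some m → m.pc ≠ .announce) (h : t.Unannounced y) :
    ∃ j m, j ≠ i ∧ s.proc j = some m ∧ m.pc = .announce ∧ m.g = some y := by
  obtain ⟨j, m, hm, hpc, hg⟩ := h
  have hj : j ≠ i := by
    rintro rfl
    exact hi m hm hpc
  exact ⟨j, m, hj, ht j hj ▸ hm, hpc, hg⟩

theorem unannounced_update_proc {o : Option (Loc Item p)}
    (hl : ∀ l, s.proc i = some l → l.pc ≠ .announce)
    (ho : ∀ l, o = some l → l.pc ≠ .announce) (y : Addr) :
    ({ s with proc := Function.update s.proc i o } : Config Item p).Unannounced y ↔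
      s.Unannounced y := by
  refine exists_congr fun j => ?_
  obtain rfl | hj := eq_or_ne j i
  · simp only [Function.update_self]
    exact ⟨fun ⟨m, hm, hpc, _⟩ => absurd hpc (ho m hm), fun ⟨m, hm, hpc, _⟩ => absurd hpc (hl m hm)⟩
  · simp only [Function.update_of_ne hj]

theorem view_update_proc {o : Option (Loc Item p)}
    (hl : ∀ l, s.proc i = some l → l.pc ≠ .announce)
    (ho : ∀ l, o = some l → l.pc ≠ .announce)
    (hs : ∀ e, ({ s with proc := Function.update s.proc i o } : Config Item p).Seeks i e ↔
      s.Seeks i e) :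
    ({ s with proc := Function.update s.proc i o } : Config Item p).view ρ = s.view ρ := by
  refine View.ext rfl rfl rfl rfl rfl rfl rfl (funext fun j => funext fun e => propext ?_)
    (funext fun y => propext (unannounced_update_proc hl ho y)) rfl
  obtain rfl | hj := eq_or_ne j i
  · exact hs e
  · exact seeks_congr (t := { s with proc := Function.update s.proc i o })
      (Function.update_of_ne hj ..) rfl (fun _ _ _ _ => rfl) e

theorem view_setLoc (hl : t.proc i = some l) (he : l'.e = l.e) (h1 : l'.h1 = l.h1)
    (hpc : l.pc ≠ .announce) (hpc' : l'.pc ≠ .announce) :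
    (t.setLoc i l').view ρ = t.view ρ := by
  refine view_update_proc (by simpa [hl] using hpc) (by simpa using hpc') fun e => ?_
  simp [Seeks, hl, he, h1]

end Config

/-- The invariant of DMTF: `ρ` records when the nodes were prepended, and the addresses in `seen i`
were at the front during the current operation of process `i`. -/
structure Inv (s : Config Item p) (ρ : Addr → ℕ) (items : List Item)
    (seen : Fin p → Addr → Prop) : Prop where
  shared : (s.view ρ).SharedInv items
  loc : ∀ i l, s.proc i = some l → (s.view ρ).Local items seen i l
  idle : ∀ i, s.proc i = none → s.ann i = (none, none)
  own : ∀ i j l l' x, s.proc i = some l → s.proc j = some l' → l.g = some x → l'.g = some x → i = j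

namespace Inv

variable {s t : Config Item p} {ρ ρ' : Addr → ℕ} {items : List Item}
  {seen : Fin p → Addr → Prop} {i : Fin p} {l l' : Loc Item p} {V : View Item p} {x : Addr}
  {q : PC}

theorem g_ne (I : Inv s ρ items seen) (hl : s.proc i = some l) (hx : l.g = some x) {j : Fin p}
    {m : Loc Item p} (hj : j ≠ i) (hm : s.proc j = some m) : m.g ≠ some x := fun h =>
  hj (I.own j i m l x hm hl h hx)

theorem update (I : Inv s ρ items seen) (htp : t.proc = s.proc)
    (hidle : ∀ j, s.proc j = none → t.ann j = s.ann j)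
    (hg : ∀ x, l'.g = some x → (∃ l, s.proc i = some l ∧ l.g = some x) ∨ s.heap x = none)
    (hV : (t.setLoc i l').view ρ' = V) (G : V.SharedInv items)
    (E : (s.view ρ).Evolves V items seen fun j m => j ≠ i ∧ s.proc j = some m)
    (L : V.Local items seen i l') : Inv (t.setLoc i l') ρ' items seen := by
  subst hV
  have proc_self : (t.setLoc i l').proc i = some l' := Config.setLoc_proc_self
  have proc_ne : ∀ {j}, j ≠ i → (t.setLoc i l').proc j = s.proc j := fun hj =>
    (Config.setLoc_proc_of_ne hj).trans (congrFun htp _)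
  have g_ne : ∀ {j m x}, j ≠ i → s.proc j = some m → m.g = some x → l'.g ≠ some x := by
    intro j m x hj hm hmx hx
    rcases hg x hx with ⟨l, hl, hlx⟩ | hx
    · exact I.g_ne hl hlx hj hm hmx
    · exact (I.loc j m hm).g_allocated x hmx (Config.view_item_eq_none.2 hx)
  refine ⟨G, fun j m hm => ?_, fun j hj => ?_, fun j k m m' x hm hm' hx hx' => ?_⟩
  · obtain rfl | hj := eq_or_ne j i
    · obtain rfl : l' = m := by simpa [proc_self] using hm
      exact L
    · rw [proc_ne hj] at hm
      exact (I.loc j m hm).evolves I.shared E ⟨hj, hm⟩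
  · obtain rfl | hji := eq_or_ne j i
    · simp [proc_self] at hj
    · rw [proc_ne hji] at hj
      exact (hidle j hj).trans (I.idle j hj)
  · obtain rfl | hj := eq_or_ne i j <;> obtain rfl | hk := eq_or_ne i k
    · rfl
    · obtain rfl : l' = m := by simpa [proc_self] using hm
      exact absurd hx (g_ne hk.symm (proc_ne hk.symm ▸ hm') hx')
    · obtain rfl : l' = m' := by simpa [proc_self] using hm'
      exact absurd hx' (g_ne hj.symm (proc_ne hj.symm ▸ hm) hx)
    · exact I.own j k m m' x (proc_ne hj.symm ▸ hm) (proc_ne hk.symm ▸ hm') hx hx'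

theorem update_setLoc (I : Inv s ρ items seen) (hl : s.At i l q) (htp : t.proc = s.proc)
    (hidle : ∀ j, s.proc j = none → t.ann j = s.ann j)
    (hfix : l'.e = l.e ∧ l'.g = l.g ∧ l'.h1 = l.h1) (hq : q ≠ .announce) (hq' : l'.pc ≠ .announce)
    (hV : t.view ρ' = V) (G : V.SharedInv items)
    (E : (s.view ρ).Evolves V items seen fun j m => j ≠ i ∧ s.proc j = some m)
    (L : V.Local items seen i l') : Inv (t.setLoc i l') ρ' items seen :=
  I.update htp hidle (fun _ hx => .inl ⟨l, hl.1, hfix.2.1 ▸ hx⟩)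
    ((Config.view_setLoc (htp ▸ hl.1) hfix.1 hfix.2.2 (hl.2 ▸ hq) hq').trans hV) G E L

theorem setLoc (I : Inv s ρ items seen) (hl : s.At i l q)
    (hfix : l'.e = l.e ∧ l'.g = l.g ∧ l'.h1 = l.h1) (hq : q ≠ .announce) (hq' : l'.pc ≠ .announce)
    (L : (s.view ρ).Local items seen i l') : Inv (s.setLoc i l') ρ items seen :=
  I.update_setLoc hl rfl (fun _ _ => rfl) hfix hq hq' rfl I.shared .refl L

theorem mem_setLoc (I : Inv s ρ items seen) (hl : s.At i l q) (htp : t.proc = s.proc)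
    (hidle : ∀ j, s.proc j = none → t.ann j = s.ann j)
    (hfix : l'.e = l.e ∧ l'.g = l.g ∧ l'.h1 = l.h1) (hq : q ≠ .announce) (hq' : l'.pc ≠ .announce)
    (hV : t.view ρ' = V) (G : V.SharedInv items)
    (E : (s.view ρ).Evolves V items seen fun j m => s.proc j = some m)
    (L : V.Local items seen i l → V.Local items seen i l') : Inv (t.setLoc i l') ρ' items seen :=
  I.update_setLoc hl htp hidle hfix hq hq' hV G (E.mono fun _ _ h => h.2)
    (L ((I.loc i l hl.1).evolves I.shared E hl.1))

theorem invoke (I : Inv s ρ items seen) (e : Item) (h : s.proc i = none) :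
    Inv (s.setLoc i { pc := .allocate, e := e }) ρ items seen := by
  have hidle := I.idle i h
  have hV : (s.setLoc i { pc := .allocate, e := e }).view ρ = s.view ρ :=
    Config.view_update_proc (by simp [h]) (by simp) fun e => by simp [Config.Seeks, h]
  refine I.update rfl (fun _ _ => rfl) (by simp) hV I.shared .refl
    ⟨by simp, by simp, by simp, fun hs => ?_, hidle, rfl⟩
  exact absurd hs (Config.not_seeks_of_ann (by rw [hidle]) e)

theorem ret (I : Inv s ρ items seen) (hl : s.At i l .ret) : Inv (s.setIdle i) ρ items seen := by
  have hidle : s.ann i = (none, none) := ((I.loc i l hl.1).outline_at hl.2).1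
  have hns : ∀ {t : Config Item p}, t.ann = s.ann → ∀ e, ¬ t.Seeks i e := fun ht =>
    Config.not_seeks_of_ann (by rw [ht, hidle])
  have hV : (s.setIdle i).view ρ = s.view ρ :=
    Config.view_update_proc (by simp [hl.1, hl.2]) (by simp) fun e => by simp [hns]
  have proc_ne : ∀ {j m}, (s.setIdle i).proc j = some m → s.proc j = some m := by
    intro j m h
    obtain rfl | hj := eq_or_ne j i
    · simp [Config.setIdle] at h
    · simpa [Config.setIdle, hj] using h
  refine ⟨hV ▸ I.shared, fun j m hm => hV ▸ I.loc j m (proc_ne hm), fun j hj => ?_,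
    fun j k m m' x hm hm' => I.own j k m m' x (proc_ne hm) (proc_ne hm')⟩
  obtain rfl | hji := eq_or_ne j i
  · exact hidle
  · exact I.idle j (by simpa [Config.setIdle, hji] using hj)

end Inv

theorem Config.view_allocate {s : Config Item p} {ρ : Addr → ℕ} {x : Addr} {i : Fin p} {e : Item}
    {l : Loc Item p} (hx : s.heap x = none) (ha : (s.ann i).2 = none)
    (hh : ∀ j m a, s.proc j = some m → m.h1 = some a → a ≠ x) :
    ((s.setNode x ⟨e, none, none, .ptr none, .ptr none⟩).setLoc i l).view ρ =
      { s.view ρ with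
        item := Function.update (s.view ρ).item x (some e)
        unannounced := ((s.setNode x ⟨e, none, none, .ptr none, .ptr none⟩).setLoc i l).Unannounced
      } := by
  refine View.ext (funext fun y => ?_) (funext fun y => ?_) (funext fun y => ?_)
    (funext fun y => ?_) (funext fun y => ?_) rfl rfl (funext fun j => funext fun e' => propext ?_)
    rfl rfl
  case refine_6 =>
    change Config.Seeks _ j e' ↔ s.Seeks j e'
    obtain rfl | hj := eq_or_ne j i
    · exact iff_of_false (Config.not_seeks_of_ann (by exact ha) e')
        (Config.not_seeks_of_ann ha e')
    · refine (Config.seeks_setLoc_of_ne hj e').trans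
        (Config.seeks_congr (s := s) (t := s.setNode x _) rfl rfl (fun m a hm h1 => ?_) e')
      simp [Config.setNode, hh j m a hm h1]
  all_goals
    obtain rfl | hy := eq_or_ne y x
    · simp [Config.view, Config.setLoc, Config.setNode, hx]
    · simp [Config.view, Config.setLoc, Config.setNode, hy]

theorem Config.not_seeks_setLoc_of_h1_eq_none {s : Config Item p} {i : Fin p} {l : Loc Item p}
    (h : l.h1 = none) (e : Item) : ¬ (s.setLoc i l).Seeks i e := by
  rintro ⟨m, a, hm, -, ha, -⟩
  rw [Config.setLoc_proc_self] at hm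
  cases hm
  cases h.symm.trans ha

namespace Inv

variable {s : Config Item p} {ρ : Addr → ℕ} {items : List Item} {seen : Fin p → Addr → Prop}
  {i : Fin p} {l : Loc Item p} {x : Addr}

theorem allocate (I : Inv s ρ items seen) (hl : s.At i l .allocate) (hx : s.heap x = none) :
    Inv ((s.setNode x ⟨l.e, none, none, .ptr none, .ptr none⟩).setLoc i
      { l with g := some x, pc := .announce }) ρ items seen := by
  have L := I.loc i l hl.1
  obtain ⟨hann, h1⟩ := L.outline_at hl.2
  change s.ann i = _ at hann
  have hxi : (s.view ρ).item x = none := Config.view_item_eq_none.2 hx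
  have hx0 : ρ x = 0 := by
    by_contra h
    exact I.shared.ne_of_item_eq_none hxi (Nat.pos_of_ne_zero h) rfl
  have hu : ∀ y, ((s.setNode x ⟨l.e, none, none, .ptr none, .ptr none⟩).setLoc i
      { l with g := some x, pc := .announce }).Unannounced y → s.Unannounced y ∨ y = x := by
    rintro y ⟨j, m, hm, hpc, hg⟩
    obtain rfl | hj := eq_or_ne j i
    · rw [Config.setLoc_proc_self] at hm
      cases hm
      exact .inr (Option.some.inj hg).symm
    · exact .inl ⟨j, m, (Config.setLoc_proc_of_ne hj).symm.trans hm, hpc, hg⟩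
  have hV := Config.view_allocate (ρ := ρ) (e := l.e)
    (l := { l with g := some x, pc := .announce }) hx (by rw [hann]) fun j m a hm ha hax =>
      ((I.loc j m hm).h1_seen a ha).1.ne' (hax ▸ hx0)
  refine I.update rfl (fun _ _ => rfl) (fun y hy => .inr (Option.some.inj hy ▸ hx)) hV
    (I.shared.allocate hxi hu) (I.shared.evolves_allocate hxi hu)
    ⟨?_, L.h1_seen, L.h_passed, fun hs => ?_, hann, ⟨x, rfl, ?_, hx0, fun y hy hn => ?_, ?_⟩, h1⟩
  · intro y hy
    cases hy
    simp
  · exact absurd hs (Config.not_seeks_of_ann (by rw [hann]) _)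
  · simp
  · obtain ⟨e, -, he⟩ := I.shared.item_mem y hy
    cases hxi.symm.trans ((I.shared.new_ptr y x hy hn).1.trans he)
  · simp [Config.view, hx]

theorem announce (I : Inv s ρ items seen) (hl : s.At i l .announce) :
    Inv (({ s with ann := Function.update s.ann i (l.g, some l.e) } : Config Item p).setLoc i
      { l with pc := .getHead }) ρ items seen := by
  have L := I.loc i l hl.1
  obtain ⟨hann, hU, h1⟩ := L.outline_at hl.2
  change s.ann i = _ at hann
  obtain ⟨g, hg, -⟩ := id hU
  set t : Config Item p := { s with ann := Function.update s.ann i (l.g, some l.e) }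
  have ann_ne : ∀ {j}, j ≠ i → t.ann j = s.ann j := fun hj => Function.update_of_ne hj ..
  have ann_self : t.ann i = (l.g, some l.e) := Function.update_self ..
  have hns : ∀ e, ¬ (t.setLoc i { l with pc := .getHead }).Seeks i e :=
    Config.not_seeks_setLoc_of_h1_eq_none (by exact h1)
  have hs : ∀ j e, (t.setLoc i { l with pc := .getHead }).Seeks j e →
      s.Seeks j e ∧ t.ann j = s.ann j := by
    intro j e h
    have hj : j ≠ i := fun hj => hns e (hj ▸ h)
    exact ⟨(Config.seeks_congr (s := s) (t := t) rfl (ann_ne hj) (fun _ _ _ _ => rfl) e).1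
      ((Config.seeks_setLoc_of_ne hj e).1 h), ann_ne hj⟩
  have hu : ∀ y, (t.setLoc i { l with pc := .getHead }).Unannounced y →
      s.Unannounced y ∧ y ≠ g := by
    intro y hy
    obtain ⟨j, m, hj, hm, hpc, hmy⟩ := Config.unannounced_of_ne (s := s)
      (fun j hj => Config.setLoc_proc_of_ne hj) (by simp [Config.setLoc_proc_self]) hy
    exact ⟨⟨j, m, hm, hpc, hmy⟩, fun h => I.g_ne hl.1 hg hj hm (h ▸ hmy)⟩
  refine I.update rfl (fun j hj => ann_ne fun h => ?_) (fun y hy => .inl ⟨l, hl.1, hy⟩) rfl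
    (I.shared.setAnn (fun j e h => (hs j e h).1) fun j y hy => ?_)
    (View.evolves_setAnn hs (fun y hy => (hu y hy).1) (fun j m hj => .inl (ann_ne hj.1))
      fun j y e h => ?_)
    ⟨L.g_allocated, L.h1_seen, L.h_passed, fun h => absurd h (hns _), .inl ann_self, hU, h1⟩
  · cases hl.1.symm.trans (h ▸ hj)
  · obtain rfl | hj := eq_or_ne j i
    · rw [Config.setLoc, ann_self] at hy
      exact ⟨L.g_allocated y hy, fun h => (hu y h).2 (Option.some.inj (hy.symm.trans hg))⟩
    · exact (I.shared.ann j y (congrArg Prod.fst (ann_ne hj) ▸ hy)).imp_right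
        (mt fun h => (hu y h).1)
  · obtain rfl | hj := eq_or_ne j i
    · cases ann_self.symm.trans h
      exact .inr ⟨g, hg, j, l, hl.1, hl.2, hg⟩
    · exact .inl ((ann_ne hj).symm.trans h)

theorem getHead (I : Inv s ρ items seen) (hl : s.At i l .getHead)
    (hseen : ∀ a, s.head.1 = some a → seen i a) :
    Inv (s.setLoc i { l with h1 := s.head.1, h := s.head.2, pc := .testFront }) ρ items seen := by
  set l' : Loc Item p := { l with h1 := s.head.1, h := s.head.2, pc := .testFront }
  have L := I.loc i l hl.1
  have hi : ∀ e, (s.setLoc i l').Seeks i e →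
      ∃ a, s.head.1 = some a ∧ (s.view ρ).item a ≠ some e := by
    rintro e ⟨m, a, hm, -, ha, he, -⟩
    rw [Config.setLoc_proc_self] at hm
    cases hm
    exact ⟨a, ha, he⟩
  have hs : ∀ j e, (s.setLoc i l').Seeks j e →
      s.Seeks j e ∨ ∃ a, s.head.1 = some a ∧ (s.view ρ).item a ≠ some e := by
    intro j e h
    obtain rfl | hj := eq_or_ne j i
    · exact .inr (hi e h)
    · exact .inl ((Config.seeks_setLoc_of_ne hj e).1 h)
  have hV : (s.setLoc i l').view ρ =
      (fun V : View Item p => { V with seeks := (s.setLoc i l').Seeks }) (s.view ρ) :=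
    View.ext rfl rfl rfl rfl rfl rfl rfl rfl
      (funext fun y => propext (Config.unannounced_update_proc (by simp [hl.1, hl.2])
        (by simp [l']) y)) rfl
  refine I.update rfl (fun _ _ => rfl) (fun y hy => .inl ⟨l, hl.1, hy⟩) hV (I.shared.seek hs)
    (I.shared.evolves_seek hs fun j m e h => (Config.seeks_setLoc_of_ne h.1 e).1) ?_
  refine L.toTestFront hl.2 (I.shared.seek hs) (fun a ha h => ?_) hseen
  obtain ⟨a', ha', hne⟩ := hi _ h
  cases ha.symm.trans ha'
  exact hne

end Inv

namespace Inv

variable {s : Config Item p} {ρ : Addr → ℕ} {items : List Item} {seen : Fin p → Addr → Prop}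
  {i : Fin p} {l l' : Loc Item p} {x : Addr} {v : Node Item} {q : PC}

section answer

variable {y : Ptr}

theorem seeks_of_answer {k : Fin p} {e : Item}
    (h : ({ s with ann := Function.update s.ann i (y, none) } : Config Item p).Seeks k e) :
    s.Seeks k e ∧ Function.update s.ann i (y, none) k = s.ann k := by
  obtain rfl | hk := eq_or_ne k i
  · exact absurd h (Config.not_seeks_of_ann (by simp) e)
  · have hk' := Function.update_of_ne hk (y, none) s.ann
    exact ⟨(Config.seeks_congr (s := s) (t := { s with ann := Function.update s.ann i (y, none) })
      rfl hk' (fun _ _ _ _ => rfl) e).1 h, hk'⟩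

theorem sharedInv_answer (G : (s.view ρ).SharedInv items)
    (hy : ∀ x, y = some x → (s.view ρ).item x ≠ none ∧ ¬ s.Unannounced x) :
    (({ s with ann := Function.update s.ann i (y, none) } : Config Item p).view ρ).SharedInv
      items := by
  refine G.setAnn (fun k e h => (seeks_of_answer h).1) fun k x hx => ?_
  obtain rfl | hk := eq_or_ne k i
  · exact hy x (by simpa using hx)
  · exact G.ann k x ((congrArg Prod.fst (Function.update_of_ne hk ..)).symm.trans hx)

theorem evolves_answer {rely : Fin p → Loc Item p → Prop}
    (hi : ∀ m, rely i m → s.ann i = (m.g, some m.e) ∧ m.e ∈ items ∧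
      ∃ x, y = some x ∧ seen i x ∧ (s.view ρ).item x = some m.e ∧ 0 < ρ x) :
    (s.view ρ).Evolves
      (({ s with ann := Function.update s.ann i (y, none) } : Config Item p).view ρ)
      items seen rely := by
  refine View.evolves_setAnn (fun k e h => seeks_of_answer h) (fun _ h => h) (fun k m hm => ?_)
    fun k x e h => ?_
  · obtain rfl | hk := eq_or_ne k i
    · obtain ⟨ha, he, x, rfl, h⟩ := hi m hm
      exact .inr ⟨ha, he, x, Function.update_self .., h⟩
    · exact .inl (Function.update_of_ne hk ..)
  · obtain rfl | hk := eq_or_ne k i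
    · simp at h
    · exact .inl ((Function.update_of_ne hk ..).symm.trans h)

end answer

theorem withdraw (I : Inv s ρ items seen) (hl : s.At i l q) (hq : q ≠ .announce)
    (hfix : l'.e = l.e ∧ l'.g = l.g ∧ l'.h1 = l.h1) (hh : l'.h = l.h) (hpc : l'.pc = .ret)
    (hres : (s.view ρ).CorrectResult items seen i l') :
    Inv (({ s with ann := Function.update s.ann i (none, none) } : Config Item p).setLoc i l')
      ρ items seen := by
  have L := I.loc i l hl.1
  obtain ⟨he, hg, h1⟩ := hfix
  refine I.update_setLoc hl rfl (fun j hj => Function.update_of_ne ?_ ..) ⟨he, hg, h1⟩ hq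
    (by simp [hpc]) rfl (sharedInv_answer I.shared (by simp))
    (evolves_answer fun m hm => absurd rfl hm.1)
    ⟨hg ▸ L.g_allocated, h1 ▸ L.h1_seen, hh ▸ L.h_passed, fun hs => ?_, ?_⟩
  · rintro rfl
    cases hl.1.symm.trans hj
  · exact absurd hs (Config.not_seeks_of_ann (by simp) _)
  · rw [hpc]
    exact ⟨Function.update_self .., hres⟩

theorem setOld (I : Inv s ρ items seen) (hl : s.At i l .setOld) (hx : s.Pts l.g x v) :
    Inv ((s.casOld x v (.ptr none) (.ptr l.h)).setLoc i { l with pc := .setNew }) ρ items seen := by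
  have L := I.loc i l hl.1
  obtain ⟨⟨-, ⟨x', hx', -, hx0, hxn, hxo⟩, -⟩, -⟩ := L.outline_at hl.2
  obtain rfl : x = x' := Option.some_inj.1 (hx.1.symm.trans hx')
  rw [Config.view_old hx.2] at hxo
  rw [Config.casOld, if_pos hxo]
  exact I.update_setLoc hl rfl (fun _ _ => rfl) ⟨rfl, rfl, rfl⟩ (by simp) (by simp)
    (Config.view_setOld hx.2) (I.shared.setOld hx0 hxn)
    (I.shared.evolves_setOld hx0 fun j m hm => I.g_ne hl.1 hx.1 hm.1 hm.2)
    (L.toSetNew I.shared hl.2 hx.1)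

theorem setNew (I : Inv s ρ items seen) (hl : s.At i l .setNew) (hx : s.Pts l.h x v) :
    Inv ((s.casNew x v (.ptr none) (.ptr l.g)).setLoc i { l with pc := .getNew }) ρ items seen := by
  have L := I.loc i l hl.1
  obtain ⟨hA, ⟨g, hg, hge, hg0, -, hgo⟩, hM, x', hx', hxe⟩ := L.outline_at hl.2
  obtain rfl : x = x' := Option.some_inj.1 (hx.1.symm.trans hx')
  obtain ⟨hx0, hxh⟩ := L.h_passed x hx.1
  by_cases h : v.new = .ptr none
  · have hn : (s.view ρ).new x = .ptr none := (Config.view_new hx.2).trans h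
    rw [Config.casNew, if_pos h]
    refine I.update_setLoc hl rfl (fun _ _ => rfl) ⟨rfl, rfl, rfl⟩ (by simp) (by simp)
      ((Config.view_setNew hx.2).trans (by rw [hg]))
      (I.shared.setNew hx0 hn hxh hg0 (hge.trans hxe.symm) (hx.1 ▸ hgo))
      (View.evolves_setNew hn fun j m hm => I.g_ne hl.1 hg hm.1 hm.2)
      ⟨L.g_allocated, L.h1_seen, L.h_passed, L.onTrack, hA, hM, ⟨x, hx.1, hxe⟩, fun y hy => ?_⟩
    cases hx.1.symm.trans hy
    simp
  · rw [Config.casNew, if_neg h]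
    refine I.setLoc hl ⟨rfl, rfl, rfl⟩ (by simp) (by simp)
      { L with outline := ⟨hA, hM, ⟨x, hx.1, hxe⟩, fun y hy => ?_⟩ }
    cases hx.1.symm.trans hy
    rwa [Config.view_new hx.2]

theorem prepend (I : Inv s ρ items seen) (hl : s.At i l .prepend) :
    ∃ ρ', Inv ((s.casHead (l.k1, l.k2) (l.g', l.k1)).setLoc i { l with pc := .outer }) ρ' items seen
      ∧ ∀ x, 0 < ρ x → ρ' x = ρ x := by
  have L := I.loc i l hl.1
  obtain ⟨hM, ⟨a, b, ha, hb, -⟩, hO, hN⟩ := L.outline_at hl.2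
  by_cases h : s.head = (l.k1, l.k2)
  · obtain ⟨-, -, -, x, g, hx, hg, -, hxg⟩ := hM
    have hg0 : ρ g = 0 := hN (congrArg Prod.fst h) g hg
    have hn : (s.view ρ).new x = .ptr (some g) := hxg.resolve_right fun h => h.2.ne' hg0
    have C : (s.view ρ).CanPrepend a b x g :=
      ⟨h.trans (by rw [ha, hb]), hO a ha, (L.h_passed x hx).1, hg0, hn⟩
    rw [Config.casHead, if_pos h]
    refine ⟨Function.update ρ g (ρ a + 1), I.mem_setLoc hl rfl (fun _ _ => rfl) ⟨rfl, rfl, rfl⟩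
      (by simp) (by simp) (V := (s.view ρ).prepend a g) (by rw [hg, ha]; rfl)
      (C.sharedInv_prepend I.shared) (C.evolves_prepend I.shared)
      fun L' => { L' with outline := (L'.outline_at hl.2).1 }, fun y hy => ?_⟩
    exact Function.update_of_ne (C.ne hy) ..
  · rw [Config.casHead, if_neg h]
    exact ⟨ρ, I.setLoc hl ⟨rfl, rfl, rfl⟩ (by simp) (by simp) { L with outline := hM },
      fun _ _ => rfl⟩

theorem setNext (I : Inv s ρ items seen) (hl : s.At i l .setNext) (hx : s.Pts l.k1 x v) :
    Inv ((s.casNext x v none l.k2).setLoc i { l with pc := .setPrev }) ρ items seen := by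
  have L := I.loc i l hl.1
  have hH := L.outline_at hl.2
  obtain ⟨-, ⟨x', y, hx', hy, hy0, hyx, hmax⟩, -⟩ := id hH
  obtain rfl : x = x' := Option.some_inj.1 (hx.1.symm.trans hx')
  by_cases h : v.next = none
  · have hs : ∀ w, (s.view ρ).Protected w → ρ w < ρ x → ∃ u, l.k2 = some u ∧ ρ w ≤ ρ u :=
      fun w _ hr => ⟨y, hy, hmax w hr⟩
    have hv := Config.view_setNext (y := l.k2) (ρ := ρ) hx.2
    rw [Config.casNext, if_pos h]
    refine I.mem_setLoc hl rfl (fun _ _ => rfl) ⟨rfl, rfl, rfl⟩ (by simp) (by simp) hv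
      (I.shared.setNext (hy0.trans hyx) (fun u hu => ?_) hs) (I.shared.evolves_setNext hs)
      fun L' => { L' with outline := ⟨L'.outline_at hl.2, fun z hz _ => ?_⟩ }
    · cases hy.symm.trans hu
      exact ⟨hy0, hyx⟩
    · cases hx.1.symm.trans hz
      simp [hy]
  · rw [Config.casNext, if_neg h]
    refine I.setLoc hl ⟨rfl, rfl, rfl⟩ (by simp) (by simp)
      { L with outline := ⟨hH, fun z hz _ => ?_⟩ }
    cases hx.1.symm.trans hz
    rwa [Config.view_next hx.2]

theorem setPrev (I : Inv s ρ items seen) (hl : s.At i l .setPrev) (hx : s.Pts l.k2 x v) :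
    Inv ((s.casPrev x v none l.k1).setLoc i { l with pc := .getItem }) ρ items seen := by
  have L := I.loc i l hl.1
  obtain ⟨hH, hN⟩ := L.outline_at hl.2
  obtain ⟨-, ⟨y, x', hy, hx', hx0, hxy, -⟩, -⟩ := id hH
  obtain rfl : x = x' := Option.some_inj.1 (hx.1.symm.trans hx')
  by_cases h : v.prev = none
  · rw [Config.casPrev, if_pos h]
    refine I.mem_setLoc hl rfl (fun _ _ => rfl) ⟨rfl, rfl, rfl⟩ (by simp) (by simp)
      ((Config.view_setPrev hx.2).trans (by rw [hy]))
      (I.shared.setPrev hx0 (hx0.trans hxy)) View.evolves_setPrev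
      fun L' => { L' with outline := ⟨(L'.outline_at hl.2).1, (L'.outline_at hl.2).2, ?_⟩ }
    intro z hz
    cases hx.1.symm.trans hz
    simp
  · rw [Config.casPrev, if_neg h]
    refine I.setLoc hl ⟨rfl, rfl, rfl⟩ (by simp) (by simp) { L with outline := ⟨hH, hN, ?_⟩ }
    intro z hz
    cases hx.1.symm.trans hz
    rwa [Config.view_prev hx.2]

end Inv

namespace View

variable {V : View Item p} {items : List Item} {seen : Fin p → Addr → Prop} {i : Fin p}
  {l : Loc Item p} {x w z b : Addr}

theorem Local.ann_eq (L : V.Local items seen i l) (h : (V.ann i).2 ≠ none) :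
    V.ann i = (l.g, some l.e) := by
  have hA : V.Announced seen i l ∨ (V.ann i).2 = none := by
    have hO := L.outline
    cases hpc : l.pc <;> rw [hpc] at hO <;>
      simp only [Outline, Searching, Moving, Helping, Linked, Removing, Withdrawing,
        Announced] at hO ⊢ <;> grind
  exact (hA.resolve_right h).resolve_right fun h' => h h'.ann_snd

theorem Removing.not_seeks (hR : V.Removing seen i l) (hx : l.k1 = some x)
    (hh : V.head.1 = some x) (ho : V.old x ≠ .DONE) (j : Fin p) (e : Item)
    (he : V.item x = some e) : ¬ V.seeks j e := by
  obtain ⟨hxe, hI⟩ := hR.2 x hx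
  cases hxe.symm.trans he
  exact hI hh ho j

theorem SharedInv.not_protected_of_removing (G : V.SharedInv items) (hR : V.Removing seen i l)
    (hw : l.h' = some w) : ¬ V.Protected w := by
  obtain ⟨x, w', hx, hw', hocc, -⟩ := hR.1.1.2.2
  obtain rfl : w = w' := Option.some_inj.1 (hw.symm.trans hw')
  exact G.not_protected_of_prevOcc hocc (hR.not_seeks hx)

theorem SharedInv.rank_lt_next (G : V.SharedInv items) (hx : 0 < V.rank x)
    (hn : V.next x = some w) (hw : ¬ V.Protected w) (hz : V.Protected z)
    (hzx : V.rank z < V.rank x) : V.rank z < V.rank w := by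
  obtain ⟨u, hu, hzu⟩ | ⟨-, -, hu⟩ := G.le_next x z hx hz hzx
  · obtain rfl : w = u := Option.some_inj.1 (hn.symm.trans hu)
    exact hzu.lt_of_ne fun h => hw (G.rank_inj z w hz.1 h ▸ hz)
  · cases hn.symm.trans hu

theorem SharedInv.head_snd_eq (G : V.SharedInv items) (hp : V.HeadPair l)
    (hx : V.head.1 = l.k1) : V.head.2 = l.k2 := by
  obtain ⟨x, y, hk1, hk2, hy, hyx, hmax⟩ := hp
  obtain ⟨a, b, hab, _, hba, -, hmax'⟩ := G.head
  obtain rfl : a = x := Option.some_inj.1 (by rw [← hk1, ← hx, hab])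
  have hya : y ≠ a := by
    rintro rfl
    exact hyx.ne rfl
  rw [hab, hk2, G.rank_inj y b hy (le_antisymm (hmax' y hya) (hmax b hba))]

end View

namespace Inv

variable {s : Config Item p} {ρ : Addr → ℕ} {items : List Item} {seen : Fin p → Addr → Prop}
  {i : Fin p} {l : Loc Item p} {x : Addr} {v : Node Item}

theorem exists_of_ann (I : Inv s ρ items seen) {j : Fin p} {y : Ptr} {e : Item}
    (h : s.ann j = (y, some e)) :
    ∃ m, s.proc j = some m ∧ m.e = e ∧ s.ann j = (m.g, some m.e) := by
  cases hm : s.proc j with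
  | none => simp [I.idle j hm] at h
  | some m =>
    have ha : s.ann j = (m.g, some m.e) := (I.loc j m hm).ann_eq (by simp [Config.view, h])
    exact ⟨m, rfl, Option.some_inj.1 (congrArg Prod.snd (ha.symm.trans h)), ha⟩

theorem not_unannounced (I : Inv s ρ items seen) (hx : 0 < ρ x) : ¬ s.Unannounced x := by
  rintro ⟨j, m, hm, hpc, hg⟩
  obtain ⟨-, ⟨x', hx', -, hx0, -⟩, -⟩ := (I.loc j m hm).outline_at hpc
  obtain rfl : x = x' := Option.some_inj.1 (hg.symm.trans hx')
  exact hx.ne' hx0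

theorem inform [DecidableEq Item] {j : Fin p} (I : Inv s ρ items seen) (hl : s.At i l .inform)
    (hj : l.j = some j) :
    Inv ((s.casAnn j (l.a, l.b) (l.k1, none)).setLoc i { l with pc := .readAnn }) ρ items seen := by
  have L := I.loc i l hl.1
  obtain ⟨hL, hI, ⟨j', hj', hb, -⟩, hS⟩ := L.outline_at hl.2
  obtain rfl : j = j' := Option.some_inj.1 (hj.symm.trans hj')
  by_cases h : s.ann j = (l.a, l.b)
  · obtain ⟨⟨-, -, x, w, hx, -, ⟨-, -, hwx, -⟩, -⟩, -⟩ := id hL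
    have hx0 : 0 < ρ x := (Nat.zero_le _).trans_lt hwx
    have hxe : (s.view ρ).item x = some l.e' := (hI x hx).1
    have hxs : seen j x := hS j x hj h hx
    obtain ⟨m, hm, hme, hma⟩ := I.exists_of_ann (h.trans (by rw [hb]))
    obtain ⟨e, he, hxe'⟩ := I.shared.item_mem x hx0
    obtain rfl : e = l.e' := Option.some_inj.1 (hxe'.symm.trans hxe)
    rw [Config.casAnn, if_pos h]
    refine I.mem_setLoc hl rfl (fun k hk => Function.update_of_ne ?_ ..) ⟨rfl, rfl, rfl⟩ (by simp)
      (by simp) rfl (sharedInv_answer I.shared fun y hy => ?_) (evolves_answer fun m' hm' => ?_)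
      fun L' => { L' with
        outline := ⟨(L'.outline_at hl.2).1, (L'.outline_at hl.2).2.1.mono ?_⟩ }
    · rintro rfl
      cases hm.symm.trans hk
    · cases hx.symm.trans hy
      exact ⟨by simp [hxe], I.not_unannounced hx0⟩
    · cases hm.symm.trans hm'
      exact ⟨hma, hme ▸ he, x, hx, hxs, hme ▸ hxe, hx0⟩
    · rintro k - (hk | ⟨hk, ha⟩)
      · exact hk
      · cases hj.symm.trans hk
        simp [Config.view, hb] at ha
  · rw [Config.casAnn, if_neg h]
    refine I.setLoc hl ⟨rfl, rfl, rfl⟩ (by simp) (by simp)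
      { L with outline := ⟨hL, hI.mono ?_⟩ }
    rintro k - (hk | ⟨hk, ha⟩)
    · exact hk
    · cases hj.symm.trans hk
      exact absurd ha h

theorem remove1 (I : Inv s ρ items seen) (hl : s.At i l .remove1) (hx : s.Pts l.pred x v) :
    Inv ((s.casNext x v l.h' l.succ).setLoc i { l with pc := .remove2 }) ρ items seen := by
  have L := I.loc i l hl.1
  obtain ⟨hR, hP, hN⟩ := L.outline_at hl.2
  by_cases h : v.next = l.h'
  · obtain ⟨-, w, -, hw, -⟩ := hR.1.1.2.2
    obtain ⟨x', hx', hx0⟩ := id hP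
    obtain rfl : x = x' := Option.some_inj.1 (hx.1.symm.trans hx')
    obtain ⟨hsucc, hle⟩ := hN w hw
    have hnw := I.shared.not_protected_of_removing hR hw
    have hn : (s.view ρ).next x = some w := (Config.view_next hx.2).trans (h.trans hw)
    have hwx := (I.shared.next_lt x w hx0 hn).2
    have hs : ∀ z, (s.view ρ).Protected z → ρ z < ρ x → ∃ u, l.succ = some u ∧ ρ z ≤ ρ u :=
      fun z hz hzx => hle z hz (I.shared.rank_lt_next hx0 hn hnw hz hzx)
    rw [Config.casNext, if_pos h]
    exact I.mem_setLoc hl rfl (fun _ _ => rfl) ⟨rfl, rfl, rfl⟩ (by simp) (by simp)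
      (Config.view_setNext hx.2)
      (I.shared.setNext hx0 (fun u hu => ⟨(hsucc u hu).1, (hsucc u hu).2.trans hwx⟩) hs)
      (I.shared.evolves_setNext hs)
      fun L' => { L' with outline := L'.outline_at hl.2 }
  · rw [Config.casNext, if_neg h]
    exact I.setLoc hl ⟨rfl, rfl, rfl⟩ (by simp) (by simp) { L with outline := ⟨hR, hP, hN⟩ }

theorem remove2 (I : Inv s ρ items seen) (hl : s.At i l .remove2) (hx : s.Pts l.succ x v) :
    Inv ((s.casPrev x v l.h' l.pred).setLoc i { l with pc := .gone }) ρ items seen := by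
  have L := I.loc i l hl.1
  obtain ⟨hR, ⟨y, hy, hy0⟩, hN⟩ := L.outline_at hl.2
  obtain ⟨-, w, -, hw, -⟩ := hR.1.1.2.2
  have hx0 := ((hN w hw).1 x hx.1).1
  by_cases h : v.prev = l.h'
  · rw [Config.casPrev, if_pos h]
    exact I.mem_setLoc hl rfl (fun _ _ => rfl) ⟨rfl, rfl, rfl⟩ (by simp) (by simp)
      ((Config.view_setPrev hx.2).trans (by rw [hy])) (I.shared.setPrev hx0 hy0)
      View.evolves_setPrev fun L' => { L' with outline := (L'.outline_at hl.2).1 }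
  · rw [Config.casPrev, if_neg h]
    exact I.setLoc hl ⟨rfl, rfl, rfl⟩ (by simp) (by simp) { L with outline := hR }

theorem gone (I : Inv s ρ items seen) (hl : s.At i l .gone) (hx : s.Pts l.h' x v) :
    Inv ((s.casNew x v (.ptr l.k1) .GONE).setLoc i { l with pc := .done }) ρ items seen := by
  have L := I.loc i l hl.1
  have hR := L.outline_at hl.2
  by_cases h : v.new = .ptr l.k1
  · obtain ⟨k, w, hk, hw, hocc, -⟩ := hR.1.1.2.2
    obtain rfl : x = w := Option.some_inj.1 (hx.1.symm.trans hw)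
    have hnx := I.shared.not_protected_of_removing hR hx.1
    rw [Config.casNew, if_pos h]
    exact I.mem_setLoc hl rfl (fun _ _ => rfl) ⟨rfl, rfl, rfl⟩ (by simp) (by simp)
      (Config.view_setNew hx.2) (I.shared.setGone hocc.1 hnx)
      (View.evolves_setGone (hocc.1.trans hocc.2.2.1) (by rw [Config.view_new hx.2, h, hk]))
      fun L' => { L' with outline := L'.outline_at hl.2 }
  · rw [Config.casNew, if_neg h]
    exact I.setLoc hl ⟨rfl, rfl, rfl⟩ (by simp) (by simp) { L with outline := hR }

theorem done (I : Inv s ρ items seen) (hl : s.At i l .done) (hx : s.Pts l.k1 x v) :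
    Inv ((s.casOld x v (.ptr l.h') .DONE).setLoc i { l with pc := .outer }) ρ items seen := by
  have L := I.loc i l hl.1
  have hR := L.outline_at hl.2
  obtain ⟨⟨⟨hM, hp, -⟩, hN, hP⟩, -⟩ := id hR
  by_cases h : v.old = .ptr l.h'
  · have hxo : (s.view ρ).old x ≠ .DONE := by rw [Config.view_old hx.2, h]; simp
    have hh : (s.view ρ).head.1 = some x :=
      ((I.shared.old x (hp.rank_pos hx.1)).resolve_left hxo).1
    have hsnd : (s.view ρ).head.2 = l.k2 := I.shared.head_snd_eq hp (hh.trans hx.1.symm)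
    rw [Config.casOld, if_pos h]
    exact I.mem_setLoc hl rfl (fun _ _ => rfl) ⟨rfl, rfl, rfl⟩ (by simp) (by simp)
      (Config.view_setOld hx.2)
      (I.shared.setDone hh (hN x hx.1 hh) fun b hb => hP b (hsnd.symm.trans hb))
      (I.shared.evolves_setDone hh (hR.not_seeks hx.1 hh))
      fun L' => { L' with outline := (L'.outline_at hl.2).1.1.1 }
  · rw [Config.casOld, if_neg h]
    exact I.setLoc hl ⟨rfl, rfl, rfl⟩ (by simp) (by simp) { L with outline := hM }

end Inv

namespace View

variable {V : View Item p} {items : List Item} {seen : Fin p → Addr → Prop} {i : Fin p}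
  {l : Loc Item p} {x y : Addr}

theorem AtFront.correctResult (L : V.Local items seen i l) (G : V.SharedInv items)
    (h : V.AtFront l) {l' : Loc Item p} (he : l'.e = l.e) (hres : l'.res = .pointer l.h1) :
    V.CorrectResult items seen i l' := by
  obtain ⟨a, h1, hae⟩ := h
  obtain ⟨ha0, ha⟩ := L.h1_seen a h1
  rw [CorrectResult, he]
  refine ⟨fun _ => ⟨a, by rw [hres, h1], ha, hae⟩, fun hn => ?_⟩
  obtain ⟨e, he', hae'⟩ := G.item_mem a ha0
  cases hae.symm.trans hae'
  exact absurd he' hn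

theorem Informed.correctResult (G : V.SharedInv items) (hI : V.Informed seen i l)
    (hW : V.Withdrawing i l) {l' : Loc Item p} (he : l'.e = l.e) (hres : l'.res = .pointer l.a) :
    V.CorrectResult items seen i l' := by
  obtain ⟨x, hann, hx, hxe, hx0⟩ := hI
  have ha : l.a = some x := (congrArg Prod.fst (hW.1.symm.trans hann) :)
  rw [CorrectResult, he]
  refine ⟨fun _ => ⟨x, by rw [hres, ha], hx, hxe⟩, fun hn => ?_⟩
  obtain ⟨e, he', hxe'⟩ := G.item_mem x hx0
  cases hxe.symm.trans hxe'
  exact absurd he' hn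

theorem SharedInv.not_protected_of_target_done (G : V.SharedInv items) (hT : V.Target l)
    (hx : l.h = some x) (hx0 : 0 < V.rank x) (hy : l.g' = some y) (hd : V.old y = .DONE) :
    ¬ V.Protected x := by
  obtain ⟨x', y', hx', hy', -, hnew⟩ := hT
  obtain rfl : x = x' := Option.some_inj.1 (hx.symm.trans hx')
  obtain rfl : y = y' := Option.some_inj.1 (hy.symm.trans hy')
  obtain hnew | ⟨hgone, -⟩ := hnew
  · obtain ⟨hi, -, hlt, hold⟩ := G.new_ptr x y hx0 hnew
    have hy0 : 0 < V.rank y := by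
      by_contra h
      cases hd.symm.trans (hold (by omega))
    rintro ⟨-, hlatest | ⟨a, e, j, ha, haw, -⟩⟩
    · exact (hlt hy0).not_ge (hlatest y hi)
    · obtain h | ⟨-, w, hw, -, h | h⟩ := G.old a (G.head_listed ha)
      · cases haw.symm.trans h
      · cases haw.symm.trans hw
        cases hnew.symm.trans h
        cases hd.symm.trans haw
      · cases haw.symm.trans hw
        cases hnew.symm.trans h
  · exact G.not_protected_of_gone x hgone

end View

theorem View.Announced.informed_of_not_seeks {s : Config Item p} {ρ : Addr → ℕ}
    {seen : Fin p → Addr → Prop} {i : Fin p} {l : Loc Item p}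
    (hA : (s.view ρ).Announced seen i l) (hM : (s.view ρ).Missed l) (hl : s.proc i = some l)
    (h : ¬ s.Seeks i l.e) : (s.view ρ).Informed seen i l := by
  obtain ⟨a, ha, hne⟩ := hM
  exact hA.informed fun hb => h (Config.seeks_of_ann hl ha hne hb)

namespace Inv

variable {φ : ℕ} {s : Config Item p} {ρ : Addr → ℕ} {items : List Item}
  {seen : Fin p → Addr → Prop} {i : Fin p} {l l' : Loc Item p} {x : Addr} {v : Node Item} {q : PC}

theorem advance (I : Inv s ρ items seen) (hl : s.At i l q)
    (hfix : l'.e = l.e ∧ l'.g = l.g ∧ l'.h1 = l.h1 ∧ l'.h = l.h) (hq : q ≠ .announce)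
    (hq' : l'.pc ≠ .announce) (O : (s.view ρ).Outline items seen i l' l'.pc) :
    Inv (s.setLoc i l') ρ items seen := by
  obtain ⟨he, hg, h1, hh⟩ := hfix
  have L := I.loc i l hl.1
  refine I.setLoc hl ⟨he, hg, h1⟩ hq hq'
    ⟨hg ▸ L.g_allocated, h1 ▸ L.h1_seen, hh ▸ L.h_passed, ?_, O⟩
  have := L.onTrack
  rw [View.OnTrack] at this ⊢
  rwa [he, hh]

theorem testFront [DecidableEq Item] (I : Inv s ρ items seen) (hl : s.At i l .testFront)
    (hx : s.Pts l.h1 x v) :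
    Inv (s.setLoc i (if v.item = l.e then { l with pc := .unannFront1 }
      else { l with c := 0, pc := .loop })) ρ items seen := by
  obtain ⟨hA, hU, -⟩ := (I.loc i l hl.1).outline_at hl.2
  have hi := Config.view_item (ρ := ρ) hx.2
  split_ifs with h
  · exact I.advance hl ⟨rfl, rfl, rfl, rfl⟩ (by simp) (by simp) ⟨hA, x, hx.1, by rw [hi, h]⟩
  · exact I.advance hl ⟨rfl, rfl, rfl, rfl⟩ (by simp) (by simp)
      ⟨hA, hU, x, hx.1, by simpa [hi] using h⟩

theorem unannFront1 [DecidableEq Item] (I : Inv s ρ items seen) (hl : s.At i l .unannFront1) :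
    Inv ((s.casAnn i (l.g, some l.e) (none, none)).setLoc i
      { l with
        a := (s.ann i).1, b := (s.ann i).2, res := .pointer l.h1
        pc := if (s.ann i).2 = none then .unannFront2 else .ret }) ρ items seen := by
  have L := I.loc i l hl.1
  obtain ⟨-, hF⟩ := L.outline_at hl.2
  by_cases h : (s.ann i).2 = none
  · have hne : s.ann i ≠ (l.g, some l.e) := fun h' => by simp [h'] at h
    simp only [Config.casAnn, if_neg hne, if_pos h]
    exact I.advance hl ⟨rfl, rfl, rfl, rfl⟩ (by simp) (by simp) ⟨hF, rfl, h⟩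
  · have heq : s.ann i = (l.g, some l.e) := L.ann_eq h
    simp only [Config.casAnn, if_pos heq, if_neg h]
    exact I.withdraw hl (by simp) ⟨rfl, rfl, rfl⟩ rfl rfl (hF.correctResult L I.shared rfl rfl)

theorem unannFront2 [DecidableEq Item] (I : Inv s ρ items seen) (hl : s.At i l .unannFront2) :
    Inv ((s.casAnn i (l.a, l.b) (none, none)).setLoc i
      { l with res := .pointer l.h1, pc := .ret }) ρ items seen := by
  have L := I.loc i l hl.1
  obtain ⟨hF, hW, -⟩ := L.outline_at hl.2
  have hW' : s.ann i = (l.a, l.b) := hW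
  simp only [Config.casAnn, if_pos hW']
  exact I.withdraw hl (by simp) ⟨rfl, rfl, rfl⟩ rfl rfl (hF.correctResult L I.shared rfl rfl)

theorem loop (I : Inv s ρ items seen) (hl : s.At i l .loop) :
    Inv (s.setLoc i { l with pc := if l.h = none then .readAnn4 else .testItem }) ρ items seen := by
  have hS := (I.loc i l hl.1).outline_at hl.2
  split_ifs with h
  · exact I.advance hl ⟨rfl, rfl, rfl, rfl⟩ (by simp) (by simp) ⟨hS.1, hS.2.2, h⟩
  · exact I.advance hl ⟨rfl, rfl, rfl, rfl⟩ (by simp) (by simp) ⟨hS, h⟩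

theorem testItem [DecidableEq Item] (I : Inv s ρ items seen) (hl : s.At i l .testItem)
    (hx : s.Pts l.h x v) :
    Inv (s.setLoc i (if v.item = l.e then { l with pc := .readAnn1 }
      else { l with c := (l.c + 1) % φ
                    pc := if (l.c + 1) % φ = 0 then .readAnn3 else .next })) ρ items seen := by
  obtain ⟨hS, -⟩ := (I.loc i l hl.1).outline_at hl.2
  have hi := Config.view_item (ρ := ρ) hx.2
  split_ifs with h
  · exact I.advance hl ⟨rfl, rfl, rfl, rfl⟩ (by simp) (by simp) ⟨hS, x, hx.1, by rw [hi, h]⟩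
  all_goals
    exact I.advance hl ⟨rfl, rfl, rfl, rfl⟩ (by simp) (by simp)
      ⟨hS, x, hx.1, by simpa [hi] using h⟩

theorem readAnn1 (I : Inv s ρ items seen) (hl : s.At i l .readAnn1) :
    Inv (s.setLoc i { l with
      a := (s.ann i).1, b := (s.ann i).2
      pc := if (s.ann i).2 = none then .unannOther1 else .setOld }) ρ items seen := by
  obtain ⟨hS, hF⟩ := (I.loc i l hl.1).outline_at hl.2
  split_ifs with h
  · have hI := hS.1.informed (h.trans_ne (by simp))
    exact I.advance hl ⟨rfl, rfl, rfl, rfl⟩ (by simp) (by simp) ⟨hI, rfl, h⟩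
  · exact I.advance hl ⟨rfl, rfl, rfl, rfl⟩ (by simp) (by simp) ⟨hS, hF⟩

theorem readAnn3 (I : Inv s ρ items seen) (hl : s.At i l .readAnn3) :
    Inv (s.setLoc i { l with
      a := (s.ann i).1, b := (s.ann i).2
      pc := if (s.ann i).2 = none then .unannOther2 else .next }) ρ items seen := by
  obtain ⟨hS, hF⟩ := (I.loc i l hl.1).outline_at hl.2
  split_ifs with h
  · have hI := hS.1.informed (h.trans_ne (by simp))
    exact I.advance hl ⟨rfl, rfl, rfl, rfl⟩ (by simp) (by simp) ⟨hI, rfl, h⟩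
  · exact I.advance hl ⟨rfl, rfl, rfl, rfl⟩ (by simp) (by simp) ⟨hS, hF⟩

theorem next (I : Inv s ρ items seen) (hl : s.At i l .next) (hx : s.Pts l.h x v) :
    Inv (s.setLoc i { l with h := v.next, pc := .loop }) ρ items seen :=
  I.setLoc hl ⟨rfl, rfl, rfl⟩ (by simp) (by simp)
    (Config.view_next (ρ := ρ) hx.2 ▸ (I.loc i l hl.1).toLoop I.shared hl.2 hx.1)

theorem withdraw_informed [DecidableEq Item] (I : Inv s ρ items seen) (hl : s.At i l q)
    (hq : q ≠ .announce)
    (hI : (s.view ρ).Informed seen i l) (hW : (s.view ρ).Withdrawing i l) :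
    Inv ((s.casAnn i (l.a, l.b) (none, none)).setLoc i
      { l with res := .pointer l.a, pc := .ret }) ρ items seen := by
  have hW' : s.ann i = (l.a, l.b) := hW.1
  simp only [Config.casAnn, if_pos hW']
  exact I.withdraw hl hq ⟨rfl, rfl, rfl⟩ rfl rfl (hI.correctResult I.shared hW rfl rfl)

theorem getNewGone (I : Inv s ρ items seen) (hl : s.At i l .getNew) (hx : s.Pts l.h x v)
    (hv : v.new = .GONE) : Inv (s.setLoc i { l with pc := .readAnn2 }) ρ items seen := by
  have L := I.loc i l hl.1
  obtain ⟨hA, hM, ⟨x', hx', hxe⟩, -⟩ := L.outline_at hl.2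
  obtain rfl : x = x' := Option.some_inj.1 (hx.1.symm.trans hx')
  have hp := I.shared.not_protected_of_gone x ((Config.view_new hx.2).trans hv)
  exact I.advance hl ⟨rfl, rfl, rfl, rfl⟩ (by simp) (by simp)
    (hA.informed_of_not_seeks hM hl.1 (L.not_seeks_of_not_protected I.shared hx.1 hxe hp))

theorem getNew (I : Inv s ρ items seen) (hl : s.At i l .getNew) (hx : s.Pts l.h x v) {y : Ptr}
    (hv : v.new = .ptr y) : Inv (s.setLoc i { l with g' := y, pc := .outer }) ρ items seen := by
  have L := I.loc i l hl.1
  obtain ⟨hA, hM, hF, hR⟩ := L.outline_at hl.2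
  have hnew : (s.view ρ).new x = .ptr y := (Config.view_new hx.2).trans hv
  obtain _ | y := y
  · exact absurd hnew (hR x hx.1)
  · exact I.advance hl ⟨rfl, rfl, rfl, rfl⟩ (by simp) (by simp)
      ⟨hA, hM, hF, I.shared.target hx.1 (L.h_passed x hx.1).1 hnew⟩

theorem readAnn4 (I : Inv s ρ items seen) (hl : s.At i l .readAnn4) :
    Inv (s.setLoc i { l with a := (s.ann i).1, b := (s.ann i).2, pc := .unannEnd })
      ρ items seen := by
  have L := I.loc i l hl.1
  obtain ⟨hA, hM, hh⟩ := L.outline_at hl.2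
  refine I.advance hl ⟨rfl, rfl, rfl, rfl⟩ (by simp) (by simp) ⟨hA, rfl, or_iff_not_imp_right.2 ?_⟩
  intro he
  refine (hA.informed_of_not_seeks hM hl.1 fun hs => ?_).ann_snd
  obtain ⟨x, -, hx, -⟩ := L.onTrack hs (not_not.1 he)
  cases hh.symm.trans hx

theorem unannEnd [DecidableEq Item] (I : Inv s ρ items seen) (hl : s.At i l .unannEnd) :
    Inv ((s.casAnn i (l.a, l.b) (none, none)).setLoc i
      { l with res := if l.b = none then .pointer l.a else .notPresent, pc := .ret })
      ρ items seen := by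
  obtain ⟨hA, hann, hres⟩ := (I.loc i l hl.1).outline_at hl.2
  by_cases h : l.b = none
  · have hI := hA.informed (by rw [hann]; simp [h])
    simp only [if_pos h]
    exact I.withdraw_informed hl (by simp) hI ⟨hann, h⟩
  · have hann' : s.ann i = (l.a, l.b) := hann
    have he := hres.resolve_left h
    simp only [if_neg h, Config.casAnn, if_pos hann']
    exact I.withdraw hl (by simp) ⟨rfl, rfl, rfl⟩ rfl rfl ⟨fun h => absurd h he, fun _ => rfl⟩

end Inv

theorem View.SharedInv.notPrepended {V : View Item p} {items : List Item} {l : Loc Item p}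
    (G : V.SharedInv items) (hd : V.OldDone l) {x : Addr} (hx : l.g' = some x)
    (hxd : V.old x ≠ .DONE) : V.NotPrepended l := by
  intro hh y hy
  obtain rfl : x = y := Option.some_inj.1 (hx.symm.trans hy)
  by_contra h0
  obtain ⟨hhx, -⟩ := (G.old x (Nat.pos_of_ne_zero h0)).resolve_left hxd
  exact hxd (hd x (hh.symm.trans hhx))

theorem View.SharedInv.informee {V : View Item p} {items : List Item} {l : Loc Item p} {j : Fin p}
    (G : V.SharedInv items) (hj : l.j = some j) (ha : V.ann j = (l.a, l.b)) (hb : l.b = some l.e') :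
    V.Informee l :=
  ⟨j, hj, hb, fun x hx => G.ann j x (by rw [ha, hx])⟩

namespace Inv

variable {φ : ℕ} {s s' : Config Item p} {ρ : Addr → ℕ} {items : List Item}
  {seen : Fin p → Addr → Prop} {i : Fin p} {l : Loc Item p} {x : Addr} {v : Node Item}

theorem outer (I : Inv s ρ items seen) (hl : s.At i l .outer) (hx : s.Pts l.g' x v) :
    Inv (s.setLoc i { l with pc := if v.old = .DONE then .readAnn2 else .getHead2 })
      ρ items seen := by
  have L := I.loc i l hl.1
  have hM := L.outline_at hl.2
  split_ifs with hd
  · obtain ⟨hA, hF, ⟨u, hu, hue⟩, hT⟩ := hM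
    have hp := I.shared.not_protected_of_target_done hT hu (L.h_passed u hu).1 hx.1
      ((Config.view_old hx.2).trans hd)
    exact I.advance hl ⟨rfl, rfl, rfl, rfl⟩ (by simp) (by simp)
      (hA.informed_of_not_seeks hF hl.1 (L.not_seeks_of_not_protected I.shared hu hue hp))
  · exact I.advance hl ⟨rfl, rfl, rfl, rfl⟩ (by simp) (by simp) hM

theorem getOldDone (I : Inv s ρ items seen) (hl : s.At i l .getOld) (hx : s.Pts l.k1 x v)
    (hv : v.old = .DONE) : Inv (s.setLoc i { l with pc := .testPrepend }) ρ items seen := by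
  obtain ⟨hM, hH⟩ := (I.loc i l hl.1).outline_at hl.2
  refine I.advance hl ⟨rfl, rfl, rfl, rfl⟩ (by simp) (by simp) ⟨hM, hH, fun y hy => ?_⟩
  obtain rfl : x = y := Option.some_inj.1 (hx.1.symm.trans hy)
  exact (Config.view_old hx.2).trans hv

theorem getOld (I : Inv s ρ items seen) (hl : s.At i l .getOld) (hx : s.Pts l.k1 x v) {w : Ptr}
    (hv : v.old = .ptr w) : Inv (s.setLoc i { l with h' := w, pc := .setNext }) ρ items seen := by
  obtain ⟨hM, hH⟩ := (I.loc i l hl.1).outline_at hl.2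
  exact I.advance hl ⟨rfl, rfl, rfl, rfl⟩ (by simp) (by simp)
    ⟨hM, hH, I.shared.replaces hx.1 (hH.rank_pos hx.1) ((Config.view_old hx.2).trans hv)⟩

theorem testPrepend (I : Inv s ρ items seen) (hl : s.At i l .testPrepend) (hx : s.Pts l.g' x v) :
    Inv (s.setLoc i { l with pc := if v.old = .DONE then .outer else .prepend }) ρ items seen := by
  obtain ⟨hM, hH, hd⟩ := (I.loc i l hl.1).outline_at hl.2
  split_ifs with h
  · exact I.advance hl ⟨rfl, rfl, rfl, rfl⟩ (by simp) (by simp) hM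
  · exact I.advance hl ⟨rfl, rfl, rfl, rfl⟩ (by simp) (by simp)
      ⟨hM, hH, hd, I.shared.notPrepended hd hx.1 (by rwa [Config.view_old hx.2])⟩

theorem getItem (I : Inv s ρ items seen) (hl : s.At i l .getItem) (hx : s.Pts l.k1 x v) :
    Inv (s.setLoc i { l with e' := v.item, todo := Finset.univ, pc := .readAnn })
      ρ items seen := by
  refine I.advance hl ⟨rfl, rfl, rfl, rfl⟩ (by simp) (by simp)
    ⟨(I.loc i l hl.1).outline_at hl.2, fun y hy => ?_⟩
  obtain rfl : x = y := Option.some_inj.1 (hx.1.symm.trans hy)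
  exact ⟨Config.view_item hx.2, fun _ _ j _ => Finset.mem_univ j⟩

theorem readAnn [DecidableEq Item] (I : Inv s ρ items seen) (hl : s.At i l .readAnn) (j : Fin p) :
    Inv (s.setLoc i { l with
      j := some j, todo := l.todo.erase j, a := (s.ann j).1, b := (s.ann j).2
      pc := if (s.ann j).2 = some l.e' then .testInform else .readAnn }) ρ items seen := by
  obtain ⟨hL, hI⟩ := (I.loc i l hl.1).outline_at hl.2
  split_ifs with h
  · refine I.advance hl ⟨rfl, rfl, rfl, rfl⟩ (by simp) (by simp)
      ⟨hL, hI.mono fun k _ hk => ?_, I.shared.informee rfl rfl h⟩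
    obtain rfl | hkj := eq_or_ne k j
    · exact .inr ⟨rfl, rfl⟩
    · exact .inl (Finset.mem_erase.2 ⟨hkj, hk⟩)
  · refine I.advance hl ⟨rfl, rfl, rfl, rfl⟩ (by simp) (by simp)
      ⟨hL, hI.mono fun k hs hk => Finset.mem_erase.2 ⟨?_, hk⟩⟩
    rintro rfl
    obtain ⟨_, _, _, _, _, _, hk'⟩ := hs
    exact h hk'

theorem testInform (I : Inv s ρ items seen)
    (hseen : ∀ j a, s.proc j ≠ none → s.head.1 = some a → seen j a)
    (hl : s.At i l .testInform) (hx : s.Pts l.k1 x v) :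
    Inv (s.setLoc i { l with pc := if v.old = .DONE then .readAnn else .inform })
      ρ items seen := by
  obtain ⟨hL, hI, hJ⟩ := (I.loc i l hl.1).outline_at hl.2
  split_ifs with h
  · refine I.advance hl ⟨rfl, rfl, rfl, rfl⟩ (by simp) (by simp) ⟨hL, hI.of_oldDone ?_⟩
    intro y hy
    obtain rfl : x = y := Option.some_inj.1 (hx.1.symm.trans hy)
    exact (Config.view_old hx.2).trans h
  · refine I.advance hl ⟨rfl, rfl, rfl, rfl⟩ (by simp) (by simp) ⟨hL, hI, hJ, ?_⟩
    intro j y _ ha hy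
    obtain rfl : x = y := Option.some_inj.1 (hx.1.symm.trans hy)
    obtain ⟨-, -, hb, -⟩ := hJ
    refine hseen j x (fun hj => ?_)
      ((I.shared.old x (hL.1.2.1.rank_pos hx.1)).resolve_left (by rwa [Config.view_old hx.2])).1
    cases (congrArg Prod.snd (ha.symm.trans (I.idle j hj)) :).symm.trans hb

theorem getPrev (I : Inv s ρ items seen) (hl : s.At i l .getPrev) (hx : s.Pts l.h' x v) :
    Inv (s.setLoc i { l with pred := v.prev, pc := .getNext }) ρ items seen := by
  have hR := (I.loc i l hl.1).outline_at hl.2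
  exact I.advance hl ⟨rfl, rfl, rfl, rfl⟩ (by simp) (by simp)
    ⟨hR, Config.view_prev (ρ := ρ) hx.2 ▸ I.shared.gotPrev hR.1.1.2.2 hx.1⟩

theorem getNext (I : Inv s ρ items seen) (hl : s.At i l .getNext) (hx : s.Pts l.h' x v) :
    Inv (s.setLoc i { l with succ := v.next, pc := .remove1 }) ρ items seen := by
  obtain ⟨hR, hP⟩ := (I.loc i l hl.1).outline_at hl.2
  exact I.advance hl ⟨rfl, rfl, rfl, rfl⟩ (by simp) (by simp)
    ⟨hR, hP, Config.view_next (ρ := ρ) hx.2 ▸ I.shared.gotNext hR.1.1.2.2 hx.1⟩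

theorem step [DecidableEq Item] (I : Inv s ρ items seen)
    (hseen : ∀ j a, s.proc j ≠ none → s.head.1 = some a → seen j a)
    {lab : Label Item p} (h : Step φ s lab s') :
    ∃ ρ', Inv s' ρ' items seen ∧ ∀ x, 0 < ρ x → ρ' x = ρ x := by
  have O := fun {i l} (hl : s.proc i = some l) {q} => (I.loc i l hl).outline_at (q := q)
  suffices h' : Inv s' ρ items seen ∨ _ from h'.elim (fun h => ⟨ρ, h, fun _ _ => rfl⟩) id
  cases h with
  | prepend i l hl => exact .inr (I.prepend hl)
  | invoke i e h => exact .inl (I.invoke e h)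
  | allocate i l x hl hx => exact .inl (I.allocate hl hx)
  | announce i l hl =>
    have hann : s.ann i = (none, none) := (O hl.1 hl.2).1
    rw [Config.casAnn, if_pos hann]
    exact .inl (I.announce hl)
  | getHead i l hl => exact .inl (I.getHead hl fun a => hseen i a (by simp [hl.1]))
  | testFront i l x v hl hx => exact .inl (I.testFront hl hx)
  | unannFront1 i l hl => exact .inl (I.unannFront1 hl)
  | unannFront2 i l hl => exact .inl (I.unannFront2 hl)
  | loop i l hl => exact .inl (I.loop hl)
  | testItem i l x v hl hx => exact .inl (I.testItem hl hx)
  | readAnn1 i l hl => exact .inl (I.readAnn1 hl)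
  | unannOther1 i l hl | unannOther2 i l hl | unannPostMTF i l hl =>
    exact .inl (I.withdraw_informed hl (by simp) (O hl.1 hl.2).1 (O hl.1 hl.2).2)
  | setOld i l x v hl hx => exact .inl (I.setOld hl hx)
  | setNew i l x v hl hx => exact .inl (I.setNew hl hx)
  | getNewGone i l x v hl hx hv => exact .inl (I.getNewGone hl hx hv)
  | getNew i l x v a hl hx hv => exact .inl (I.getNew hl hx hv)
  | readAnn2 i l hl =>
    have hI := O hl.1 hl.2
    exact .inl (I.advance hl ⟨rfl, rfl, rfl, rfl⟩ (by simp) (by simp) ⟨hI, rfl, hI.ann_snd⟩)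
  | readAnn3 i l hl => exact .inl (I.readAnn3 hl)
  | next i l x v hl hx => exact .inl (I.next hl hx)
  | readAnn4 i l hl => exact .inl (I.readAnn4 hl)
  | unannEnd i l hl => exact .inl (I.unannEnd hl)
  | ret i l hl => exact .inl (I.ret hl)
  | outer i l x v hl hx => exact .inl (I.outer hl hx)
  | getHead2 i l hl =>
    exact .inl (I.advance hl ⟨rfl, rfl, rfl, rfl⟩ (by simp) (by simp)
      ⟨O hl.1 hl.2, I.shared.headPair⟩)
  | getOldDone i l x v hl hx hv => exact .inl (I.getOldDone hl hx hv)
  | getOld i l x v a hl hx hv => exact .inl (I.getOld hl hx hv)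
  | testPrepend i l x v hl hx => exact .inl (I.testPrepend hl hx)
  | setNext i l x v hl hx => exact .inl (I.setNext hl hx)
  | setPrev i l x v hl hx => exact .inl (I.setPrev hl hx)
  | getItem i l x v hl hx => exact .inl (I.getItem hl hx)
  | readAnn i l j hl hj => exact .inl (I.readAnn hl j)
  | testInform i l x v hl hx => exact .inl (I.testInform hseen hl hx)
  | inform i l j hl hj => exact .inl (I.inform hl hj)
  | informed i l hl hj =>
    obtain ⟨hL, hI⟩ := O hl.1 hl.2
    exact .inl (I.advance hl ⟨rfl, rfl, rfl, rfl⟩ (by simp) (by simp)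
      ⟨hL, hI.mono fun j _ h => absurd h (by simp [hj])⟩)
  | getPrev i l x v hl hx => exact .inl (I.getPrev hl hx)
  | getNext i l x v hl hx => exact .inl (I.getNext hl hx)
  | remove1 i l x v hl hx => exact .inl (I.remove1 hl hx)
  | remove2Null i l hl hx =>
    exact .inl (I.advance hl ⟨rfl, rfl, rfl, rfl⟩ (by simp) (by simp) (O hl.1 hl.2).1)
  | remove2 i l x v hl hx => exact .inl (I.remove2 hl hx)
  | gone i l x v hl hx => exact .inl (I.gone hl hx)
  | done i l x v hl hx => exact .inl (I.done hl hx)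

end Inv

namespace View

/-- The shared memory is initial and the list consists of the nodes `addrs`, which contain the
members of `items`. The ranks are those that the nodes would have if they had been prepended one
after the other, the last one first. -/
structure IsInitial (V : View Item p) (items : List Item) (addrs : List Addr) : Prop where
  nodup : addrs.Nodup
  length_eq : addrs.length = items.length
  head : V.head = (addrs[0]?, addrs[1]?)
  rank : ∀ x, V.rank x = addrs.length - addrs.idxOf x
  item : ∀ (t : ℕ) (ht : t < addrs.length), V.item addrs[t] = items[t]?
  next : ∀ (t : ℕ) (ht : t < addrs.length), V.next addrs[t] = addrs[t + 1]?
  prev : ∀ (t : ℕ) (ht : t < addrs.length),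
    V.prev addrs[t] = if t = 0 then none else addrs[t - 1]?
  old : ∀ (t : ℕ) (ht : t < addrs.length), V.old addrs[t] = .DONE
  new : ∀ x, V.new x = .ptr none
  unlisted : ∀ x ∉ addrs, V.next x = none ∧ V.prev x = none
  ann : ∀ i, V.ann i = (none, none)

namespace IsInitial

variable {V : View Item p} {items : List Item} {addrs : List Addr}

theorem rank_getElem (h : V.IsInitial items addrs) (t : ℕ) (ht : t < addrs.length) :
    V.rank addrs[t] = addrs.length - t := by
  rw [h.rank, h.nodup.idxOf_getElem]

theorem exists_getElem (h : V.IsInitial items addrs) {x : Addr} (hx : 0 < V.rank x) :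
    ∃ t, ∃ ht : t < addrs.length, addrs[t] = x := by
  rw [h.rank] at hx
  exact ⟨_, by omega, List.getElem_idxOf (by omega)⟩

theorem eq_of_item_eq (h : V.IsInitial items addrs) (hnodup : items.Nodup) {x y : Addr}
    (hx : 0 < V.rank x) (hy : 0 < V.rank y) (hxy : V.item x = V.item y) : x = y := by
  obtain ⟨t, ht, rfl⟩ := h.exists_getElem hx
  obtain ⟨u, hu, rfl⟩ := h.exists_getElem hy
  rw [h.item, h.item] at hxy
  obtain rfl := (List.getElem?_inj (h.length_eq ▸ ht) hnodup).1 hxy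
  rfl

theorem exists_head (h : V.IsInitial items addrs) (hnodup : items.Nodup)
    (hlen : 2 ≤ items.length) :
    ∃ a b, V.head = (some a, some b) ∧ 0 < V.rank b ∧ V.rank b < V.rank a ∧
      V.item a ≠ V.item b ∧ ∀ z, z ≠ a → V.rank z ≤ V.rank b := by
  have hl := h.length_eq
  have r0 := h.rank_getElem 0 (by omega)
  have r1 := h.rank_getElem 1 (by omega)
  refine ⟨addrs[0], addrs[1], by simp [h.head, show 0 < addrs.length by omega,
    show 1 < addrs.length by omega], by omega, by omega, fun hi => ?_, fun z hz => ?_⟩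
  · have := h.eq_of_item_eq hnodup (by omega) (by omega) hi
    rw [this] at r0
    omega
  · by_contra! hlt
    obtain ⟨t, ht, rfl⟩ := h.exists_getElem (Nat.zero_lt_of_lt hlt)
    obtain rfl : t = 0 := by
      rw [h.rank_getElem t ht] at hlt
      omega
    exact hz rfl

theorem rank_inj (h : V.IsInitial items addrs) {x y : Addr} (hx : 0 < V.rank x)
    (hxy : V.rank x = V.rank y) : x = y := by
  obtain ⟨t, ht, rfl⟩ := h.exists_getElem hx
  obtain ⟨u, hu, rfl⟩ := h.exists_getElem (hxy ▸ hx)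
  rw [h.rank_getElem, h.rank_getElem] at hxy
  obtain rfl : t = u := by omega
  rfl

theorem next_lt (h : V.IsInitial items addrs) {x y : Addr} (hx : 0 < V.rank x)
    (hy : V.next x = some y) : 0 < V.rank y ∧ V.rank y < V.rank x := by
  obtain ⟨t, ht, rfl⟩ := h.exists_getElem hx
  rw [h.next] at hy
  obtain ⟨ht', rfl⟩ := List.getElem?_eq_some_iff.1 hy
  rw [h.rank_getElem, h.rank_getElem]
  omega

theorem exists_next (h : V.IsInitial items addrs) {x w : Addr} (hw : 0 < V.rank w)
    (hlt : V.rank w < V.rank x) : ∃ y, V.next x = some y ∧ V.rank w ≤ V.rank y := by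
  obtain ⟨t, ht, rfl⟩ := h.exists_getElem (hw.trans hlt)
  obtain ⟨u, hu, rfl⟩ := h.exists_getElem hw
  rw [h.rank_getElem, h.rank_getElem] at hlt
  have ht' : t + 1 < addrs.length := by omega
  refine ⟨addrs[t + 1], by rw [h.next, List.getElem?_eq_getElem ht'], ?_⟩
  rw [h.rank_getElem, h.rank_getElem]
  omega

theorem prev_listed (h : V.IsInitial items addrs) {x y : Addr} (hx : 0 < V.rank x)
    (hy : V.prev x = some y) : 0 < V.rank y := by
  obtain ⟨t, ht, rfl⟩ := h.exists_getElem hx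
  rw [h.prev] at hy
  split_ifs at hy
  obtain ⟨ht', rfl⟩ := List.getElem?_eq_some_iff.1 hy
  rw [h.rank_getElem]
  omega

theorem prev_ne_none (h : V.IsInitial items addrs) {x : Addr} (hx : 0 < V.rank x)
    (hne : V.head.1 ≠ some x) : V.prev x ≠ none := by
  obtain ⟨t, ht, rfl⟩ := h.exists_getElem hx
  have ht0 : t ≠ 0 := by
    rintro rfl
    exact hne (by rw [h.head, List.getElem?_eq_getElem ht])
  rw [h.prev, if_neg ht0, List.getElem?_eq_getElem (by omega)]
  exact Option.some_ne_none _

theorem sharedInv (h : V.IsInitial items addrs) (hnodup : items.Nodup)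
    (hlen : 2 ≤ items.length) : V.SharedInv items where
  rank_inj _ _ := h.rank_inj
  item_mem x hx := by
    obtain ⟨t, ht, rfl⟩ := h.exists_getElem hx
    have ht' : t < items.length := h.length_eq ▸ ht
    exact ⟨items[t], List.getElem_mem _, by rw [h.item, List.getElem?_eq_getElem ht']⟩
  exists_node e he := by
    obtain ⟨t, ht, rfl⟩ := List.getElem_of_mem he
    have ht' : t < addrs.length := h.length_eq ▸ ht
    refine ⟨addrs[t], ?_, by rw [h.item, List.getElem?_eq_getElem ht]⟩
    rw [h.rank_getElem]
    omega
  head := h.exists_head hnodup hlen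
  old x hx := by
    obtain ⟨t, ht, rfl⟩ := h.exists_getElem hx
    exact .inl (h.old t ht)
  next_lt _ _ := h.next_lt
  le_next _ _ _ hw hlt := .inl (h.exists_next hw.1 hlt)
  prev_listed _ _ := h.prev_listed
  prev_ne_none _ hx hne _ := h.prev_ne_none hx hne
  new_ptr x g _ hg := by cases (h.new x).symm.trans hg
  new_of_later x z hx hlt hi := by
    cases h.eq_of_item_eq hnodup (hx.trans hlt) hx hi
    exact absurd hlt (lt_irrefl _)
  not_protected_of_gone x hx := by cases (h.new x).symm.trans hx
  unlisted x hx := by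
    have hmem : x ∉ addrs := fun hmem => by
      have := List.idxOf_lt_length_of_mem hmem
      have := h.rank x
      omega
    exact ⟨(h.unlisted x hmem).1, (h.unlisted x hmem).2, h.new x⟩
  ann j x hx := by simp [h.ann] at hx

end IsInitial

end View

theorem IsInit.exists_inv {items : List Item} (hnodup : items.Nodup) (hlen : 2 ≤ items.length)
    {s : Config Item p} (h : IsInit items s) (seen : Fin p → Addr → Prop) :
    ∃ ρ, Inv s ρ items seen := by
  obtain ⟨⟨addrs, hnd, hl, hheap, hnone, hhead⟩, hann, hproc⟩ := h
  let ρ : Addr → ℕ := fun x => addrs.length - addrs.idxOf x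
  have hnode : ∀ t (ht : t < addrs.length), s.heap addrs[t] = some
      { item := items[t]'(hl ▸ ht), next := addrs[t + 1]?,
        prev := if t = 0 then none else addrs[t - 1]?, old := .DONE, new := .ptr none } :=
    fun t ht => hheap t _ _ (by simp [ht]) (by simp [hl ▸ ht])
  have hinit : (s.view ρ).IsInitial items addrs :=
    { nodup := hnd
      length_eq := hl
      head := hhead
      rank := fun _ => rfl
      item := fun t ht => (Config.view_item (hnode t ht)).trans (List.getElem?_eq_getElem _).symm
      next := fun t ht => Config.view_next (hnode t ht)
      prev := fun t ht => Config.view_prev (hnode t ht)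
      old := fun t ht => Config.view_old (hnode t ht)
      new := fun x => by
        by_cases hx : x ∈ addrs
        · obtain ⟨t, ht, rfl⟩ := List.getElem_of_mem hx
          exact Config.view_new (hnode t ht)
        · simp [Config.view, hnone x hx]
      unlisted := fun x hx => by simp [Config.view, hnone x hx]
      ann := hann }
  exact ⟨ρ, hinit.sharedInv hnodup hlen, fun i l h => by simp [hproc] at h, fun i _ => hann i,
    fun i j l l' x h => by simp [hproc] at h⟩

namespace Config

/-- Only one address is written between `s` and `t`, and the item stored there is kept. -/
def WritesOne (s t : Config Item p) : Prop :=
  ∃ x, (∀ y, y ≠ x → t.heap y = s.heap y) ∧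
    ∀ v, s.heap x = some v → ∃ v', t.heap x = some v' ∧ v'.item = v.item

variable {s t : Config Item p} {x : Addr} {v v' : Node Item}

theorem writesOne_of_heap_eq (h : t.heap = s.heap) : s.WritesOne t :=
  ⟨0, fun y _ => by rw [h], fun v hv => ⟨v, by rw [h, hv], rfl⟩⟩

theorem writesOne_setNode (h : ∀ u, s.heap x = some u → v.item = u.item) :
    s.WritesOne (s.setNode x v) :=
  ⟨x, fun y hy => by simp [setNode, hy], fun u hu => ⟨v, by simp [setNode], h u hu⟩⟩

theorem writesOne_ite_setNode {c : Prop} [Decidable c] (h : s.heap x = some v)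
    (hv : v'.item = v.item) : s.WritesOne (if c then s.setNode x v' else s) := by
  split_ifs
  · exact writesOne_setNode fun u hu => by rw [hv, Option.some.inj (h.symm.trans hu)]
  · exact writesOne_of_heap_eq rfl

theorem heap_casAnn [DecidableEq Item] (s : Config Item p) (i : Fin p)
    (x y : Ptr × Option Item) : (s.casAnn i x y).heap = s.heap := by
  unfold casAnn
  split_ifs <;> rfl

theorem heap_casHead (s : Config Item p) (x y : Ptr × Ptr) :
    (s.casHead x y).heap = s.heap := by
  unfold casHead
  split_ifs <;> rfl

theorem WritesOne.contains {a : Ptr} {e : Item} (h : s.WritesOne t) (ha : s.Contains a e) :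
    t.Contains a e := by
  obtain ⟨y, v, ⟨rfl, hv⟩, rfl⟩ := ha
  obtain ⟨x, h1, h2⟩ := h
  obtain rfl | hy := eq_or_ne y x
  · obtain ⟨v', hv', hi⟩ := h2 v hv
    exact ⟨y, v', ⟨rfl, hv'⟩, hi⟩
  · exact ⟨y, v, ⟨rfl, (h1 y hy).trans hv⟩, rfl⟩

theorem WritesOne.finite_heap (h : s.WritesOne t) (hs : {x | s.heap x ≠ none}.Finite) :
    {x | t.heap x ≠ none}.Finite := by
  obtain ⟨x, h1, -⟩ := h
  refine (hs.insert x).subset fun y hy => or_iff_not_imp_left.2 fun hyx => ?_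
  rw [Set.mem_ofPred_eq, h1 y hyx] at hy
  exact hy

end Config

namespace Step

variable [DecidableEq Item] {s s' : Config Item p} {φ : ℕ} {lab : Label Item p} {i : Fin p}
  {l : Loc Item p}

theorem writesOne (h : Step φ s lab s') : s.WritesOne s' := by
  cases h with
  | allocate i l x hl hx => exact Config.writesOne_setNode fun u hu => by simp [hx] at hu
  | announce | unannFront1 | unannFront2 | unannOther1 | unannOther2 | unannPostMTF | unannEnd
  | inform => exact Config.writesOne_of_heap_eq (Config.heap_casAnn ..)
  | prepend => exact Config.writesOne_of_heap_eq (Config.heap_casHead ..)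
  | setOld i l x v hl hx | done i l x v hl hx | setNew i l x v hl hx | gone i l x v hl hx
  | setNext i l x v hl hx | remove1 i l x v hl hx | setPrev i l x v hl hx
  | remove2 i l x v hl hx => exact Config.writesOne_ite_setNode hx.2 rfl
  | _ => exact Config.writesOne_of_heap_eq rfl

theorem proc_of_ne (h : Step φ s lab s') (hi : lab.proc ≠ i) : s'.proc i = s.proc i := by
  cases h <;> simp only [Label.proc] at hi <;>
    simp only [Config.setLoc, Config.setIdle, Config.casAnn, Config.casHead, Config.casOld,
      Config.casNew, Config.casNext, Config.casPrev, Config.setNode] <;>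
    (try split_ifs) <;> simp [Function.update_of_ne (Ne.symm hi)]

theorem exists_loc (h : Step φ s lab s') (hl : s.proc i = some l) (hr : ∀ r, lab ≠ .ret i r) :
    ∃ l', s'.proc i = some l' ∧ l'.e = l.e := by
  obtain hi | hi := ne_or_eq lab.proc i
  · exact ⟨l, by rw [h.proc_of_ne hi, hl], rfl⟩
  have own : ∀ {l₁ l₂ : Loc Item p} {q : PC} {t : Config Item p}, s.At i l₁ q →
      l₂.e = l₁.e → ∃ l', (t.setLoc i l₂).proc i = some l' ∧ l'.e = l.e :=
    fun {l₁ l₂ _ _} hl₁ he => ⟨l₂, Config.setLoc_proc_self, by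
      rw [he, Option.some.inj (hl₁.1.symm.trans hl)]⟩
  cases h with
  | invoke i e h => cases hi; cases hl.symm.trans h
  | ret i l => cases hi; exact absurd rfl (hr _)
  | _ => cases hi; exact own (by assumption) (by first | rfl | (split_ifs <;> rfl))

theorem exists_of_inv {e : Item} (h : Step φ s (.inv i e) s') :
    s.proc i = none ∧ ∃ l, s'.proc i = some l ∧ l.e = e := by
  cases h with
  | invoke i e h => exact ⟨h, _, Config.setLoc_proc_self, rfl⟩

theorem exists_of_ret {r : Result} (h : Step φ s (.ret i r) s') :
    ∃ l, s.At i l .ret ∧ l.res = r := by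
  cases h with
  | ret i l hl => exact ⟨l, hl, rfl⟩

end Step

/-- Process `i` has a next step in configuration `s`. -/
def Config.Enabled [DecidableEq Item] (φ : ℕ) (s : Config Item p) (i : Fin p) : Prop :=
  ∃ lab t, lab.proc = i ∧ Step φ s lab t

/-- The positions in MOVE-TO-FRONT at which the node at the front replaces another one. -/
def PC.InHelping : PC → Prop
  | .setNext | .setPrev | .getItem | .readAnn | .testInform | .inform | .getPrev | .getNext
  | .remove1 | .remove2 | .gone | .done => True
  | _ => False

/-- The other positions in MOVE-TO-FRONT. -/
def PC.InMoving : PC → Prop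
  | .outer | .getHead2 | .getOld | .testPrepend | .prepend => True
  | _ => False

theorem Config.exists_pts_of_target {s : Config Item p} {ρ : Addr → ℕ} {l : Loc Item p}
    (hT : (s.view ρ).Target l) : ∃ x v, s.Pts l.g' x v := by
  obtain ⟨-, y, -, hy, hi, -⟩ := hT
  exact ⟨y, (Config.exists_of_view_item hi).imp fun _ hv => ⟨hy, hv⟩⟩

namespace Inv

variable {s : Config Item p} {ρ : Addr → ℕ} {items : List Item} {seen : Fin p → Addr → Prop}
  {i : Fin p} {l : Loc Item p} {a : Ptr}

theorem exists_pts (I : Inv s ρ items seen) (h : ∃ x, a = some x ∧ 0 < ρ x) :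
    ∃ x v, s.Pts a x v := by
  obtain ⟨x, ha, hx⟩ := h
  obtain ⟨e, -, he⟩ := I.shared.item_mem x hx
  obtain ⟨v, hv⟩ := Config.exists_of_view_item (he ▸ Option.some_ne_none e)
  exact ⟨x, v, ha, hv⟩

theorem exists_pts_h (I : Inv s ρ items seen) (hl : s.proc i = some l) (h : l.h ≠ none) :
    ∃ x v, s.Pts l.h x v := by
  obtain ⟨x, hx⟩ := Option.ne_none_iff_exists'.1 h
  exact I.exists_pts ⟨x, hx, ((I.loc i l hl).h_passed x hx).1⟩

theorem exists_pts_headPair (I : Inv s ρ items seen) (hH : (s.view ρ).HeadPair l) :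
    (∃ x v, s.Pts l.k1 x v) ∧ ∃ x v, s.Pts l.k2 x v := by
  obtain ⟨x, y, hx, hy, hy0, hyx, -⟩ := hH
  exact ⟨I.exists_pts ⟨x, hx, hy0.trans hyx⟩, I.exists_pts ⟨y, hy, hy0⟩⟩

theorem exists_pts_replaced (I : Inv s ρ items seen) (hR : (s.view ρ).Replaces l) :
    ∃ x v, s.Pts l.h' x v := by
  obtain ⟨_, w, -, hw, hocc, -⟩ := hR
  exact I.exists_pts ⟨w, hw, hocc.1⟩

theorem helping (I : Inv s ρ items seen) (hl : s.proc i = some l) (hpc : l.pc.InHelping) :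
    (s.view ρ).Helping seen i l := by
  have O := (I.loc i l hl).outline
  cases hq : l.pc <;> rw [hq] at O hpc <;>
    first
    | exact hpc.elim
    | simp only [View.Outline, View.Linked, View.Removing] at O; tauto

variable [DecidableEq Item]

theorem enabled_of_inMoving (φ : ℕ) (I : Inv s ρ items seen) (hl : s.proc i = some l)
    (hpc : l.pc.InMoving) : s.Enabled φ i := by
  have O := (I.loc i l hl).outline
  cases hq : l.pc <;> rw [hq] at O hpc
  case outer =>
    obtain ⟨x, v, hx⟩ := Config.exists_pts_of_target O.2.2.2
    exact ⟨_, _, rfl, .outer s i l x v ⟨hl, hq⟩ hx⟩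
  case getHead2 => exact ⟨_, _, rfl, .getHead2 s i l ⟨hl, hq⟩⟩
  case getOld =>
    obtain ⟨x, v, hx⟩ := (I.exists_pts_headPair O.2).1
    cases hv : v.old with
    | mark => exact ⟨_, _, rfl, .getOldDone s i l x v ⟨hl, hq⟩ hx hv⟩
    | ptr w => exact ⟨_, _, rfl, .getOld s i l x v w ⟨hl, hq⟩ hx hv⟩
  case testPrepend =>
    obtain ⟨x, v, hx⟩ := Config.exists_pts_of_target O.1.2.2.2
    exact ⟨_, _, rfl, .testPrepend s i l x v ⟨hl, hq⟩ hx⟩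
  case prepend => exact ⟨_, _, rfl, .prepend s i l ⟨hl, hq⟩⟩
  all_goals exact hpc.elim

theorem enabled_of_inHelping (φ : ℕ) (I : Inv s ρ items seen) (hl : s.proc i = some l)
    (hpc : l.pc.InHelping) : s.Enabled φ i := by
  have O := (I.loc i l hl).outline
  obtain ⟨-, hH, hR⟩ := I.helping hl hpc
  obtain ⟨⟨x, v, hx⟩, y, w, hy⟩ := I.exists_pts_headPair hH
  obtain ⟨z, u, hz⟩ := I.exists_pts_replaced hR
  cases hq : l.pc <;> rw [hq] at O hpc
  case setNext => exact ⟨_, _, rfl, .setNext s i l x v ⟨hl, hq⟩ hx⟩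
  case setPrev => exact ⟨_, _, rfl, .setPrev s i l y w ⟨hl, hq⟩ hy⟩
  case getItem => exact ⟨_, _, rfl, .getItem s i l x v ⟨hl, hq⟩ hx⟩
  case readAnn =>
    obtain h | ⟨j, hj⟩ := l.todo.eq_empty_or_nonempty
    · exact ⟨_, _, rfl, .informed s i l ⟨hl, hq⟩ h⟩
    · exact ⟨_, _, rfl, .readAnn s i l j ⟨hl, hq⟩ hj⟩
  case testInform => exact ⟨_, _, rfl, .testInform s i l x v ⟨hl, hq⟩ hx⟩
  case inform =>
    obtain ⟨j, hj, -⟩ := O.2.2.1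
    exact ⟨_, _, rfl, .inform s i l j ⟨hl, hq⟩ hj⟩
  case getPrev => exact ⟨_, _, rfl, .getPrev s i l z u ⟨hl, hq⟩ hz⟩
  case getNext => exact ⟨_, _, rfl, .getNext s i l z u ⟨hl, hq⟩ hz⟩
  case remove1 =>
    obtain ⟨x, v, hx⟩ := I.exists_pts O.2.1
    exact ⟨_, _, rfl, .remove1 s i l x v ⟨hl, hq⟩ hx⟩
  case remove2 =>
    cases hs : l.succ with
    | none => exact ⟨_, _, rfl, .remove2Null s i l ⟨hl, hq⟩ hs⟩
    | some y =>
      obtain ⟨x, v, hx⟩ := I.exists_pts ⟨y, hs, ((O.2.2 z hz.1).1 y hs).1⟩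
      exact ⟨_, _, rfl, .remove2 s i l x v ⟨hl, hq⟩ hx⟩
  case gone => exact ⟨_, _, rfl, .gone s i l z u ⟨hl, hq⟩ hz⟩
  case done => exact ⟨_, _, rfl, .done s i l x v ⟨hl, hq⟩ hx⟩
  all_goals exact hpc.elim

theorem enabled (φ : ℕ) (I : Inv s ρ items seen) (hfin : {x | s.heap x ≠ none}.Finite)
    (hl : s.proc i = some l) : s.Enabled φ i := by
  by_cases hmoving : l.pc.InMoving
  · exact I.enabled_of_inMoving φ hl hmoving
  by_cases hhelping : l.pc.InHelping
  · exact I.enabled_of_inHelping φ hl hhelping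
  have L := I.loc i l hl
  have O := L.outline
  cases hq : l.pc <;> rw [hq] at O hmoving hhelping
  case allocate =>
    obtain ⟨x, hx⟩ := hfin.exists_notMem
    exact ⟨_, _, rfl, .allocate s i l x ⟨hl, hq⟩ (not_not.1 hx)⟩
  case announce => exact ⟨_, _, rfl, .announce s i l ⟨hl, hq⟩⟩
  case getHead => exact ⟨_, _, rfl, .getHead s i l ⟨hl, hq⟩⟩
  case testFront =>
    obtain ⟨y, hy⟩ := Option.ne_none_iff_exists'.1 O.2.2
    obtain ⟨x, v, hx⟩ := I.exists_pts ⟨y, hy, (L.h1_seen y hy).1⟩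
    exact ⟨_, _, rfl, .testFront s i l x v ⟨hl, hq⟩ hx⟩
  case unannFront1 => exact ⟨_, _, rfl, .unannFront1 s i l ⟨hl, hq⟩⟩
  case unannFront2 => exact ⟨_, _, rfl, .unannFront2 s i l ⟨hl, hq⟩⟩
  case loop => exact ⟨_, _, rfl, .loop s i l ⟨hl, hq⟩⟩
  case testItem =>
    obtain ⟨x, v, hx⟩ := I.exists_pts_h hl O.2
    exact ⟨_, _, rfl, .testItem s i l x v ⟨hl, hq⟩ hx⟩
  case readAnn1 => exact ⟨_, _, rfl, .readAnn1 s i l ⟨hl, hq⟩⟩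
  case unannOther1 => exact ⟨_, _, rfl, .unannOther1 s i l ⟨hl, hq⟩⟩
  case setOld =>
    obtain ⟨x, hx, -⟩ := O.1.2.1
    obtain ⟨v, hv⟩ := Config.exists_of_view_item (L.g_allocated x hx)
    exact ⟨_, _, rfl, .setOld s i l x v ⟨hl, hq⟩ ⟨hx, hv⟩⟩
  case setNew =>
    obtain ⟨y, hy, -⟩ := O.2.2.2
    obtain ⟨x, v, hx⟩ := I.exists_pts_h hl (hy ▸ Option.some_ne_none y)
    exact ⟨_, _, rfl, .setNew s i l x v ⟨hl, hq⟩ hx⟩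
  case getNew =>
    obtain ⟨y, hy, -⟩ := O.2.2.1
    obtain ⟨x, v, hx⟩ := I.exists_pts_h hl (hy ▸ Option.some_ne_none y)
    cases hv : v.new with
    | mark => exact ⟨_, _, rfl, .getNewGone s i l x v ⟨hl, hq⟩ hx hv⟩
    | ptr z => exact ⟨_, _, rfl, .getNew s i l x v z ⟨hl, hq⟩ hx hv⟩
  case readAnn2 => exact ⟨_, _, rfl, .readAnn2 s i l ⟨hl, hq⟩⟩
  case unannPostMTF => exact ⟨_, _, rfl, .unannPostMTF s i l ⟨hl, hq⟩⟩
  case readAnn3 => exact ⟨_, _, rfl, .readAnn3 s i l ⟨hl, hq⟩⟩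
  case unannOther2 => exact ⟨_, _, rfl, .unannOther2 s i l ⟨hl, hq⟩⟩
  case next =>
    obtain ⟨y, hy, -⟩ := O.2
    obtain ⟨x, v, hx⟩ := I.exists_pts_h hl (hy ▸ Option.some_ne_none y)
    exact ⟨_, _, rfl, .next s i l x v ⟨hl, hq⟩ hx⟩
  case readAnn4 => exact ⟨_, _, rfl, .readAnn4 s i l ⟨hl, hq⟩⟩
  case unannEnd => exact ⟨_, _, rfl, .unannEnd s i l ⟨hl, hq⟩⟩
  case ret => exact ⟨_, _, rfl, .ret s i l ⟨hl, hq⟩⟩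
  all_goals first | exact absurd trivial hmoving | exact absurd trivial hhelping

end Inv

/-- The positions of a process that has not found its item. -/
def PC.Absent : PC → Prop
  | .allocate | .announce | .getHead | .testFront | .loop | .testItem | .readAnn3 | .next
  | .readAnn4 | .unannEnd | .ret => True
  | _ => False

/-- Number of positions before the start of the traversal. -/
def PC.stage : PC → ℕ
  | .allocate => 3
  | .announce => 2
  | .getHead => 1
  | _ => 0

/-- Bound on the number of steps before the traversal moves on to the next node or the search
returns. -/
def PC.weight : PC → ℕ
  | .testFront => 5
  | .loop => 4
  | .testItem | .readAnn4 => 3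
  | .readAnn3 | .unannEnd => 2
  | .next | .ret => 1
  | _ => 0

/-- A quantity that decreases with each step of a search for an item that is not in the list:
the traversal visits nodes of decreasing rank, and takes fewer than 8 steps at each. -/
def Loc.measure (ρ : Addr → ℕ) (l : Loc Item p) : ℕ ×ₗ ℕ :=
  toLex (l.pc.stage, 8 * l.h.elim 0 ρ + l.pc.weight)

theorem Loc.measure_lt_iff {ρ ρ' : Addr → ℕ} {l l' : Loc Item p} :
    l'.measure ρ' < l.measure ρ ↔ l'.pc.stage < l.pc.stage ∨ l'.pc.stage = l.pc.stage ∧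
      8 * l'.h.elim 0 ρ' + l'.pc.weight < 8 * l.h.elim 0 ρ + l.pc.weight :=
  Prod.Lex.toLex_lt_toLex

theorem Config.At.eq_of_proc {s t : Config Item p} {i : Fin p} {l l₀ l₁ l' : Loc Item p}
    {q : PC} (h : s.At i l₀ q) (hl : s.proc i = some l)
    (hl' : (t.setLoc i l₁).proc i = some l') : l₀ = l ∧ l₁ = l' ∧ l.pc = q := by
  obtain rfl : l₀ = l := Option.some.inj (h.1.symm.trans hl)
  exact ⟨rfl, Option.some.inj (Config.setLoc_proc_self.symm.trans hl'), h.2⟩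

namespace Inv

variable {s s' : Config Item p} {ρ ρ' : Addr → ℕ} {items : List Item}
  {seen : Fin p → Addr → Prop} {i : Fin p} {l l' : Loc Item p} {φ : ℕ}

theorem absent (I : Inv s ρ items seen) (hl : s.proc i = some l) (he : l.e ∉ items) :
    l.pc.Absent := by
  have L := I.loc i l hl
  have hmem : ∀ x, 0 < ρ x → (s.view ρ).item x ≠ some l.e := by
    intro x hx hxe
    obtain ⟨e, hmem, hxe'⟩ := I.shared.item_mem x hx
    exact he (Option.some.inj (hxe.symm.trans hxe') ▸ hmem)
  have hfound : ¬ (s.view ρ).Found l :=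
    fun ⟨x, hx, hxe⟩ => hmem x (L.h_passed x hx).1 hxe
  have hfront : ¬ (s.view ρ).AtFront l :=
    fun ⟨x, hx, hxe⟩ => hmem x (L.h1_seen x hx).1 hxe
  have hinformed : ¬ (s.view ρ).Informed seen i l :=
    fun ⟨x, _, _, hxe, hx⟩ => hmem x hx hxe
  have O := L.outline
  cases hq : l.pc <;>
    simp only [hq, View.Outline, View.Moving, View.Helping, View.Linked, View.Removing] at O <;>
    first | trivial | tauto

theorem measure_eq (I : Inv s ρ items seen) (hρ : ∀ x, 0 < ρ x → ρ' x = ρ x)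
    (hl : s.proc i = some l) : l.measure ρ' = l.measure ρ := by
  unfold Loc.measure
  cases hx : l.h with
  | none => rfl
  | some x => simp only [Option.elim_some, hρ x ((I.loc i l hl).h_passed x hx).1]

theorem next_elim_lt {x : Addr} {v : Node Item} (I : Inv s ρ items seen)
    (hρ : ∀ x, 0 < ρ x → ρ' x = ρ x) (hx : s.heap x = some v) (hx0 : 0 < ρ x) :
    v.next.elim 0 ρ' < ρ x := by
  cases hn : v.next with
  | none => exact hx0
  | some y =>
    obtain ⟨hy0, hyx⟩ := I.shared.next_lt x y hx0 ((Config.view_next hx).trans hn)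
    exact (hρ y hy0).trans_lt hyx

theorem measure_lt [DecidableEq Item] (I : Inv s ρ items seen)
    (hρ : ∀ x, 0 < ρ x → ρ' x = ρ x) {lab : Label Item p} (h : Step φ s lab s')
    (hi : lab.proc = i) (hl : s.proc i = some l) (hl' : s'.proc i = some l')
    (hA : l.pc.Absent) (hA' : l'.pc.Absent) : l'.measure ρ' < l.measure ρ := by
  rw [← I.measure_eq hρ hl, Loc.measure_lt_iff]
  cases h with
  | invoke i e h => cases hi; cases hl.symm.trans h
  | ret i l => cases hi; simp [Config.setIdle, Label.proc] at hl'
  | allocate i l x hm | announce i l hm | getHead i l hm =>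
    cases hi; obtain ⟨rfl, rfl, hq⟩ := hm.eq_of_proc hl hl'
    simp [hq, PC.stage]
  | testFront i l x v hm | testItem i l x v hm =>
    cases hi; obtain ⟨rfl, rfl, hq⟩ := hm.eq_of_proc hl hl'
    split_ifs at hA' ⊢ <;> first | exact False.elim hA' | simp [hq, PC.stage, PC.weight]
  | loop i l hm =>
    cases hi; obtain ⟨rfl, rfl, hq⟩ := hm.eq_of_proc hl hl'
    split_ifs <;> simp [hq, PC.stage, PC.weight]
  | readAnn3 i l hm =>
    cases hi; obtain ⟨rfl, rfl, hq⟩ := hm.eq_of_proc hl hl'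
    split_ifs at hA' ⊢ <;> first | exact False.elim hA' | simp [hq, PC.stage, PC.weight]
  | next i l x v hm hx =>
    cases hi; obtain ⟨rfl, rfl, hq⟩ := hm.eq_of_proc hl hl'
    have hx0 : 0 < ρ x := ((I.loc _ _ hm.1).h_passed x hx.1).1
    have hlt := I.next_elim_lt hρ hx.2 hx0
    refine .inr ⟨by simp only [hq, PC.stage], ?_⟩
    simp only [hq, hx.1, hρ x hx0, Option.elim_some, PC.weight]
    omega
  | readAnn4 i l hm | unannEnd i l hm =>
    cases hi; obtain ⟨rfl, rfl, hq⟩ := hm.eq_of_proc hl hl'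
    simp [hq, PC.stage, PC.weight]
  | _ =>
    cases hi
    obtain ⟨-, -, hq⟩ := Config.At.eq_of_proc (by assumption) hl hl'
    rw [hq] at hA; exact False.elim hA

end Inv

theorem Config.contains_of_view_item {s : Config Item p} {ρ : Addr → ℕ} {x : Addr} {e : Item}
    (h : (s.view ρ).item x = some e) : s.Contains (some x) e := by
  obtain ⟨v, hv⟩ := exists_of_view_item (h ▸ Option.some_ne_none e)
  exact ⟨x, v, ⟨rfl, hv⟩, Option.some.inj ((view_item hv).symm.trans h)⟩

theorem Config.Contains.unique {s : Config Item p} {a : Ptr} {e e' : Item}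
    (h : s.Contains a e) (h' : s.Contains a e') : e = e' := by
  obtain ⟨x, v, ⟨rfl, hv⟩, rfl⟩ := h
  obtain ⟨y, w, ⟨hy, hw⟩, rfl⟩ := h'
  cases hy
  rw [Option.some.inj (hv.symm.trans hw)]

theorem Inv.of_seen {s : Config Item p} {ρ : Addr → ℕ} {items : List Item}
    {seen seen' : Fin p → Addr → Prop} (I : Inv s ρ items seen)
    (h : ∀ i x, s.proc i ≠ none → seen i x → seen' i x) : Inv s ρ items seen' where
  shared := I.shared
  loc i l hl := (I.loc i l hl).of_seen fun j x hj => h j x fun hidle => by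
    obtain rfl | hj := hj
    · exact Option.some_ne_none l (hl.symm.trans hidle)
    · exact hj (congrArg Prod.snd (I.idle j hidle))
  idle := I.idle
  own := I.own

namespace Execution

variable [DecidableEq Item] {φ : ℕ} {items : List Item} {X : Execution p φ items}
  {k m t : ℕ} {i : Fin p} {e : Item} {r : Result} {a : Addr}

/-- Node `a` was at the front of the list at some time during the operation that process `i`
performs in configuration `t`. -/
def Seen (X : Execution p φ items) (t : ℕ) (i : Fin p) (a : Addr) : Prop :=
  ∃ t' ≤ t, (X.cfg t').head.1 = some a ∧ ∀ u, t' ≤ u → u ≤ t → (X.cfg u).proc i ≠ none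

theorem seen_of_head (ha : (X.cfg t).head.1 = some a) (hi : (X.cfg t).proc i ≠ none) :
    X.Seen t i a :=
  ⟨t, le_rfl, ha, fun _ h h' => le_antisymm h h' ▸ hi⟩

theorem Seen.succ (h : X.Seen t i a) (hi : (X.cfg (t + 1)).proc i ≠ none) :
    X.Seen (t + 1) i a := by
  obtain ⟨t', ht', ha, hbusy⟩ := h
  refine ⟨t', ht'.trans t.le_succ, ha, fun u hu hut => ?_⟩
  obtain hut | rfl := Nat.le_succ_iff.1 hut
  · exact hbusy u hu hut
  · exact hi

theorem Invokes.exists_time_of_seen (h : X.Invokes k i e) (hkm : k ≤ m) (ha : X.Seen m i a) :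
    ∃ t, k < t ∧ t ≤ m ∧ (X.cfg t).head.1 = some a := by
  obtain ⟨t, htm, ht, hbusy⟩ := ha
  refine ⟨t, not_le.1 fun htk => hbusy k htk hkm ?_, htm, ht⟩
  exact (h.2 ▸ X.step k h.1).exists_of_inv.1

theorem lt_of_succ_le (h : ((t + 1 : ℕ) : ℕ∞) ≤ X.len) : (t : ℕ∞) < X.len :=
  lt_of_lt_of_le (by exact_mod_cast Nat.lt_succ_self t) h

theorem exists_inv_succ {ρ : Addr → ℕ} (ht : (t : ℕ∞) < X.len)
    (I : Inv (X.cfg t) ρ items (X.Seen t)) :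
    ∃ ρ', Inv (X.cfg (t + 1)) ρ' items (X.Seen (t + 1)) ∧ ∀ x, 0 < ρ x → ρ' x = ρ x := by
  obtain ⟨ρ', I', hρ⟩ := I.step (fun j a hj ha => seen_of_head ha hj) (X.step t ht)
  exact ⟨ρ', I'.of_seen fun i x hi hx => hx.succ hi, hρ⟩

theorem exists_inv (hnodup : items.Nodup) (hlen : 2 ≤ items.length) (X : Execution p φ items) :
    ∃ ρ : ℕ → Addr → ℕ, (∀ t : ℕ, (t : ℕ∞) ≤ X.len → Inv (X.cfg t) (ρ t) items (X.Seen t)) ∧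
      ∀ t : ℕ, (t : ℕ∞) < X.len → ∀ x, 0 < ρ t x → ρ (t + 1) x = ρ t x := by
  choose! f hf using fun (t : ℕ) (ρ : Addr → ℕ) (ht : (t : ℕ∞) < X.len)
    (I : Inv (X.cfg t) ρ items (X.Seen t)) => exists_inv_succ ht I
  obtain ⟨ρ₀, h₀⟩ := X.init.exists_inv hnodup hlen (X.Seen 0)
  let ρ : ℕ → Addr → ℕ := fun t => Nat.rec ρ₀ f t
  have hI : ∀ t : ℕ, (t : ℕ∞) ≤ X.len → Inv (X.cfg t) (ρ t) items (X.Seen t) := by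
    intro t
    induction t with
    | zero => exact fun _ => h₀
    | succ t ih =>
      exact fun ht => (hf t (ρ t) (lt_of_succ_le ht) (ih (lt_of_succ_le ht).le)).1
  exact ⟨ρ, hI, fun t ht => (hf t (ρ t) ht (hI t ht.le)).2⟩

theorem finite_heap (X : Execution p φ items) (ht : (t : ℕ∞) ≤ X.len) :
    {x | (X.cfg t).heap x ≠ none}.Finite := by
  induction t with
  | zero =>
    obtain ⟨⟨addrs, -, -, -, h, -⟩, -⟩ := X.init
    exact (List.finite_toSet addrs).subset fun x hx => by_contra fun h' => hx (h x h')
  | succ t ih =>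
    exact (X.step t (lt_of_succ_le ht)).writesOne.finite_heap (ih (lt_of_succ_le ht).le)

theorem contains_of_le (hm : (m : ℕ∞) ≤ X.len) (htm : t ≤ m) {a : Ptr}
    (h : (X.cfg t).Contains a e) : (X.cfg m).Contains a e := by
  induction m, htm using Nat.le_induction with
  | base => exact h
  | succ m _ ih =>
    exact (X.step m (lt_of_succ_le hm)).writesOne.contains (ih (lt_of_succ_le hm).le)

theorem Invokes.unique {i' : Fin p} {e' : Item} (h : X.Invokes k i e) (h' : X.Invokes k i' e') :
    i = i' ∧ e = e' := by
  simpa using h.2.symm.trans h'.2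

theorem Returns.unique {m' : ℕ} {r' : Result} (h : X.Returns k m r) (h' : X.Returns k m' r') :
    m = m' ∧ r = r' := by
  obtain ⟨i, e, hinv, hkm, -, hret, hfirst⟩ := h
  obtain ⟨i', e', hinv', hkm', -, hret', hfirst'⟩ := h'
  obtain ⟨rfl, rfl⟩ := hinv.unique hinv'
  obtain h | rfl | h := lt_trichotomy m m'
  · exact absurd hret (hfirst' m r hkm h)
  · exact ⟨rfl, by simpa using hret.symm.trans hret'⟩
  · exact absurd hret' (hfirst m' r' hkm' h)

theorem Invokes.exists_loc (h : X.Invokes k i e) (hkt : k < t) (ht : (t : ℕ∞) ≤ X.len)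
    (hr : ∀ m r, k < m → m < t → X.lab m ≠ .ret i r) :
    ∃ l, (X.cfg t).proc i = some l ∧ l.e = e := by
  induction t, hkt using Nat.le_induction with
  | base => exact (h.2 ▸ X.step k h.1).exists_of_inv.2
  | succ t hkt ih =>
    obtain ⟨l, hl, rfl⟩ := ih (lt_of_succ_le ht).le fun m r hkm hmt => hr m r hkm (by omega)
    exact (X.step t (lt_of_succ_le ht)).exists_loc hl fun r => hr t r hkt (by omega)

theorem Returns.correctResult {ρ : Addr → ℕ} (h : X.Invokes k i e) (hr : X.Returns k m r)
    (I : Inv (X.cfg m) ρ items (X.Seen m)) :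
    ∃ l : Loc Item p, l.e = e ∧ l.res = r ∧
      ((X.cfg m).view ρ).CorrectResult items (X.Seen m) i l := by
  obtain ⟨i', e', h', hkm, hm, hret, hfirst⟩ := hr
  obtain ⟨rfl, rfl⟩ := h.unique h'
  obtain ⟨l, hl, rfl⟩ := h.exists_loc hkm hm.le hfirst
  obtain ⟨l', hl', rfl⟩ := (hret ▸ X.step m hm).exists_of_ret
  obtain rfl : l' = l := Option.some.inj (hl'.1.symm.trans hl)
  exact ⟨l', rfl, rfl, ((I.loc i l' hl).outline_at hl'.2).2⟩

theorem Returns.exists_time_contains (hnodup : items.Nodup) (hlen : 2 ≤ items.length)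
    (h : X.Invokes k i e) (hr : X.Returns k m r) (he : e ∈ items) :
    ∃ t, k < t ∧ t ≤ m ∧ (X.cfg t).Contains (X.cfg t).head.1 e ∧
      r = .pointer (X.cfg t).head.1 := by
  obtain ⟨ρ, hI, -⟩ := X.exists_inv hnodup hlen
  obtain ⟨-, -, -, hkm, hm, -⟩ := id hr
  obtain ⟨l, rfl, rfl, hfound, -⟩ := hr.correctResult h (hI m hm.le)
  obtain ⟨x, hres, hseen, hxe⟩ := hfound he
  obtain ⟨t, hkt, htm, ht⟩ := h.exists_time_of_seen hkm.le hseen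
  have I := hI t ((Nat.cast_le.2 htm).trans hm.le)
  obtain ⟨a, b, hab, hb, hba, -⟩ := I.shared.head
  obtain rfl : a = x := Option.some.inj ((congrArg Prod.fst hab).symm.trans ht)
  obtain ⟨e', -, hxe'⟩ := I.shared.item_mem a (hb.trans hba)
  have hc := Config.contains_of_view_item hxe'
  obtain rfl := (contains_of_le hm.le htm hc).unique (Config.contains_of_view_item hxe)
  exact ⟨t, hkt, htm, ht ▸ hc, ht ▸ hres⟩

theorem Returns.eq_notPresent (hnodup : items.Nodup) (hlen : 2 ≤ items.length)
    (h : X.Invokes k i e) (hr : X.Returns k m r) (he : e ∉ items) : r = .notPresent := by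
  obtain ⟨ρ, hI, -⟩ := X.exists_inv hnodup hlen
  obtain ⟨-, -, -, -, hm, -⟩ := id hr
  obtain ⟨l, rfl, rfl, -, hmissing⟩ := hr.correctResult h (hI m hm.le)
  exact hmissing he

end Execution

theorem Inv.measure_le [DecidableEq Item] {s s' : Config Item p} {ρ ρ' : Addr → ℕ}
    {items : List Item} {seen seen' : Fin p → Addr → Prop} {i : Fin p} {l l' : Loc Item p}
    {φ : ℕ} (I : Inv s ρ items seen) (I' : Inv s' ρ' items seen')
    (hρ : ∀ x, 0 < ρ x → ρ' x = ρ x) {lab : Label Item p} (h : Step φ s lab s')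
    (hl : s.proc i = some l) (hl' : s'.proc i = some l') (he : l.e ∉ items) (he' : l'.e = l.e) :
    l'.measure ρ' ≤ l.measure ρ ∧ (lab.proc = i → l'.measure ρ' < l.measure ρ) := by
  have hlt : lab.proc = i → l'.measure ρ' < l.measure ρ := fun hi =>
    I.measure_lt hρ h hi hl hl' (I.absent hl he) (I'.absent hl' (he' ▸ he))
  refine ⟨?_, hlt⟩
  obtain hi | hi := eq_or_ne lab.proc i
  · exact (hlt hi).le
  · obtain rfl : l' = l := Option.some.inj ((hl'.symm.trans (h.proc_of_ne hi)).trans hl)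
    exact (I.measure_eq hρ hl).le

theorem not_frequently_succ_lt {α : Type*} [PartialOrder α] [WellFoundedLT α] {f : ℕ → α} {k : ℕ}
    (hf : ∀ t, k ≤ t → f (t + 1) ≤ f t) : ¬ ∃ᶠ t in Filter.atTop, f (t + 1) < f t := by
  have hanti : Antitone fun n => f (k + n) := antitone_nat_of_succ_le fun n => hf (k + n) (by omega)
  obtain ⟨n, hn⟩ := WellFoundedLT.antitone_chain_condition hanti
  intro hlt
  obtain ⟨t, hnt, ht⟩ := Filter.frequently_atTop.1 hlt (k + n)
  obtain ⟨m, rfl⟩ := Nat.exists_eq_add_of_le (le_of_add_le_left hnt)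
  exact ht.ne ((hn (m + 1) (by omega)).symm.trans (hn m (by omega)))

namespace Execution

variable [DecidableEq Item] {φ : ℕ} {items : List Item} {X : Execution p φ items}
  {k m : ℕ} {i : Fin p} {e : Item} {r : Result}

theorem Invokes.exists_returns_of_ret (h : X.Invokes k i e) (hkm : k < m)
    (hm : (m : ℕ∞) < X.len) (hr : X.lab m = .ret i r) : ∃ m r, X.Returns k m r := by
  classical
  have hex : ∃ m, k < m ∧ (m : ℕ∞) < X.len ∧ ∃ r, X.lab m = .ret i r := ⟨m, hkm, hm, r, hr⟩
  obtain ⟨hk, hlt, r, hret⟩ := Nat.find_spec hex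
  refine ⟨Nat.find hex, r, i, e, h, hk, hlt, hret, fun m' r' hkm' hm' hr' => ?_⟩
  exact Nat.find_min hex hm' ⟨hkm', (Nat.cast_lt.2 hm').trans hlt, r', hr'⟩

theorem Invokes.exists_returns (hnodup : items.Nodup) (hlen : 2 ≤ items.length)
    (h : X.Invokes k i e) (he : e ∉ items) (hX : X.len = ⊤)
    (hf : ∃ᶠ m in Filter.atTop, (X.lab m).proc = i) : ∃ m r, X.Returns k m r := by
  obtain ⟨ρ, hI, hρ⟩ := X.exists_inv hnodup hlen
  have hlt : ∀ t : ℕ, (t : ℕ∞) < X.len := fun t => hX ▸ ENat.natCast_lt_top t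
  by_contra hnever
  have hloc : ∀ t, k < t → ∃ l, (X.cfg t).proc i = some l ∧ l.e = e := fun t hkt =>
    h.exists_loc hkt (hlt t).le fun m r hkm _ hr =>
      hnever (h.exists_returns_of_ret hkm (hlt m) hr)
  let μ : ℕ → ℕ ×ₗ ℕ := fun t => ((X.cfg t).proc i).elim (toLex (0, 0)) (Loc.measure (ρ t))
  have hμ : ∀ t, k < t → μ (t + 1) ≤ μ t ∧ ((X.lab t).proc = i → μ (t + 1) < μ t) := by
    intro t hkt
    obtain ⟨l, hl, rfl⟩ := hloc t hkt
    obtain ⟨l', hl', he'⟩ := hloc (t + 1) (hkt.trans t.lt_succ_self)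
    simp only [μ, hl, hl', Option.elim_some]
    exact (hI t (hlt t).le).measure_le (hI (t + 1) (hlt _).le) (hρ t (hlt t)) (X.step t (hlt t))
      hl hl' he he'
  refine not_frequently_succ_lt (fun t hkt => (hμ t hkt).1) ?_
  exact (hf.and_eventually (Filter.eventually_gt_atTop k)).mono fun t ht => (hμ t ht.2).2 ht.1

end Execution

theorem mem_seqRun [DecidableEq Item] {L es : List Item} {e : Item} :
    e ∈ seqRun L es ↔ e ∈ L := by
  induction es generalizing L with
  | nil => rfl
  | cons a es ih =>
    rw [show seqRun L (a :: es) = seqRun (seqState a L) es from rfl, ih, seqState]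
    split_ifs with h
    · obtain rfl | hea := eq_or_ne e a
      · simp [h]
      · simp [hea, List.mem_erase_of_ne]
    · rfl

theorem exists_pairwise_list {ι α : Type*} [LinearOrder α] {f : ι → α} (hf : f.Injective)
    {s : Set ι} (hs : s.Finite) :
    ∃ L : List ι, L.Pairwise (fun a b => f a < f b) ∧ ∀ a, a ∈ L ↔ a ∈ s := by
  let : LinearOrder ι := LinearOrder.lift' f hf
  exact ⟨hs.toFinset.sort, (Finset.sortedLT_sort _).pairwise, by simp⟩

namespace Execution

variable [DecidableEq Item] {φ : ℕ} {items : List Item} {X : Execution p φ items}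

/-- Configuration `t` is a suitable time to linearize the operation invoked at step `k`. -/
structure LinearizesAt (X : Execution p φ items) (k t : ℕ) : Prop where
  lt : k < t
  le : ∀ m r, X.Returns k m r → t ≤ m
  of_mem : ∀ i e, X.Invokes k i e → e ∈ items → ∀ m r, X.Returns k m r →
    (X.cfg t).Contains (X.cfg t).head.1 e ∧ r = .pointer (X.cfg t).head.1
  of_notMem : ∀ i e, X.Invokes k i e → e ∉ items → ∀ m r, X.Returns k m r → r = .notPresent

theorem exists_linearizesAt (hnodup : items.Nodup) (hlen : 2 ≤ items.length)
    (X : Execution p φ items) (k : ℕ) : ∃ t, X.LinearizesAt k t := by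
  have hnot := fun i e hinv he m r (hr : X.Returns k m r) =>
    hr.eq_notPresent (i := i) (e := e) hnodup hlen hinv he
  by_cases h : ∃ i e m r, X.Invokes k i e ∧ e ∈ items ∧ X.Returns k m r
  · obtain ⟨i, e, m, r, hinv, he, hr⟩ := h
    obtain ⟨t, hkt, htm, hc, hres⟩ := hr.exists_time_contains hnodup hlen hinv he
    refine ⟨t, hkt, fun m' r' hr' => (hr.unique hr').1 ▸ htm, fun i' e' hinv' _ m' r' hr' => ?_,
      hnot⟩
    obtain ⟨-, rfl⟩ := hinv.unique hinv'
    exact ⟨hc, (hr.unique hr').2 ▸ hres⟩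
  · refine ⟨k + 1, k.lt_succ_self, fun m r hr => ?_, fun i e hinv he m r hr => ?_, hnot⟩
    · obtain ⟨-, -, -, hkm, -⟩ := hr
      exact hkm
    · exact absurd ⟨i, e, m, r, hinv, he, hr⟩ h

/-- The linearization points given the times `T`. Operations linearized in the same configuration
are ordered by invocation, but any order would do. -/
def point (T : ℕ → ℕ) (k : ℕ) : ℕ ×ₗ ℕ :=
  toLex (T k, k)

theorem point_injective (T : ℕ → ℕ) : (point T).Injective := fun _ _ h =>
  (Prod.mk.inj (toLex.injective h)).2

theorem finite_point_lt {T : ℕ → ℕ} (hT : ∀ k, k < T k) (q : ℕ ×ₗ ℕ) :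
    {a | point T a < q}.Finite := by
  refine (Set.finite_Iic (ofLex q).1).subset fun a ha => (hT a).le.trans ?_
  exact Prod.Lex.monotone_fst_ofLex ha.le

theorem isLinearization_point {T : ℕ → ℕ} (hT : ∀ k, X.LinearizesAt k (T k)) :
    X.IsLinearization {k | ∃ m r, X.Returns k m r} (point T) where
  isOp := fun k ⟨_, _, i, e, h, _⟩ => ⟨i, e, h⟩
  complete k m r h := ⟨m, r, h⟩
  distinct := (point_injective T).injOn
  within := fun k ⟨m, r, hr⟩ => by
    have hTm := (hT k).le m r hr
    obtain ⟨-, -, -, -, hm, -⟩ := hr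
    exact (Nat.cast_le.2 hTm).trans hm.le
  after k _ := (hT k).lt
  before k := (hT k).le
  legal k m i e r hinv hr := by
    obtain ⟨prior, hsorted, hmem⟩ := exists_pairwise_list (point_injective T)
      ((finite_point_lt (fun k => (hT k).lt) (point T k)).inter_of_right
        {k | ∃ m r, X.Returns k m r})
    refine ⟨prior, hsorted, hmem, ?_⟩
    simp only [seqResponse, mem_seqRun]
    split_ifs with he
    · obtain ⟨hc, rfl⟩ := (hT k).of_mem i e hinv he m r hr
      have hTm := (hT k).le m _ hr
      obtain ⟨-, -, -, -, hm, -⟩ := hr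
      exact contains_of_le hm.le hTm hc
    · rw [(hT k).of_notMem i e hinv he m r hr]
      trivial

end Execution

end DMTF

theorem mainTheorem7 {Item : Type*} [DecidableEq Item] (p φ : ℕ) (hφ : 1 ≤ φ)
    (items : List Item) (hnodup : items.Nodup) (hlen : 2 ≤ items.length)
    (X : DMTF.Execution p φ items) :
    -- the execution is linearizable
    (∃ (ops : Set ℕ) (pt : ℕ → ℕ ×ₗ ℕ), X.IsLinearization ops pt ∧
      ∀ k ∈ ops, ∀ i e, X.Invokes k i e →
        -- an item of the set is at the front when the operation is linearized, and the operation
        -- returns a pointer to the front node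
        (e ∈ items →
          (X.cfg (ofLex (pt k)).1).Contains (X.cfg (ofLex (pt k)).1).head.1 e ∧
          ∀ m r, X.Returns k m r → r = .pointer (X.cfg (ofLex (pt k)).1).head.1) ∧
        -- a search for any other item returns NOT PRESENT
        (e ∉ items → ∀ m r, X.Returns k m r → r = .notPresent)) ∧
    -- a search for an item outside the set does return unless its process crashes
    (∀ k i e, X.Invokes k i e → e ∉ items → X.len = ⊤ →
      (∃ᶠ m in Filter.atTop, (X.lab m).proc = i) → ∃ m, X.Returns k m .notPresent) ∧
    -- a process that is performing an operation always has a next step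
    (∀ t : ℕ, (t : ℕ∞) ≤ X.len → ∀ i l, (X.cfg t).proc i = some l →
      ∃ lab s, lab.proc = i ∧ DMTF.Step φ (X.cfg t) lab s) := by
  refine ⟨?_, fun k i e h he hX hf => ?_, fun t ht i l hl => ?_⟩
  · choose T hT using X.exists_linearizesAt hnodup hlen
    refine ⟨_, _, DMTF.Execution.isLinearization_point hT, ?_⟩
    rintro k ⟨m, r, hr⟩ i e hinv
    exact ⟨fun he => ⟨((hT k).of_mem i e hinv he m r hr).1,
      fun m' r' hr' => ((hT k).of_mem i e hinv he m' r' hr').2⟩, (hT k).of_notMem i e hinv⟩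
  · obtain ⟨m, r, hr⟩ := h.exists_returns hnodup hlen he hX hf
    exact ⟨m, hr.eq_notPresent hnodup hlen h he ▸ hr⟩
  · obtain ⟨ρ, hI, -⟩ := X.exists_inv hnodup hlen
    exact (hI t ht).enabled φ (X.finite_heap ht) hl
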